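/- Let $m$ be Lebesgue measure on $[0,1]$, let $L^0$ be the space of real Lebesgue measurable functions on $[0,1]$ (modulo a.e. equality), and let $p\colon[0,1]\to(1,\infty)$ be Lebesgue measurable. For $f\in L^0$ and $x_0\ge 0$, a solution with initial value $x_0$ is an absolutely continuous $\varphi\colon[0,1]\to[0,\infty)$ such that the integrand below is integrable and $$\varphi(T)=x_0+\int_0^T\frac{|f(t)|^{p(t)}}{p(t)}\,\varphi(t)^{1-p(t)}\,dt\qquad\text{for all }T\in[0,1],$$ with the convention $0^s=0$ for $s\neq 0$. A $0^+$-solution for $f$ is a function $\varphi_f$ such that a solution $\varphi_{x_0}$ exists for every initial value $x_0>0$, $\varphi_{x_0}(t)\to\varphi_f(t)$ as $x_0\searrow0$ for every $t\in[0,1]$, and $\varphi_f$ is a solution with initial value $0$; it is unique if it exists. Let $L^{p(\cdot)}\subset L^0$ be the class of all $f$ having a $0^+$-solution, and put $\|f\|_{p(\cdot)}=\varphi_f(1)$ for such $f$. (In general $L^{p(\cdot)}$ need not be a linear space.) Let $L^{p(\cdot)}_0\subset L^{p(\cdot)}$ be the closure of $\bigcup_{n\in\mathbb N}\{1_{\{p\le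 n\}}h : h\in L^{p(\cdot)}\}$, that is, the set of all $f\in L^{p(\cdot)}$ such that for every $\varepsilon>0$ there is $g$ in this union with $f-g\in L^{p(\cdot)}$ and $\|f-g\|_{p(\cdot)}<\varepsilon$. We say that $L^{p(\cdot)}_0$ contains a Banach space $X$ almost isometrically if for every $\varepsilon>0$ there is a linear map $T\colon X\to L^0$ with $T(X)\subset L^{p(\cdot)}_0$ and $\|x\|\le\|Tx\|_{p(\cdot)}\le(1+\varepsilon)\|x\|$ for all $x\in X$. Theorem. The following four conditions are equivalent: (1) $L^{p(\cdot)}$ is a linear space, $\|\cdot\|_{p(\cdot)}$ is a complete norm on it, and the resulting Banach space is uniformly convex and uniformly smooth; (2) $L^{p(\cdot)}$ is a linear space, $\|\cdot\|_{p(\cdot)}$ is a complete norm on it, and the resulting Banach space is reflexive; (3) $L^{p(\cdot)}_0$ contains neither $\ell^1$ nor $c_0$ almost isometrically; (4) $\operatorname{ess\,inf}_{t}p(t)>1$ and $\operatorname{ess\,sup}_{t}p(t)<\infty$. -/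

import Mathlib

open MeasureTheory Filter Topology Set
open scoped ZeroAtInfty

noncomputable section

namespace VarExp

/-- Lebesgue measure on the unit interval `[0,1]`. -/
abbrev unitMeasure : Measure ℝ := volume.restrict (Icc (0 : ℝ) 1)

/-- `L⁰`: classes (modulo a.e. equality) of Lebesgue measurable real functions on `[0,1]`. -/
abbrev LZero : Type := ℝ →ₘ[unitMeasure] ℝ

/-- The right-hand side `|f(t)|^{p(t)} / p(t) * φ(t)^{1-p(t)}` of the differential equation. -/
def rhs (p : ℝ → ℝ) (f : LZero) (φ : ℝ → ℝ) (t : ℝ) : ℝ :=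
  |f t| ^ p t / p t * φ t ^ (1 - p t)

/-- `φ : [0,1] → [0,∞)` is a Carathéodory solution of
`φ(0) = x₀`, `φ'(t) = |f(t)|^{p(t)} / p(t) * φ(t)^{1-p(t)}` for a.e. `t ∈ [0,1]`.
Only the values of `φ` on `[0,1]` matter. -/
structure IsSolution (p : ℝ → ℝ) (f : LZero) (x₀ : ℝ) (φ : ℝ → ℝ) : Prop where
  absCont : AbsolutelyContinuousOnInterval φ 0 1
  nonneg : ∀ t ∈ Icc (0 : ℝ) 1, 0 ≤ φ t
  integrable : IntervalIntegrable (rhs p f φ) volume 0 1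
  eq_integral : ∀ T ∈ Icc (0 : ℝ) 1, φ T = x₀ + ∫ t in (0 : ℝ)..T, rhs p f φ t

/-- `φ` is the solution with initial value `φ(0) = 0⁺`: solutions exist for all positive initial
values `x₀`, they converge pointwise to `φ` as `x₀ ↘ 0`, and `φ` solves the equation. -/
structure IsZeroPlusSolution (p : ℝ → ℝ) (f : LZero) (φ : ℝ → ℝ) : Prop where
  isSolution : IsSolution p f 0 φ
  limit : ∃ Φ : ℝ → ℝ → ℝ, (∀ x₀ > 0, IsSolution p f x₀ (Φ x₀)) ∧
    ∀ t ∈ Icc (0 : ℝ) 1, Tendsto (fun x₀ => Φ x₀ t) (𝓝[>] 0) (𝓝 (φ t))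

/-- The class `L^{p(·)}` of those `f ∈ L⁰` which admit a `0⁺`-solution `φ_f` on `[0,1]`. -/
def lpClass (p : ℝ → ℝ) : Set LZero :=
  {f | ∃ φ, IsZeroPlusSolution p f φ}

open Classical in
/-- `‖f‖_{p(·)} = φ_f(1)` for `f ∈ L^{p(·)}` (and the junk value `0` for other `f`).
The value does not depend on the choice, since `φ_f` is unique on `[0,1]`. -/
def lpNorm (p : ℝ → ℝ) (f : LZero) : ℝ :=
  if h : f ∈ lpClass p then h.choose 1 else 0

/-- The functions `1_{p(t) ≤ n} h`, where `h ∈ L^{p(·)}`. -/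
def truncations (p : ℝ → ℝ) (n : ℕ) : Set LZero :=
  {g | ∃ h ∈ lpClass p, g =ᵐ[unitMeasure] {t | p t ≤ n}.indicator h}

/-- `L₀^{p(·)}`: the closure of `⋃ₙ {1_{p(t) ≤ n} h : h ∈ L^{p(·)}}` in `L^{p(·)}`,
with respect to `‖·‖_{p(·)}`. -/
def lpZeroClass (p : ℝ → ℝ) : Set LZero :=
  {f | f ∈ lpClass p ∧ ∀ ε > 0, ∃ g ∈ ⋃ n : ℕ, truncations p n,
    f - g ∈ lpClass p ∧ lpNorm p (f - g) < ε}

/-- The class `C ⊆ L⁰` is a linear subspace and the functional `N` is a norm on it. -/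
structure IsNormedFunctionSpace (C : Set LZero) (N : LZero → ℝ) : Prop where
  zero_mem : (0 : LZero) ∈ C
  add_mem : ∀ f ∈ C, ∀ g ∈ C, f + g ∈ C
  smul_mem : ∀ (c : ℝ), ∀ f ∈ C, c • f ∈ C
  norm_nonneg : ∀ f ∈ C, 0 ≤ N f
  norm_smul : ∀ (c : ℝ), ∀ f ∈ C, N (c • f) = |c| * N f
  norm_add_le : ∀ f ∈ C, ∀ g ∈ C, N (f + g) ≤ N f + N g
  norm_eq_zero_iff : ∀ f ∈ C, N f = 0 ↔ f = 0

section Space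

variable {C : Set LZero} {N : LZero → ℝ}

/-- The class `C` as a linear subspace of `L⁰`. -/
def IsNormedFunctionSpace.toSubmodule (h : IsNormedFunctionSpace C N) : Submodule ℝ LZero where
  carrier := C
  zero_mem' := h.zero_mem
  add_mem' := fun {f g} hf hg => h.add_mem f hf g hg
  smul_mem' := fun c f hf => h.smul_mem c f hf

/-- The class `C` as a normed space, with the norm `N`. -/
def IsNormedFunctionSpace.Space (h : IsNormedFunctionSpace C N) : Type := h.toSubmodule

instance (h : IsNormedFunctionSpace C N) : AddCommGroup h.Space :=
  inferInstanceAs (AddCommGroup h.toSubmodule)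

instance (h : IsNormedFunctionSpace C N) : Module ℝ h.Space :=
  inferInstanceAs (Module ℝ h.toSubmodule)

instance (h : IsNormedFunctionSpace C N) : Norm h.Space :=
  ⟨fun f => N f.1⟩

theorem IsNormedFunctionSpace.core (h : IsNormedFunctionSpace C N) :
    NormedSpace.Core ℝ h.Space where
  norm_nonneg f := h.norm_nonneg f.1 f.2
  norm_smul c f := h.norm_smul c f.1 f.2
  norm_triangle f g := h.norm_add_le f.1 f.2 g.1 g.2
  norm_eq_zero_iff f := (h.norm_eq_zero_iff f.1 f.2).trans
    (Subtype.ext_iff (a1 := f) (a2 := (0 : h.toSubmodule))).symm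

instance (h : IsNormedFunctionSpace C N) : NormedAddCommGroup h.Space :=
  NormedAddCommGroup.ofCore h.core

instance (h : IsNormedFunctionSpace C N) : NormedSpace ℝ h.Space :=
  NormedSpace.ofCore h.core

end Space

/-- Uniform smoothness: `‖x + y‖ + ‖x - y‖ ≤ 2 + ε ‖y‖` for all `‖x‖ = 1` and all `y` of
sufficiently small norm, uniformly in `x`. -/
def IsUniformlySmooth (E : Type*) [NormedAddCommGroup E] : Prop :=
  ∀ ε : ℝ, 0 < ε → ∃ δ : ℝ, 0 < δ ∧ ∀ x y : E, ‖x‖ = 1 → ‖y‖ ≤ δ →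
    ‖x + y‖ + ‖x - y‖ ≤ 2 + ε * ‖y‖

/-- Reflexivity: the canonical map of `E` into its bidual is surjective. -/
def IsReflexiveSpace (E : Type*) [NormedAddCommGroup E] [NormedSpace ℝ E] : Prop :=
  Function.Surjective (NormedSpace.inclusionInDoubleDual ℝ E)

/-- The function class `C`, with the functional `N` as its norm, contains the normed space `X`
almost isometrically: for every `ε > 0` there is a linear `(1 + ε)`-isomorphic embedding. -/
def ContainsAlmostIsometrically (C : Set LZero) (N : LZero → ℝ)
    (X : Type*) [NormedAddCommGroup X] [NormedSpace ℝ X] : Prop :=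
  ∀ ε : ℝ, 0 < ε → ∃ T : X →ₗ[ℝ] LZero,
    ∀ x, T x ∈ C ∧ ‖x‖ ≤ N (T x) ∧ N (T x) ≤ (1 + ε) * ‖x‖

end VarExp

end

/-!
The argument rests on one comparison principle for absolutely continuous functions
(`le_of_deriv_le_of_lt`). For positive initial values the equation is a regular one: its solutions
are unique, increase with `|f|` and with the initial value, and exist as soon as all multiples of
`f` have finite modular `∫ |f|^{p(t)} / p(t) dt`. If solutions exist for all positive initial
values, their limit at `0⁺` automatically solves the equation (`mem_lpClass_of_forall_exists`), so
that only this existence matters for membership in the class.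

**Convexity and concavity.** Let `α`, `β`, `γ` be solutions for `f`, `g`, `h`. If `p ≥ s` and
`|h|^s ≤ |f|^s + |g|^s`, then Jensen's inequality for `x ↦ x^{p(t)/s}` says that `log (γ^s)` grows
at most as fast as `log (α^s + β^s)` at the times when it is the larger of the two. So
`‖h‖^s ≤ ‖f‖^s + ‖g‖^s` (`lpNorm_rpow_le_add`); the case `s = 1` is the triangle inequality. For
`p ≤ s` all inequalities are reversed (`add_le_lpNorm_rpow`). These two facts carry the rest.

**Bounded exponents give a uniformly convex and uniformly smooth Banach space.** If `p` is
essentially bounded, the class is a linear space because membership amounts to a finite modular of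
some multiple, and it is complete by the Riesz–Fischer argument (`completeSpace`). If moreover
`s ≤ p ≤ r` with `1 < s ≤ 2 ≤ r`, the norm is `s`-convex and `r`-concave with constants one. The
pointwise power mean of `|f|` and `|g|` then transfers the scalar inequalities
`exists_two_point_convex` and `exists_two_point_smooth` to norms, which is uniform convexity
(`uniformConvexSpace`) and uniform smoothness (`isUniformlySmooth`).

**From uniform convexity to the absence of `ℓ¹` and `c₀`.** A complete uniformly convex space is
reflexive by the Milman–Pettis theorem (`isReflexiveSpace_of_uniformConvexSpace`). A bounded sequence
in a reflexive space has a point common to the closed convex hulls of all its tails; the unit vector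
basis of `ℓ¹` and the summing basis of `c₀` have no such point, and an embedding preserves this
(`IsReflexiveSpace.false_of_lp_one_embedding`, `IsReflexiveSpace.false_of_c₀_embedding`).

**Unbounded behaviour of the exponent produces `ℓ¹` or `c₀`.** If `ess inf p = 1`, there are
disjoint sets of positive measure on which `p` tends to `1` as fast as desired. Their normalized
indicator functions span a copy of `ℓ¹`: the upper bound is the triangle inequality, and in the lower
bound, where the blocks are split off one by one, `r`-concavity with `r` close to `1` costs at each
step a factor as close to one as desired (`containsAlmostIsometrically_lp_one`). If
`ess sup p = ∞`, sets on which `p` tends to infinity span a copy of `c₀`: the lower bound is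
monotonicity, and the upper bound comes from `s`-convexity with large `s`
(`containsAlmostIsometrically_c₀`). The images are finite elements, on which the norm is order
continuous (`tendsto_lpNorm_zero`), and so they lie in the closure of the functions supported in
sets where `p` is bounded.
-/

noncomputable section

namespace VarExp

/-! ### Absolutely continuous functions on the unit interval -/

section

theorem ae_mem_Ioo : ∀ᵐ t ∂unitMeasure, t ∈ Ioo (0 : ℝ) 1 := by
  have : (volume.restrict (Icc (0 : ℝ) 1)) = volume.restrict (Ioo (0 : ℝ) 1) :=
    Measure.restrict_congr_set Ioo_ae_eq_Icc.symm
  rw [unitMeasure, this]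
  exact ae_restrict_mem measurableSet_Ioo

theorem ae_mem_Icc : ∀ᵐ t ∂unitMeasure, t ∈ Icc (0 : ℝ) 1 :=
  ae_restrict_mem measurableSet_Icc

theorem unitMeasure_restrict_Ioc {S T : ℝ} (hS : 0 ≤ S) (hT : T ≤ 1) :
    unitMeasure.restrict (Ioc S T) = volume.restrict (Ioc S T) := by
  rw [unitMeasure, Measure.restrict_restrict measurableSet_Ioc]
  congr 1
  exact inter_eq_left.2 (fun x hx => ⟨hS.trans hx.1.le, hx.2.trans hT⟩)

theorem intervalIntegrable_iff_integrable {f : ℝ → ℝ} :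
    IntervalIntegrable f volume 0 1 ↔ Integrable f unitMeasure := by
  rw [intervalIntegrable_iff_integrableOn_Icc_of_le zero_le_one, IntegrableOn]

theorem intervalIntegral_eq_integral {f : ℝ → ℝ} :
    ∫ t in (0 : ℝ)..1, f t = ∫ t, f t ∂unitMeasure := by
  rw [intervalIntegral.integral_of_le zero_le_one, integral_Icc_eq_integral_Ioc]

/-- Post-composition with a function that is Lipschitz on the range preserves absolute
continuity. -/
theorem _root_.LipschitzOnWith.comp_absolutelyContinuousOnInterval {g φ : ℝ → ℝ} {K : NNReal}
    {s : Set ℝ} {a b : ℝ} (hg : LipschitzOnWith K g s) (hφ : AbsolutelyContinuousOnInterval φ a b)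
    (hs : MapsTo φ (uIcc a b) s) : AbsolutelyContinuousOnInterval (fun t => g (φ t)) a b := by
  rw [absolutelyContinuousOnInterval_iff] at hφ ⊢
  intro ε hε
  obtain ⟨δ, hδ, h⟩ := hφ (ε / (K + 1)) (by positivity)
  refine ⟨δ, hδ, fun E hE hlt => ?_⟩
  have h1 := h E hE hlt
  have hmem := hE.1
  calc ∑ i ∈ Finset.range E.1, dist (g (φ (E.2 i).1)) (g (φ (E.2 i).2))
      ≤ ∑ i ∈ Finset.range E.1, K * dist (φ (E.2 i).1) (φ (E.2 i).2) :=
        Finset.sum_le_sum fun i hi =>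
          hg.dist_le_mul _ (hs (hmem i hi).1) _ (hs (hmem i hi).2)
    _ = K * ∑ i ∈ Finset.range E.1, dist (φ (E.2 i).1) (φ (E.2 i).2) := by
        rw [Finset.mul_sum]
    _ ≤ (K + 1) * ∑ i ∈ Finset.range E.1, dist (φ (E.2 i).1) (φ (E.2 i).2) := by
        gcongr
        linarith
    _ < (K + 1) * (ε / (K + 1)) := by gcongr
    _ = ε := by field_simp

theorem absolutelyContinuousOnInterval_log {φ : ℝ → ℝ} {a : ℝ} (ha : 0 < a)
    (hφ : AbsolutelyContinuousOnInterval φ 0 1) (h : ∀ t ∈ Icc (0 : ℝ) 1, a ≤ φ t) :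
    AbsolutelyContinuousOnInterval (fun t => Real.log (φ t)) 0 1 := by
  have hL : LipschitzOnWith (Real.toNNReal a⁻¹) Real.log (Ici a) := by
    refine Convex.lipschitzOnWith_of_nnnorm_deriv_le (𝕜 := ℝ) (fun x hx => ?_) (fun x hx => ?_)
      (convex_Ici a)
    · exact Real.differentiableAt_log (ha.trans_le hx).ne'
    · rw [Real.deriv_log, ← NNReal.coe_le_coe, coe_nnnorm, Real.norm_eq_abs,
        Real.coe_toNNReal _ (inv_nonneg.2 ha.le), abs_of_pos (inv_pos.2 (ha.trans_le hx))]
      exact inv_anti₀ ha hx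
  refine hL.comp_absolutelyContinuousOnInterval hφ ?_
  rw [uIcc_of_le zero_le_one]
  exact h

theorem absolutelyContinuousOnInterval_rpow {φ : ℝ → ℝ} {a s : ℝ} (ha : 0 < a)
    (hs : 1 ≤ s) (hφ : AbsolutelyContinuousOnInterval φ 0 1)
    (h : ∀ t ∈ Icc (0 : ℝ) 1, a ≤ φ t) :
    AbsolutelyContinuousOnInterval (fun t => φ t ^ s) 0 1 := by
  obtain ⟨M, hM⟩ := hφ.exists_bound
  rw [uIcc_of_le zero_le_one] at hM
  have hL : LipschitzOnWith (Real.toNNReal (s * M ^ (s - 1))) (fun x => x ^ s) (Icc a M) := by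
    refine Convex.lipschitzOnWith_of_nnnorm_deriv_le (𝕜 := ℝ) (fun x hx => ?_) (fun x hx => ?_)
      (convex_Icc a M)
    · exact (Real.hasDerivAt_rpow_const (Or.inl (ha.trans_le hx.1).ne')).differentiableAt
    · have hx0 : 0 < x := ha.trans_le hx.1
      have hM0 : 0 < M := hx0.trans_le hx.2
      rw [(Real.hasDerivAt_rpow_const (Or.inl hx0.ne')).deriv, ← NNReal.coe_le_coe, coe_nnnorm,
        Real.norm_eq_abs, Real.coe_toNNReal _ (by positivity), abs_of_pos (by positivity)]
      gcongr
      exact hx.2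
  refine hL.comp_absolutelyContinuousOnInterval hφ ?_
  rw [uIcc_of_le zero_le_one]
  exact fun t ht => ⟨h t ht, (le_abs_self _).trans (hM t ht)⟩

/-- Comparison principle: an absolutely continuous function which starts below another one and
grows at most as fast at the times when it is above stays below. -/
theorem le_of_deriv_le_of_lt {u v : ℝ → ℝ} (hu : AbsolutelyContinuousOnInterval u 0 1)
    (hv : AbsolutelyContinuousOnInterval v 0 1) (h0 : u 0 ≤ v 0)
    (h : ∀ᵐ t ∂unitMeasure, v t < u t → deriv u t ≤ deriv v t) :
    ∀ t ∈ Icc (0 : ℝ) 1, u t ≤ v t := by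
  intro T hT
  by_contra! hlt
  have hcont : ContinuousOn (fun t => v t - u t) (Icc 0 T) := by
    have h1 := hu.continuousOn
    have h2 := hv.continuousOn
    rw [uIcc_of_le zero_le_one] at h1 h2
    exact (h2.sub h1).mono (Icc_subset_Icc_right hT.2)
  -- the last time before `T` at which `u ≤ v`
  set A : Set ℝ := Icc 0 T ∩ (fun t => v t - u t) ⁻¹' Ici 0 with hA
  have hAcl : IsClosed A := hcont.preimage_isClosed_of_isClosed isClosed_Icc isClosed_Ici
  have hAne : A.Nonempty := ⟨0, ⟨le_refl _, hT.1⟩, by simpa using h0⟩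
  have hAcpt : IsCompact A := isCompact_Icc.of_isClosed_subset hAcl inter_subset_left
  obtain ⟨S, hSA, hSmax⟩ := hAcpt.exists_isGreatest hAne
  have hS0 : 0 ≤ S := hSA.1.1
  have hST : S ≤ T := hSA.1.2
  have hSle : u S ≤ v S := by simpa using hSA.2
  have hsub : uIcc S T ⊆ uIcc 0 1 := by
    rw [uIcc_of_le hST, uIcc_of_le zero_le_one]
    exact Icc_subset_Icc hS0 hT.2
  have hu' := hu.mono hsub
  have hv' := hv.mono hsub
  have key : ∫ t in S..T, deriv u t ≤ ∫ t in S..T, deriv v t := by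
    refine intervalIntegral.integral_mono_ae_restrict hST hu'.intervalIntegrable_deriv
      hv'.intervalIntegrable_deriv ?_
    rw [← restrict_Ioc_eq_restrict_Icc, ← unitMeasure_restrict_Ioc hS0 hT.2]
    filter_upwards [ae_restrict_of_ae h, ae_restrict_mem measurableSet_Ioc] with t ht htm
    refine ht ?_
    by_contra! hc
    exact absurd (hSmax ⟨⟨hS0.trans htm.1.le, htm.2⟩, by simpa using hc⟩) (not_le.2 htm.1)
  rw [hu'.integral_deriv_eq_sub, hv'.integral_deriv_eq_sub] at key
  linarith

/-! ### Solutions with positive initial value -/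

variable {p : ℝ → ℝ} {f g : LZero} {a b : ℝ} {φ ψ : ℝ → ℝ}

theorem rhs_nonneg (hp : ∀ t ∈ Icc (0 : ℝ) 1, 1 < p t) (hφ : ∀ t ∈ Icc (0 : ℝ) 1, 0 ≤ φ t)
    {t : ℝ} (ht : t ∈ Icc (0 : ℝ) 1) : 0 ≤ rhs p f φ t := by
  have := hp t ht
  have := hφ t ht
  unfold rhs
  positivity

theorem IsSolution.map_zero (h : IsSolution p f a φ) : φ 0 = a := by
  simpa using h.eq_integral 0 ⟨le_refl _, zero_le_one⟩

theorem IsSolution.intervalIntegrable (h : IsSolution p f a φ) {S T : ℝ} (hS : 0 ≤ S)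
    (hST : S ≤ T) (hT : T ≤ 1) : IntervalIntegrable (rhs p f φ) volume S T := by
  refine h.integrable.mono_set ?_
  rw [uIcc_of_le hST, uIcc_of_le zero_le_one]
  exact Icc_subset_Icc hS hT

theorem IsSolution.monotoneOn (hp : ∀ t ∈ Icc (0 : ℝ) 1, 1 < p t) (h : IsSolution p f a φ) :
    MonotoneOn φ (Icc 0 1) := by
  intro S hS T hT hST
  have h1 : ∫ t in S..T, rhs p f φ t = φ T - φ S := by
    rw [h.eq_integral S hS, h.eq_integral T hT,
      ← intervalIntegral.integral_add_adjacent_intervals (b := S)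
        (h.intervalIntegrable le_rfl hS.1 hS.2) (h.intervalIntegrable hS.1 hST hT.2)]
    ring
  have h2 : 0 ≤ ∫ t in S..T, rhs p f φ t :=
    intervalIntegral.integral_nonneg hST fun t ht =>
      rhs_nonneg hp h.nonneg ⟨hS.1.trans ht.1, ht.2.trans hT.2⟩
  linarith

theorem IsSolution.initial_le (hp : ∀ t ∈ Icc (0 : ℝ) 1, 1 < p t) (h : IsSolution p f a φ) {t : ℝ}
    (ht : t ∈ Icc (0 : ℝ) 1) : a ≤ φ t :=
  h.map_zero ▸ h.monotoneOn hp ⟨le_rfl, zero_le_one⟩ ht ht.1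

theorem IsSolution.le_one (hp : ∀ t ∈ Icc (0 : ℝ) 1, 1 < p t) (h : IsSolution p f a φ) {t : ℝ}
    (ht : t ∈ Icc (0 : ℝ) 1) : φ t ≤ φ 1 :=
  h.monotoneOn hp ht ⟨zero_le_one, le_rfl⟩ ht.2

theorem IsSolution.integrable_rhs (h : IsSolution p f a φ) :
    Integrable (rhs p f φ) unitMeasure :=
  intervalIntegrable_iff_integrable.1 h.integrable

theorem IsSolution.apply_one (h : IsSolution p f a φ) :
    φ 1 = a + ∫ t, rhs p f φ t ∂unitMeasure := by
  rw [← intervalIntegral_eq_integral]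
  exact h.eq_integral 1 ⟨zero_le_one, le_rfl⟩

theorem IsSolution.ae_hasDerivAt (h : IsSolution p f a φ) :
    ∀ᵐ t ∂unitMeasure, HasDerivAt φ (rhs p f φ t) t := by
  have h1 := ae_restrict_of_ae (s := Icc (0 : ℝ) 1) h.integrable.ae_hasDerivAt_integral
  filter_upwards [h1, ae_mem_Ioo] with t ht htm
  have h2 := ht (by rw [uIcc_of_le zero_le_one]; exact Ioo_subset_Icc_self htm) 0 (by simp)
  refine (h2.const_add a).congr_of_eventuallyEq ?_
  filter_upwards [isOpen_Ioo.mem_nhds htm] with s hs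
  exact h.eq_integral s (Ioo_subset_Icc_self hs)

/-- An absolutely continuous nonnegative function satisfying the integral equation; the absolute
continuity is automatic. -/
theorem IsSolution.of_integral (hint : Integrable (rhs p f φ) unitMeasure)
    (hnn : ∀ t ∈ Icc (0 : ℝ) 1, 0 ≤ φ t)
    (h : ∀ T ∈ Icc (0 : ℝ) 1, φ T = a + ∫ t in (0 : ℝ)..T, rhs p f φ t) :
    IsSolution p f a φ := by
  have hi := intervalIntegrable_iff_integrable.2 hint
  refine ⟨?_, hnn, hi, h⟩
  have h1 : AbsolutelyContinuousOnInterval (fun _ : ℝ => a) 0 1 :=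
    (LipschitzWith.const a).lipschitzOnWith.absolutelyContinuousOnInterval
  have h2 := h1.add (hi.absolutelyContinuousOnInterval_intervalIntegral (c := 0) (by simp))
  rw [absolutelyContinuousOnInterval_iff] at h2 ⊢
  intro ε hε
  obtain ⟨δ, hδ, hh⟩ := h2 ε hε
  refine ⟨δ, hδ, fun E hE hlt => ?_⟩
  convert hh E hE hlt using 3 with i hi
  · have := (hE.1 i hi).1
    rw [uIcc_of_le zero_le_one] at this
    simp [h _ this]
  · have := (hE.1 i hi).2
    rw [uIcc_of_le zero_le_one] at this
    simp [h _ this]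

/-- Solutions depend monotonically on `|f|` and on the positive initial value. -/
theorem IsSolution.le_of_abs_le (hp : ∀ t ∈ Icc (0 : ℝ) 1, 1 < p t) (ha : 0 < a) (hab : a ≤ b)
    (hφ : IsSolution p f a φ) (hψ : IsSolution p g b ψ)
    (hfg : ∀ᵐ t ∂unitMeasure, |f t| ≤ |g t|) : ∀ t ∈ Icc (0 : ℝ) 1, φ t ≤ ψ t := by
  refine le_of_deriv_le_of_lt hφ.absCont hψ.absCont (by rwa [hφ.map_zero, hψ.map_zero]) ?_
  filter_upwards [hφ.ae_hasDerivAt, hψ.ae_hasDerivAt, hfg, ae_mem_Icc] with t h1 h2 h3 h4 h5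
  rw [h1.deriv, h2.deriv]
  have hpt := hp t h4
  have hψ0 : 0 < ψ t := (ha.trans_le hab).trans_le (hψ.initial_le hp h4)
  unfold rhs
  have : φ t ^ (1 - p t) ≤ ψ t ^ (1 - p t) :=
    Real.rpow_le_rpow_of_nonpos hψ0 h5.le (by linarith)
  have hφ0 : 0 < φ t := hψ0.trans h5
  gcongr

theorem IsSolution.unique (hp : ∀ t ∈ Icc (0 : ℝ) 1, 1 < p t) (ha : 0 < a)
    (hφ : IsSolution p f a φ) (hψ : IsSolution p f a ψ) {t : ℝ} (ht : t ∈ Icc (0 : ℝ) 1) :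
    φ t = ψ t :=
  le_antisymm (hφ.le_of_abs_le hp ha le_rfl hψ (by simp) t ht)
    (hψ.le_of_abs_le hp ha le_rfl hφ (by simp) t ht)

end

/-! ### Existence for positive initial values -/

section

theorem integral_mul_exp_le {L : ℝ → ℝ} (hL : Integrable L) (t : ℝ) :
    ∫ s in (0 : ℝ)..t, L s * Real.exp (2 * ∫ r in (0 : ℝ)..s, L r) ≤
      Real.exp (2 * ∫ r in (0 : ℝ)..t, L r) / 2 := by
  set Λ : ℝ → ℝ := fun s => ∫ r in (0 : ℝ)..s, L r with hΛ
  have hac : AbsolutelyContinuousOnInterval Λ 0 t :=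
    (hL.intervalIntegrable (a := 0) (b := t)).absolutelyContinuousOnInterval_intervalIntegral
      (c := 0) (by simp)
  have hac2 : AbsolutelyContinuousOnInterval (fun s => Real.exp (2 * Λ s)) 0 t := by
    obtain ⟨M, hM⟩ := (hac.const_mul 2).exists_bound
    have hLip : LipschitzOnWith (Real.toNNReal (Real.exp M)) Real.exp (Iic M) := by
      refine Convex.lipschitzOnWith_of_nnnorm_deriv_le (𝕜 := ℝ)
        (fun x _ => Real.differentiableAt_exp) (fun x hx => ?_) (convex_Iic M)
      rw [Real.deriv_exp, ← NNReal.coe_le_coe, coe_nnnorm, Real.norm_eq_abs,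
        Real.coe_toNNReal _ (Real.exp_pos M).le, abs_of_pos (Real.exp_pos x)]
      exact Real.exp_le_exp.2 hx
    exact hLip.comp_absolutelyContinuousOnInterval (hac.const_mul 2)
      fun s hs => (le_abs_self _).trans (hM s hs)
  have h1 := hac2.integral_deriv_eq_sub
  have h2 : ∫ s in (0 : ℝ)..t, deriv (fun s => Real.exp (2 * Λ s)) s =
      ∫ s in (0 : ℝ)..t, 2 * (L s * Real.exp (2 * Λ s)) := by
    refine intervalIntegral.integral_congr_ae ?_
    filter_upwards [(hL.intervalIntegrable (a := 0) (b := t)).ae_hasDerivAt_integral] with s hs hst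
    have h3 : HasDerivAt Λ (L s) s := hs (uIoc_subset_uIcc hst) 0 (by simp)
    have h4 := ((h3.const_mul 2).exp).deriv
    rw [h4]
    ring
  rw [h2, intervalIntegral.integral_const_mul] at h1
  have h5 : 0 < Real.exp (2 * Λ 0) := Real.exp_pos _
  linarith

/-- Carathéodory's existence theorem for a bounded right-hand side with an integrable Lipschitz
constant `L`, as a fixed point in the space of continuous functions. The substitution
`y(t) = exp (2 ∫₀ᵗ L) z(t)` makes the integral operator a contraction on all of `[0,1]`. -/
theorem exists_eq_add_integral {F : ℝ → ℝ → ℝ} {L : ℝ → ℝ} (hL : Integrable L)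
    (hmeas : ∀ y : ℝ → ℝ, Continuous y → AEStronglyMeasurable (fun t => F t (y t)))
    (hbound : ∀ t y, |F t y| ≤ L t) (hlip : ∀ t y z, |F t y - F t z| ≤ L t * |y - z|) (a : ℝ) :
    ∃ y : ℝ → ℝ, Continuous y ∧
      ∀ T ∈ Icc (0 : ℝ) 1, y T = a + ∫ t in (0 : ℝ)..T, F t (y t) := by
  set Λ : ℝ → ℝ := fun s => ∫ r in (0 : ℝ)..s, L r with hΛ
  have hΛc : Continuous Λ := intervalIntegral.continuous_primitive
    (fun _ _ => hL.intervalIntegrable) 0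
  have hL0 : ∀ t, 0 ≤ L t := fun t => (abs_nonneg _).trans (hbound t 0)
  have hint : ∀ y : ℝ → ℝ, Continuous y → Integrable (fun t => F t (y t)) := fun y hy =>
    hL.mono' (hmeas y hy) (Eventually.of_forall fun t => hbound t _)
  set ext : C(Icc (0 : ℝ) 1, ℝ) → ℝ → ℝ := fun z s =>
    Real.exp (2 * Λ s) * IccExtend (zero_le_one' ℝ) z s with hext
  have hextc : ∀ z, Continuous (ext z) := fun z => by
    have : Continuous (IccExtend (zero_le_one' ℝ) z) := z.continuous.Icc_extend'
    fun_prop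
  set Q : C(Icc (0 : ℝ) 1, ℝ) → C(Icc (0 : ℝ) 1, ℝ) := fun z =>
    ⟨fun t => Real.exp (-(2 * Λ t)) * (a + ∫ s in (0 : ℝ)..t, F s (ext z s)), by
      have : Continuous fun t : ℝ => ∫ s in (0 : ℝ)..t, F s (ext z s) :=
        intervalIntegral.continuous_primitive
          (fun _ _ => (hint _ (hextc z)).intervalIntegrable) 0
      fun_prop⟩ with hQ
  have hcontr : ContractingWith (1 / 2) Q := by
    refine ⟨by norm_num, LipschitzWith.of_dist_le_mul fun y z => ?_⟩
    rw [ContinuousMap.dist_le (by positivity)]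
    intro t
    have ht := t.2
    have hdist : |∫ s in (0 : ℝ)..t, (F s (ext y s) - F s (ext z s))| ≤
        dist y z * (Real.exp (2 * Λ t) / 2) := by
      calc |∫ s in (0 : ℝ)..t, (F s (ext y s) - F s (ext z s))|
          ≤ ∫ s in (0 : ℝ)..t, dist y z * (L s * Real.exp (2 * Λ s)) := by
            rw [← Real.norm_eq_abs]
            refine intervalIntegral.norm_integral_le_of_norm_le ht.1
              (Eventually.of_forall fun s hs => ?_) ?_
            · refine (hlip s _ _).trans ?_
              have h1 : |ext y s - ext z s| ≤ Real.exp (2 * Λ s) * dist y z := by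
                simp only [hext, ← mul_sub, abs_mul, abs_of_pos (Real.exp_pos _)]
                gcongr
                rw [← Real.dist_eq]
                exact ContinuousMap.dist_apply_le_dist _
              calc L s * |ext y s - ext z s| ≤ L s * (Real.exp (2 * Λ s) * dist y z) := by
                    gcongr
                    exact hL0 s
                _ = _ := by ring
            · refine IntervalIntegrable.const_mul ?_ _
              exact hL.intervalIntegrable.mul_continuousOn (by fun_prop)
        _ ≤ _ := by
            rw [intervalIntegral.integral_const_mul]
            gcongr
            exact integral_mul_exp_le hL t
    rw [intervalIntegral.integral_sub (hint _ (hextc y)).intervalIntegrable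
      (hint _ (hextc z)).intervalIntegrable] at hdist
    calc dist (Q y t) (Q z t)
        = Real.exp (-(2 * Λ t)) * |(∫ s in (0 : ℝ)..t, F s (ext y s)) -
            ∫ s in (0 : ℝ)..t, F s (ext z s)| := by
          simp only [hQ, ContinuousMap.coe_mk, Real.dist_eq, ← mul_sub, abs_mul,
            abs_of_pos (Real.exp_pos _), add_sub_add_left_eq_sub]
      _ ≤ Real.exp (-(2 * Λ t)) * (dist y z * (Real.exp (2 * Λ t) / 2)) := by gcongr
      _ = (Real.exp (-(2 * Λ t)) * Real.exp (2 * Λ t)) * (dist y z / 2) := by ring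
      _ = _ := by
          rw [← Real.exp_add]
          simp
          ring
  set z := ContractingWith.fixedPoint Q hcontr
  have hz : Q z = z := hcontr.fixedPoint_isFixedPt
  refine ⟨ext z, hextc z, fun T hT => ?_⟩
  have h1 : Q z ⟨T, hT⟩ = z ⟨T, hT⟩ := by rw [hz]
  have h2 : ext z T = Real.exp (2 * Λ T) * z ⟨T, hT⟩ := by
    simp only [hext]
    rw [IccExtend_of_mem _ _ hT]
  rw [h2, ← h1]
  simp only [hQ, ContinuousMap.coe_mk]
  rw [← mul_assoc, ← Real.exp_add]
  simp

variable {p : ℝ → ℝ} {f g : LZero} {a b : ℝ} {φ ψ : ℝ → ℝ}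

/-- Truncation at `1` removes the singularity of `y ↦ y ^ (1 - q)` at the origin. -/
theorem max_one_rpow_lipschitz {q y z : ℝ} (hq : 1 < q) :
    |max y 1 ^ (1 - q) - max z 1 ^ (1 - q)| ≤ (q - 1) * |y - z| := by
  have hL : LipschitzOnWith (Real.toNNReal (q - 1)) (fun x : ℝ => x ^ (1 - q)) (Ici 1) := by
    refine Convex.lipschitzOnWith_of_nnnorm_deriv_le (𝕜 := ℝ) (fun x hx => ?_) (fun x hx => ?_)
      (convex_Ici 1)
    · exact (Real.hasDerivAt_rpow_const
        (Or.inl (zero_lt_one.trans_le hx).ne')).differentiableAt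
    · have hx0 : 0 < x := zero_lt_one.trans_le hx
      rw [(Real.hasDerivAt_rpow_const (Or.inl hx0.ne')).deriv, ← NNReal.coe_le_coe, coe_nnnorm,
        Real.norm_eq_abs, Real.coe_toNNReal _ (by linarith), abs_mul,
        abs_of_neg (by linarith : 1 - q < 0), abs_of_pos (Real.rpow_pos_of_pos hx0 _)]
      have : x ^ (1 - q - 1) ≤ 1 := Real.rpow_le_one_of_one_le_of_nonpos hx (by linarith)
      nlinarith
  have h := hL.dist_le_mul (max y 1) (mem_Ici.2 (le_max_right _ _)) (max z 1)
    (mem_Ici.2 (le_max_right _ _))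
  rw [Real.dist_eq, Real.dist_eq, Real.coe_toNNReal _ (by linarith)] at h
  refine h.trans ?_
  have : |max y 1 - max z 1| ≤ |y - z| := abs_max_sub_max_le_abs y z 1
  gcongr

theorem aemeasurable_abs_rpow (hpm : AEMeasurable p unitMeasure) (f : LZero) (c : ℝ) :
    AEMeasurable (fun t => (c * |f t|) ^ p t) unitMeasure :=
  (f.aestronglyMeasurable.aemeasurable.abs.const_mul c).pow hpm

theorem aemeasurable_rhs (hpm : AEMeasurable p unitMeasure) (f : LZero)
    (hφ : AEMeasurable φ unitMeasure) : AEMeasurable (rhs p f φ) unitMeasure :=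
  ((f.aestronglyMeasurable.aemeasurable.abs.pow hpm).div hpm).mul
    (hφ.pow (hpm.const_sub 1))

/-- A solution with initial value `1` stays above `1`, so that `φ ^ (1 - p)` may be replaced by
`max φ 1 ^ (1 - p)`, which is bounded and Lipschitz in `φ`. -/
theorem exists_isSolution_one (hpm : AEMeasurable p unitMeasure)
    (hp : ∀ t ∈ Icc (0 : ℝ) 1, 1 < p t)
    (hf : Integrable (fun t => |f t| ^ p t) unitMeasure) : ∃ φ, IsSolution p f 1 φ := by
  set F : ℝ → ℝ → ℝ := fun t y =>
    (Icc (0 : ℝ) 1).indicator (fun t => |f t| ^ p t / p t * max y 1 ^ (1 - p t)) t with hF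
  have hbound : ∀ t y, |F t y| ≤ (Icc (0 : ℝ) 1).indicator (fun t => |f t| ^ p t) t := by
    intro t y
    by_cases ht : t ∈ Icc (0 : ℝ) 1
    · have hpt := hp t ht
      simp only [hF, indicator_of_mem ht]
      have h1 : max y 1 ^ (1 - p t) ≤ 1 :=
        Real.rpow_le_one_of_one_le_of_nonpos (le_max_right _ _) (by linarith)
      have h2 : 0 ≤ |f t| ^ p t := by positivity
      have h3 : 0 ≤ max y 1 ^ (1 - p t) := Real.rpow_nonneg (zero_le_one.trans (le_max_right _ _)) _
      rw [abs_of_nonneg (by positivity)]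
      calc |f t| ^ p t / p t * max y 1 ^ (1 - p t) ≤ |f t| ^ p t / p t * 1 := by gcongr
        _ ≤ |f t| ^ p t := by rw [mul_one]; exact div_le_self h2 hpt.le
    · simp [hF, ht]
  have hlip : ∀ t y z, |F t y - F t z| ≤
      (Icc (0 : ℝ) 1).indicator (fun t => |f t| ^ p t) t * |y - z| := by
    intro t y z
    by_cases ht : t ∈ Icc (0 : ℝ) 1
    · have hpt := hp t ht
      simp only [hF, indicator_of_mem ht, ← mul_sub, abs_mul]
      have h2 : 0 ≤ |f t| ^ p t := by positivity
      rw [abs_of_nonneg (by positivity : 0 ≤ |f t| ^ p t / p t)]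
      calc |f t| ^ p t / p t * |max y 1 ^ (1 - p t) - max z 1 ^ (1 - p t)|
          ≤ |f t| ^ p t / p t * ((p t - 1) * |y - z|) := by
            gcongr
            exact max_one_rpow_lipschitz hpt
        _ = |f t| ^ p t * |y - z| * ((p t - 1) / p t) := by ring
        _ ≤ |f t| ^ p t * |y - z| * 1 := by
            gcongr
            rw [div_le_one (by linarith)]
            linarith
        _ = _ := mul_one _
    · simp [hF, ht]
  have hmeas : ∀ y : ℝ → ℝ, Continuous y → AEStronglyMeasurable (fun t => F t (y t)) := by
    intro y hy
    have h1 : AEStronglyMeasurable (fun t => |f t| ^ p t / p t * max (y t) 1 ^ (1 - p t))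
        unitMeasure :=
      (aemeasurable_rhs hpm f
        (φ := fun t => max (y t) 1) (by fun_prop)).aestronglyMeasurable
    exact (aestronglyMeasurable_indicator_iff measurableSet_Icc).2 h1
  obtain ⟨y, hyc, hy⟩ := exists_eq_add_integral
    ((integrable_indicator_iff measurableSet_Icc).2 hf) hmeas hbound hlip 1
  have hF0 : ∀ t y, 0 ≤ F t y := by
    intro t y
    refine indicator_nonneg (fun t ht => ?_) t
    have hpt := hp t ht
    have h3 : 0 ≤ max y 1 ^ (1 - p t) := Real.rpow_nonneg (zero_le_one.trans (le_max_right _ _)) _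
    positivity
  have hy1 : ∀ T ∈ Icc (0 : ℝ) 1, 1 ≤ y T := fun T hT => by
    rw [hy T hT]
    linarith [intervalIntegral.integral_nonneg (μ := volume) hT.1 fun t _ => hF0 t (y t)]
  have heq : ∀ t ∈ Icc (0 : ℝ) 1, F t (y t) = rhs p f y t := fun t ht => by
    simp only [hF, indicator_of_mem ht, rhs, max_eq_left (hy1 t ht)]
  refine ⟨y, IsSolution.of_integral ?_ (fun t ht => zero_le_one.trans (hy1 t ht)) ?_⟩
  · have h1 : Integrable (fun t => F t (y t)) unitMeasure :=
      (((integrable_indicator_iff measurableSet_Icc).2 hf).mono' (hmeas y hyc)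
        (Eventually.of_forall fun t => hbound t _)).restrict
    refine h1.congr ?_
    filter_upwards [ae_mem_Icc] with t ht using heq t ht
  · intro T hT
    rw [hy T hT]
    congr 1
    refine intervalIntegral.integral_congr fun t ht => heq t ?_
    rw [uIcc_of_le hT.1] at ht
    exact ⟨ht.1, ht.2.trans hT.2⟩

/-- The equation is positively homogeneous in the pair of `|f|` and the solution. -/
theorem IsSolution.const_mul (hp : ∀ t ∈ Icc (0 : ℝ) 1, 1 < p t) {c : ℝ} (hc : 0 < c)
    (hφ : IsSolution p f a φ) (hg : ∀ᵐ t ∂unitMeasure, |g t| = c * |f t|) :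
    IsSolution p g (c * a) (fun t => c * φ t) := by
  have heq : ∀ᵐ t ∂unitMeasure, rhs p g (fun t => c * φ t) t = c * rhs p f φ t := by
    filter_upwards [hg, ae_mem_Icc] with t ht htm
    have hpt := hp t htm
    unfold rhs
    rw [ht, Real.mul_rpow hc.le (abs_nonneg _), Real.mul_rpow hc.le (hφ.nonneg t htm)]
    have : c ^ p t * c ^ (1 - p t) = c := by
      rw [← Real.rpow_add hc]
      simp
    calc c ^ p t * |f t| ^ p t / p t * (c ^ (1 - p t) * φ t ^ (1 - p t))
        = (c ^ p t * c ^ (1 - p t)) * (|f t| ^ p t / p t * φ t ^ (1 - p t)) := by ring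
      _ = _ := by rw [this]
  refine IsSolution.of_integral ((hφ.integrable_rhs.const_mul c).congr ?_)
    (fun t ht => mul_nonneg hc.le (hφ.nonneg t ht)) fun T hT => ?_
  · filter_upwards [heq] with t ht using ht.symm
  · have h1 : ∫ t in (0 : ℝ)..T, rhs p g (fun t => c * φ t) t =
        ∫ t in (0 : ℝ)..T, c * rhs p f φ t := by
      rw [intervalIntegral.integral_of_le hT.1, intervalIntegral.integral_of_le hT.1,
        ← unitMeasure_restrict_Ioc le_rfl hT.2]
      exact integral_congr_ae (ae_restrict_of_ae heq)
    rw [h1, intervalIntegral.integral_const_mul, hφ.eq_integral T hT]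
    ring

theorem coeFn_smul_abs (c : ℝ) (f : LZero) :
    ∀ᵐ t ∂unitMeasure, |(c • f : LZero) t| = |c| * |f t| := by
  filter_upwards [AEEqFun.coeFn_smul c f] with t ht
  rw [ht, Pi.smul_apply, smul_eq_mul, abs_mul]

/-- The case of the initial value `1` suffices by homogeneity. -/
theorem exists_isSolution (hpm : AEMeasurable p unitMeasure)
    (hp : ∀ t ∈ Icc (0 : ℝ) 1, 1 < p t) (ha : 0 < a)
    (hf : Integrable (fun t => (a⁻¹ * |f t|) ^ p t) unitMeasure) : ∃ φ, IsSolution p f a φ := by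
  have h1 := coeFn_smul_abs a⁻¹ f
  rw [abs_of_pos (inv_pos.2 ha)] at h1
  obtain ⟨φ, hφ⟩ := exists_isSolution_one (f := a⁻¹ • f) hpm hp (hf.congr (by
    filter_upwards [h1] with t ht
    rw [ht]))
  refine ⟨_, mul_one a ▸ hφ.const_mul hp ha (g := f) ?_⟩
  filter_upwards [h1] with t ht
  rw [ht, mul_inv_cancel_left₀ ha.ne']

end

/-! ### Solutions with initial value `0⁺` -/

section

variable {p : ℝ → ℝ} {f g : LZero} {a b : ℝ} {φ ψ : ℝ → ℝ}

theorem IsSolution.aemeasurable (h : IsSolution p f a φ) : AEMeasurable φ unitMeasure := by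
  have := h.absCont.continuousOn
  rw [uIcc_of_le zero_le_one] at this
  exact this.aemeasurable measurableSet_Icc

theorem tendsto_initial_value (hp : ∀ t ∈ Icc (0 : ℝ) 1, 1 < p t) {Φ : ℝ → ℝ → ℝ}
    (hΦ : ∀ a > 0, IsSolution p f a (Φ a)) {t : ℝ} (ht : t ∈ Icc (0 : ℝ) 1) :
    Tendsto (fun a => Φ a t) (𝓝[>] 0) (𝓝 (sInf ((fun a => Φ a t) '' Ioi 0))) := by
  refine MonotoneOn.tendsto_nhdsGT (fun a ha b hb hab => ?_) ?_
  · exact (hΦ a ha).le_of_abs_le hp ha hab (hΦ b hb) (by simp) t ht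
  · refine ⟨0, ?_⟩
    rintro _ ⟨a, ha, rfl⟩
    exact (hΦ a ha).nonneg t ht

theorem tendsto_one_div_nhdsGT :
    Tendsto (fun n : ℕ => (1 : ℝ) / ((n : ℝ) + 1)) atTop (𝓝[>] 0) :=
  tendsto_nhdsWithin_iff.2 ⟨tendsto_one_div_add_atTop_nhds_zero_nat,
    Eventually.of_forall fun n => mem_Ioi.2 (by positivity)⟩

/-- If solutions exist for all positive initial values, their limit as the initial value tends
to `0⁺` is a solution. By monotone convergence the limit of the right-hand sides is
integrable, hence finite, and this forces `f = 0` where the limit of the solutions vanishes. -/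
theorem mem_lpClass_of_forall_exists (hpm : AEMeasurable p unitMeasure)
    (hp : ∀ t ∈ Icc (0 : ℝ) 1, 1 < p t) (h : ∀ a > 0, ∃ φ, IsSolution p f a φ) :
    f ∈ lpClass p := by
  choose! Φ hΦ using h
  set φ : ℝ → ℝ := fun t => sInf ((fun a => Φ a t) '' Ioi 0) with hφ
  have hlim : ∀ t ∈ Icc (0 : ℝ) 1, Tendsto (fun a => Φ a t) (𝓝[>] 0) (𝓝 (φ t)) :=
    fun t ht => tendsto_initial_value hp hΦ ht
  refine ⟨φ, ?_, Φ, hΦ, hlim⟩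
  set x : ℕ → ℝ := fun n => 1 / ((n : ℝ) + 1) with hx
  have hx0 : ∀ n, 0 < x n := fun n => by positivity
  have hxanti : Antitone x := fun m n hmn => one_div_le_one_div_of_le (by positivity) (by
    have : (m : ℝ) ≤ n := by exact_mod_cast hmn
    linarith)
  have hlimn : ∀ t ∈ Icc (0 : ℝ) 1, Tendsto (fun n => Φ (x n) t) atTop (𝓝 (φ t)) :=
    fun t ht => (hlim t ht).comp tendsto_one_div_nhdsGT
  set r : ℕ → ℝ → ℝ := fun n => rhs p f (Φ (x n)) with hr
  have hrm : ∀ n, AEMeasurable (r n) unitMeasure := fun n =>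
    aemeasurable_rhs hpm f (hΦ _ (hx0 n)).aemeasurable
  have hr0 : ∀ n, ∀ t ∈ Icc (0 : ℝ) 1, 0 ≤ r n t := fun n t ht =>
    rhs_nonneg hp (hΦ _ (hx0 n)).nonneg ht
  have hΦpos : ∀ n, ∀ t ∈ Icc (0 : ℝ) 1, 0 < Φ (x n) t := fun n t ht =>
    (hx0 n).trans_le ((hΦ _ (hx0 n)).initial_le hp ht)
  have hmono : ∀ t ∈ Icc (0 : ℝ) 1, Monotone fun n => r n t := by
    intro t ht m n hmn
    have hpt := hp t ht
    have h1 : Φ (x n) t ≤ Φ (x m) t :=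
      (hΦ _ (hx0 n)).le_of_abs_le hp (hx0 n) (hxanti hmn) (hΦ _ (hx0 m)) (by simp) t ht
    have h2 : Φ (x m) t ^ (1 - p t) ≤ Φ (x n) t ^ (1 - p t) :=
      Real.rpow_le_rpow_of_nonpos (hΦpos n t ht) h1 (by linarith)
    simp only [hr, rhs]
    gcongr
  -- the limit of the increasing sequence `r n`, with finite integral by the monotone convergence
  -- theorem
  set G : ℝ → ENNReal := fun t => ⨆ n, ENNReal.ofReal (r n t) with hG
  have hGfin : ∫⁻ t, G t ∂unitMeasure ≤ ENNReal.ofReal (Φ (x 0) 1) := by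
    rw [hG, lintegral_iSup' (fun n => (hrm n).ennreal_ofReal) (by
      filter_upwards [ae_mem_Icc] with t ht m n hmn
      exact ENNReal.ofReal_le_ofReal (hmono t ht hmn))]
    refine iSup_le fun n => ?_
    rw [← ofReal_integral_eq_lintegral_ofReal (hΦ _ (hx0 n)).integrable_rhs (by
      filter_upwards [ae_mem_Icc] with t ht using hr0 n t ht)]
    refine ENNReal.ofReal_le_ofReal ?_
    have h1 := (hΦ _ (hx0 n)).apply_one
    have h2 := (hΦ _ (hx0 n)).le_of_abs_le hp (hx0 n) (hxanti (Nat.zero_le n)) (hΦ _ (hx0 0))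
      (by simp) 1 ⟨zero_le_one, le_rfl⟩
    linarith [hx0 n]
  have hGae : ∀ᵐ t ∂unitMeasure, G t < ⊤ :=
    ae_lt_top' (AEMeasurable.iSup fun n => (hrm n).ennreal_ofReal)
      (hGfin.trans_lt ENNReal.ofReal_lt_top).ne
  have htend : ∀ᵐ t ∂unitMeasure, Tendsto (fun n => r n t) atTop (𝓝 (rhs p f φ t)) := by
    filter_upwards [hGae, ae_mem_Icc] with t ht htm
    have hpt := hp t htm
    have hφ0 : 0 ≤ φ t := ge_of_tendsto' (hlimn t htm) fun n => (hΦpos n t htm).le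
    rcases hφ0.eq_or_lt with h0 | h0
    -- where `φ = 0`, the right-hand sides stay below `G t < ∞` while the factors
    -- `Φ (x n) t ^ (p t - 1)` tend to `0`, and so `f t = 0`
    · have hw0 : 0 ≤ |f t| ^ p t / p t := by positivity
      have hbd : ∀ n, |f t| ^ p t / p t ≤ (G t).toReal * Φ (x n) t ^ (p t - 1) := fun n => by
        have h1 : r n t ≤ (G t).toReal := by
          rw [← ENNReal.ofReal_le_iff_le_toReal ht.ne]
          exact le_iSup (fun n => ENNReal.ofReal (r n t)) n
        have h2 : |f t| ^ p t / p t = r n t * Φ (x n) t ^ (p t - 1) := by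
          simp only [hr, rhs]
          rw [mul_assoc, ← Real.rpow_add (hΦpos n t htm)]
          simp
        rw [h2]
        have := hΦpos n t htm
        gcongr
      have hlim0 : Tendsto (fun n => (G t).toReal * Φ (x n) t ^ (p t - 1)) atTop (𝓝 0) := by
        have h1 := ((hlimn t htm).rpow_const (p := p t - 1)
          (Or.inr (by linarith))).const_mul (G t).toReal
        rwa [← h0, Real.zero_rpow (by linarith), mul_zero] at h1
      have hw : |f t| ^ p t / p t = 0 := le_antisymm (ge_of_tendsto' hlim0 hbd) hw0
      simp only [hr, rhs, hw, zero_mul]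
      exact tendsto_const_nhds
    · exact ((hlimn t htm).rpow_const (Or.inl h0.ne')).const_mul _
  have hφm : AEMeasurable (rhs p f φ) unitMeasure := aemeasurable_of_tendsto_metrizable_ae' hrm htend
  have hφnn : ∀ t ∈ Icc (0 : ℝ) 1, 0 ≤ φ t := fun t ht =>
    ge_of_tendsto' (hlimn t ht) fun n => (hΦpos n t ht).le
  have hφint : Integrable (rhs p f φ) unitMeasure := by
    refine ⟨hφm.aestronglyMeasurable, ?_⟩
    rw [hasFiniteIntegral_iff_ofReal (by
      filter_upwards [ae_mem_Icc] with t ht using rhs_nonneg hp hφnn ht)]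
    refine lt_of_le_of_lt (lintegral_mono_ae ?_) (hGfin.trans_lt ENNReal.ofReal_lt_top)
    filter_upwards [htend] with t ht
    exact le_of_tendsto' ((ENNReal.continuous_ofReal.tendsto _).comp ht) fun n =>
      le_iSup (fun n => ENNReal.ofReal (r n t)) n
  refine IsSolution.of_integral hφint hφnn fun T hT => ?_
  have h1 : Tendsto (fun n => x n + ∫ t in (0 : ℝ)..T, r n t) atTop
      (𝓝 (0 + ∫ t in (0 : ℝ)..T, rhs p f φ t)) := by
    refine (tendsto_one_div_add_atTop_nhds_zero_nat).add ?_
    simp only [intervalIntegral.integral_of_le hT.1, ← unitMeasure_restrict_Ioc le_rfl hT.2]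
    exact integral_tendsto_of_tendsto_of_monotone
      (fun n => (hΦ _ (hx0 n)).integrable_rhs.restrict) hφint.restrict
      (ae_restrict_of_ae (by filter_upwards [ae_mem_Icc] with t ht using hmono t ht))
      (ae_restrict_of_ae htend)
  refine tendsto_nhds_unique (hlimn T hT) (h1.congr fun n => ?_)
  exact ((hΦ _ (hx0 n)).eq_integral T hT).symm

theorem IsZeroPlusSolution.unique (hp : ∀ t ∈ Icc (0 : ℝ) 1, 1 < p t)
    (hφ : IsZeroPlusSolution p f φ) (hψ : IsZeroPlusSolution p f ψ) {t : ℝ}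
    (ht : t ∈ Icc (0 : ℝ) 1) : φ t = ψ t := by
  obtain ⟨Φ, hΦ, hΦl⟩ := hφ.limit
  obtain ⟨Ψ, hΨ, hΨl⟩ := hψ.limit
  refine tendsto_nhds_unique (hΦl t ht) ((hΨl t ht).congr' ?_)
  filter_upwards [self_mem_nhdsWithin] with a ha
  exact (hΨ a ha).unique hp ha (hΦ a ha) ht

theorem IsZeroPlusSolution.lpNorm_eq (hp : ∀ t ∈ Icc (0 : ℝ) 1, 1 < p t)
    (hφ : IsZeroPlusSolution p f φ) : lpNorm p f = φ 1 := by
  have h : f ∈ lpClass p := ⟨φ, hφ⟩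
  rw [lpNorm, dif_pos h]
  exact IsZeroPlusSolution.unique hp h.choose_spec hφ ⟨zero_le_one, le_rfl⟩

theorem exists_tendsto_lpNorm (hp : ∀ t ∈ Icc (0 : ℝ) 1, 1 < p t) (hf : f ∈ lpClass p) :
    ∃ Φ : ℝ → ℝ → ℝ, (∀ a > 0, IsSolution p f a (Φ a)) ∧
      Tendsto (fun a => Φ a 1) (𝓝[>] 0) (𝓝 (lpNorm p f)) := by
  obtain ⟨φ, hφ⟩ := hf
  obtain ⟨Φ, hΦ, hΦl⟩ := hφ.limit
  exact ⟨Φ, hΦ, hφ.lpNorm_eq hp ▸ hΦl 1 ⟨zero_le_one, le_rfl⟩⟩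

theorem lpNorm_nonneg (p : ℝ → ℝ) (f : LZero) : 0 ≤ lpNorm p f := by
  unfold lpNorm
  split_ifs with h
  · exact h.choose_spec.isSolution.nonneg 1 ⟨zero_le_one, le_rfl⟩
  · exact le_rfl

theorem IsSolution.lpNorm_le (hp : ∀ t ∈ Icc (0 : ℝ) 1, 1 < p t) (hf : f ∈ lpClass p)
    (ha : 0 < a) (hφ : IsSolution p f a φ) : lpNorm p f ≤ φ 1 := by
  obtain ⟨Φ, hΦ, hl⟩ := exists_tendsto_lpNorm hp hf
  refine le_of_tendsto hl ?_
  filter_upwards [Ioo_mem_nhdsGT ha] with b hb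
  exact (hΦ b hb.1).le_of_abs_le hp hb.1 hb.2.le hφ (by simp) 1 ⟨zero_le_one, le_rfl⟩

theorem lpNorm_mono (hp : ∀ t ∈ Icc (0 : ℝ) 1, 1 < p t) (hf : f ∈ lpClass p) (hg : g ∈ lpClass p)
    (h : ∀ᵐ t ∂unitMeasure, |f t| ≤ |g t|) : lpNorm p f ≤ lpNorm p g := by
  obtain ⟨Φ, hΦ, hl⟩ := exists_tendsto_lpNorm hp hf
  obtain ⟨Ψ, hΨ, hl'⟩ := exists_tendsto_lpNorm hp hg
  refine le_of_tendsto_of_tendsto hl hl' ?_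
  filter_upwards [self_mem_nhdsWithin] with a ha
  exact (hΦ a ha).le_of_abs_le hp ha le_rfl (hΨ a ha) h 1 ⟨zero_le_one, le_rfl⟩

theorem IsZeroPlusSolution.const_mul (hp : ∀ t ∈ Icc (0 : ℝ) 1, 1 < p t) {c : ℝ} (hc : 0 < c)
    (hφ : IsZeroPlusSolution p f φ) (hg : ∀ᵐ t ∂unitMeasure, |g t| = c * |f t|) :
    IsZeroPlusSolution p g (fun t => c * φ t) := by
  obtain ⟨Φ, hΦ, hl⟩ := hφ.limit
  refine ⟨mul_zero c ▸ hφ.isSolution.const_mul hp hc hg, fun a t => c * Φ (c⁻¹ * a) t, ?_, ?_⟩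
  · intro a ha
    have := (hΦ (c⁻¹ * a) (by positivity)).const_mul hp hc hg
    rwa [mul_inv_cancel_left₀ hc.ne'] at this
  · intro t ht
    refine ((hl t ht).comp ?_).const_mul c
    refine tendsto_nhdsWithin_iff.2 ⟨?_, ?_⟩
    · have : Tendsto (fun a : ℝ => c⁻¹ * a) (𝓝 0) (𝓝 (c⁻¹ * 0)) :=
        (continuous_const_mul c⁻¹).tendsto 0
      rw [mul_zero] at this
      exact this.mono_left nhdsWithin_le_nhds
    · filter_upwards [self_mem_nhdsWithin] with a ha
      exact mul_pos (inv_pos.2 hc) ha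

theorem isSolution_zero (p : ℝ → ℝ) (hp : ∀ t ∈ Icc (0 : ℝ) 1, 1 < p t) (ha : 0 ≤ a) :
    IsSolution p 0 a fun _ => a := by
  have h0 : ∀ᵐ t ∂unitMeasure, rhs p 0 (fun _ => a) t = 0 := by
    filter_upwards [AEEqFun.coeFn_zero (α := ℝ) (β := ℝ) (μ := unitMeasure), ae_mem_Icc]
      with t ht htm
    have hpt := hp t htm
    simp [rhs, ht, Real.zero_rpow (by linarith : p t ≠ 0)]
  refine IsSolution.of_integral ((integrable_zero _ _ _).congr ?_) (fun _ _ => ha) fun T hT => ?_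
  · filter_upwards [h0] with t ht using ht.symm
  · rw [intervalIntegral.integral_of_le hT.1, ← unitMeasure_restrict_Ioc le_rfl hT.2,
      integral_eq_zero_of_ae (ae_restrict_of_ae h0), add_zero]

theorem isZeroPlusSolution_zero (hp : ∀ t ∈ Icc (0 : ℝ) 1, 1 < p t) :
    IsZeroPlusSolution p 0 fun _ => 0 :=
  ⟨isSolution_zero p hp le_rfl, fun a _ => a, fun _ ha => isSolution_zero p hp (le_of_lt ha),
    fun _ _ => tendsto_id.mono_left nhdsWithin_le_nhds⟩

theorem zero_mem_lpClass (hp : ∀ t ∈ Icc (0 : ℝ) 1, 1 < p t) : (0 : LZero) ∈ lpClass p :=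
  ⟨_, isZeroPlusSolution_zero hp⟩

theorem lpNorm_zero (hp : ∀ t ∈ Icc (0 : ℝ) 1, 1 < p t) : lpNorm p 0 = 0 :=
  (isZeroPlusSolution_zero hp).lpNorm_eq hp

theorem smul_mem_lpClass (hp : ∀ t ∈ Icc (0 : ℝ) 1, 1 < p t) (c : ℝ) (hf : f ∈ lpClass p) :
    c • f ∈ lpClass p := by
  rcases eq_or_ne c 0 with rfl | hc
  · rw [zero_smul]
    exact zero_mem_lpClass hp
  · obtain ⟨φ, hφ⟩ := hf
    exact ⟨_, hφ.const_mul hp (abs_pos.2 hc) (coeFn_smul_abs c f)⟩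

theorem lpNorm_smul (hp : ∀ t ∈ Icc (0 : ℝ) 1, 1 < p t) (c : ℝ) (hf : f ∈ lpClass p) :
    lpNorm p (c • f) = |c| * lpNorm p f := by
  rcases eq_or_ne c 0 with rfl | hc
  · rw [zero_smul, abs_zero, zero_mul]
    exact lpNorm_zero hp
  · obtain ⟨φ, hφ⟩ := hf
    rw [(hφ.const_mul hp (abs_pos.2 hc) (coeFn_smul_abs c f)).lpNorm_eq hp, hφ.lpNorm_eq hp]

end

/-! ### Convexity and concavity of the norm -/

section

variable {p : ℝ → ℝ} {f g h : LZero} {a b : ℝ} {φ ψ : ℝ → ℝ}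

/-- The derivative of `α ^ s` along a solution, in terms of the ratio `(x / α) ^ s`. -/
theorem rpow_sub_one_mul_rhs_term {α x s q : ℝ} (hα : 0 < α) (hx : 0 ≤ x) (hs : 0 < s) :
    x ^ q / q * α ^ (1 - q) * s * α ^ (s - 1) = s / q * (α ^ s * ((x / α) ^ s) ^ (q / s)) := by
  rw [← Real.rpow_mul (div_nonneg hx hα.le), mul_div_cancel₀ q hs.ne', Real.div_rpow hx hα.le]
  have h1 : α ^ (1 - q) * α ^ (s - 1) = α ^ s / α ^ q := by
    rw [← Real.rpow_add hα, ← Real.rpow_sub hα]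
    congr 1
    ring
  calc x ^ q / q * α ^ (1 - q) * s * α ^ (s - 1)
      = x ^ q / q * s * (α ^ (1 - q) * α ^ (s - 1)) := by ring
    _ = _ := by
      rw [h1]
      ring

/-- The logarithmic growth rate of `γ ^ s` as a function of the ratio `z ^ s / γ ^ s`. -/
theorem log_rate_eq {γ z s q : ℝ} (hγ : 0 < γ) (hz : 0 ≤ z) (hs : 0 < s) :
    s * (z ^ q / q * γ ^ (1 - q) / γ) = s / q * (z ^ s / γ ^ s) ^ (q / s) := by
  rw [← Real.div_rpow hz hγ.le, ← Real.rpow_mul (div_nonneg hz hγ.le), mul_div_cancel₀ q hs.ne',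
    Real.div_rpow hz hγ.le, Real.rpow_sub hγ, Real.rpow_one]
  field_simp

/-- The comparison of the logarithmic growth rates of `γ ^ s` and `α ^ s + β ^ s` for exponents
`q ≥ s`, by convexity of `x ↦ x ^ (q / s)`. -/
theorem log_rate_le {x y z α β γ s q : ℝ} (hx : 0 ≤ x) (hy : 0 ≤ y) (hz : 0 ≤ z)
    (hα : 0 < α) (hβ : 0 < β) (hγ : 0 < γ) (hs : 0 < s) (hq : s ≤ q)
    (hz' : z ^ s ≤ x ^ s + y ^ s) (hγ' : α ^ s + β ^ s ≤ γ ^ s) :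
    s * (z ^ q / q * γ ^ (1 - q) / γ) ≤
      (x ^ q / q * α ^ (1 - q) * s * α ^ (s - 1) + y ^ q / q * β ^ (1 - q) * s * β ^ (s - 1)) /
        (α ^ s + β ^ s) := by
  have hq0 : 0 < q := hs.trans_le hq
  have hA := Real.rpow_pos_of_pos hα s
  have hB := Real.rpow_pos_of_pos hβ s
  have hAB : 0 < α ^ s + β ^ s := by positivity
  have hz0 : 0 ≤ z ^ s := by positivity
  have hxα : (x / α) ^ s = x ^ s / α ^ s := Real.div_rpow hx hα.le s
  have hyβ : (y / β) ^ s = y ^ s / β ^ s := Real.div_rpow hy hβ.le s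
  have hj := (convexOn_rpow ((one_le_div hs).2 hq)).2
    (mem_Ici.2 (by positivity : 0 ≤ (x / α) ^ s)) (mem_Ici.2 (by positivity : 0 ≤ (y / β) ^ s))
    (by positivity : 0 ≤ α ^ s / (α ^ s + β ^ s)) (by positivity : 0 ≤ β ^ s / (α ^ s + β ^ s))
    (by field_simp)
  simp only [smul_eq_mul] at hj
  rw [rpow_sub_one_mul_rhs_term hα hx hs, rpow_sub_one_mul_rhs_term hβ hy hs,
    log_rate_eq hγ hz hs]
  calc s / q * (z ^ s / γ ^ s) ^ (q / s)
      ≤ s / q * ((x ^ s + y ^ s) / (α ^ s + β ^ s)) ^ (q / s) := by gcongr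
    _ = s / q * (α ^ s / (α ^ s + β ^ s) * (x / α) ^ s +
          β ^ s / (α ^ s + β ^ s) * (y / β) ^ s) ^ (q / s) := by
        rw [hxα, hyβ]
        congr 2
        field_simp
    _ ≤ s / q * (α ^ s / (α ^ s + β ^ s) * ((x / α) ^ s) ^ (q / s) +
          β ^ s / (α ^ s + β ^ s) * ((y / β) ^ s) ^ (q / s)) := by gcongr
    _ = _ := by field_simp

/-- The comparison of the logarithmic growth rates of `γ ^ s` and `α ^ s + β ^ s` for exponents
`q ≤ s`, by concavity of `x ↦ x ^ (q / s)`. -/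
theorem le_log_rate {x y z α β γ s q : ℝ} (hx : 0 ≤ x) (hy : 0 ≤ y) (hz : 0 ≤ z)
    (hα : 0 < α) (hβ : 0 < β) (hγ : 0 < γ) (hq0 : 0 < q) (hq : q ≤ s)
    (hz' : x ^ s + y ^ s ≤ z ^ s) (hγ' : γ ^ s ≤ α ^ s + β ^ s) :
    (x ^ q / q * α ^ (1 - q) * s * α ^ (s - 1) + y ^ q / q * β ^ (1 - q) * s * β ^ (s - 1)) /
        (α ^ s + β ^ s) ≤ s * (z ^ q / q * γ ^ (1 - q) / γ) := by
  have hs : 0 < s := hq0.trans_le hq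
  have hA := Real.rpow_pos_of_pos hα s
  have hB := Real.rpow_pos_of_pos hβ s
  have hC := Real.rpow_pos_of_pos hγ s
  have hAB : 0 < α ^ s + β ^ s := by positivity
  have hz0 : 0 ≤ z ^ s := by positivity
  have hxα : (x / α) ^ s = x ^ s / α ^ s := Real.div_rpow hx hα.le s
  have hyβ : (y / β) ^ s = y ^ s / β ^ s := Real.div_rpow hy hβ.le s
  have hj := (Real.concaveOn_rpow (by positivity) ((div_le_one hs).2 hq)).2
    (mem_Ici.2 (by positivity : 0 ≤ (x / α) ^ s)) (mem_Ici.2 (by positivity : 0 ≤ (y / β) ^ s))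
    (by positivity : 0 ≤ α ^ s / (α ^ s + β ^ s)) (by positivity : 0 ≤ β ^ s / (α ^ s + β ^ s))
    (by field_simp)
  simp only [smul_eq_mul] at hj
  rw [rpow_sub_one_mul_rhs_term hα hx hs, rpow_sub_one_mul_rhs_term hβ hy hs,
    log_rate_eq hγ hz hs]
  refine ge_iff_le.1 ?_
  calc s / q * (z ^ s / γ ^ s) ^ (q / s)
      ≥ s / q * ((x ^ s + y ^ s) / (α ^ s + β ^ s)) ^ (q / s) := by
        have : (x ^ s + y ^ s) / (α ^ s + β ^ s) ≤ z ^ s / γ ^ s := by gcongr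
        gcongr
    _ = s / q * (α ^ s / (α ^ s + β ^ s) * (x / α) ^ s +
          β ^ s / (α ^ s + β ^ s) * (y / β) ^ s) ^ (q / s) := by
        rw [hxα, hyβ]
        congr 2
        field_simp
    _ ≥ s / q * (α ^ s / (α ^ s + β ^ s) * ((x / α) ^ s) ^ (q / s) +
          β ^ s / (α ^ s + β ^ s) * ((y / β) ^ s) ^ (q / s)) := by gcongr
    _ = _ := by field_simp

theorem absolutelyContinuousOnInterval_log_add_rpow (hp : ∀ t ∈ Icc (0 : ℝ) 1, 1 < p t) {s : ℝ}
    (hs : 1 ≤ s) (ha : 0 < a) (hφ : IsSolution p f a φ) (hψ : IsSolution p g a ψ) :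
    AbsolutelyContinuousOnInterval (fun t => Real.log (φ t ^ s + ψ t ^ s)) 0 1 := by
  refine absolutelyContinuousOnInterval_log (Real.rpow_pos_of_pos ha s)
    ((absolutelyContinuousOnInterval_rpow ha hs hφ.absCont fun t ht => hφ.initial_le hp ht).add
    (absolutelyContinuousOnInterval_rpow ha hs hψ.absCont fun t ht => hψ.initial_le hp ht))
    fun t ht => ?_
  have h1 : a ^ s ≤ φ t ^ s := Real.rpow_le_rpow ha.le (hφ.initial_le hp ht) (by linarith)
  have h2 : 0 ≤ ψ t ^ s := Real.rpow_nonneg (hψ.nonneg t ht) s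
  exact h1.trans (le_add_of_nonneg_right h2)

theorem absolutelyContinuousOnInterval_mul_log (hp : ∀ t ∈ Icc (0 : ℝ) 1, 1 < p t) (s : ℝ)
    (ha : 0 < a) (hφ : IsSolution p f a φ) :
    AbsolutelyContinuousOnInterval (fun t => s * Real.log (φ t)) 0 1 :=
  (absolutelyContinuousOnInterval_log ha hφ.absCont fun _ ht => hφ.initial_le hp ht).const_mul s

theorem ae_hasDerivAt_log_add_rpow (hp : ∀ t ∈ Icc (0 : ℝ) 1, 1 < p t) (s : ℝ) (ha : 0 < a)
    (hφ : IsSolution p f a φ) (hψ : IsSolution p g a ψ) :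
    ∀ᵐ t ∂unitMeasure, HasDerivAt (fun t => Real.log (φ t ^ s + ψ t ^ s))
      ((rhs p f φ t * s * φ t ^ (s - 1) + rhs p g ψ t * s * ψ t ^ (s - 1)) /
        (φ t ^ s + ψ t ^ s)) t := by
  filter_upwards [hφ.ae_hasDerivAt, hψ.ae_hasDerivAt, ae_mem_Icc] with t h1 h2 ht
  have h3 := ha.trans_le (hφ.initial_le hp ht)
  have h4 := ha.trans_le (hψ.initial_le hp ht)
  exact ((h1.rpow_const (Or.inl h3.ne')).add (h2.rpow_const (Or.inl h4.ne'))).log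
    (add_pos (Real.rpow_pos_of_pos h3 s) (Real.rpow_pos_of_pos h4 s)).ne'

theorem ae_hasDerivAt_mul_log (hp : ∀ t ∈ Icc (0 : ℝ) 1, 1 < p t) (s : ℝ) (ha : 0 < a)
    (hφ : IsSolution p f a φ) :
    ∀ᵐ t ∂unitMeasure, HasDerivAt (fun t => s * Real.log (φ t))
      (s * (rhs p f φ t / φ t)) t := by
  filter_upwards [hφ.ae_hasDerivAt, ae_mem_Icc] with t h1 ht
  exact (h1.log (ha.trans_le (hφ.initial_le hp ht)).ne').const_mul s

/-- With initial values `a`, `a` and `2 ^ s⁻¹ * a` the functions compared below agree at time `0`. -/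
theorem mul_log_initial_eq {s : ℝ} (hs : 1 ≤ s) (ha : 0 < a) :
    s * Real.log (2 ^ s⁻¹ * a) = Real.log (a ^ s + a ^ s) := by
  have h1 : (2 ^ s⁻¹ * a) ^ s = a ^ s + a ^ s := by
    rw [Real.mul_rpow (by positivity) ha.le, ← Real.rpow_mul (by norm_num),
      inv_mul_cancel₀ (by linarith), Real.rpow_one]
    ring
  rw [← h1, Real.log_rpow (by positivity)]

theorem tendsto_const_mul_nhdsGT_zero {c : ℝ} (hc : 0 < c) :
    Tendsto (fun a : ℝ => c * a) (𝓝[>] 0) (𝓝[>] 0) := by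
  refine tendsto_nhdsWithin_iff.2 ⟨?_, ?_⟩
  · have : Tendsto (fun a : ℝ => c * a) (𝓝 0) (𝓝 (c * 0)) := (continuous_const_mul c).tendsto 0
    rw [mul_zero] at this
    exact this.mono_left nhdsWithin_le_nhds
  · filter_upwards [self_mem_nhdsWithin] with a ha
    exact mul_pos hc ha

/-- The norm is `s`-convex with constant one on functions supported in `{p ≥ s}`. For `s = 1`
this is the triangle inequality. The comparison principle is applied to the logarithms of `γ ^ s`
and `α ^ s + β ^ s`, where `α`, `β`, `γ` are solutions for `f`, `g`, `h`. -/
theorem lpNorm_rpow_le_add (hp : ∀ t ∈ Icc (0 : ℝ) 1, 1 < p t) {s : ℝ} (hs : 1 ≤ s)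
    (hf : f ∈ lpClass p) (hg : g ∈ lpClass p) (hh : h ∈ lpClass p)
    (hps : ∀ᵐ t ∂unitMeasure, h t ≠ 0 → s ≤ p t)
    (hfgh : ∀ᵐ t ∂unitMeasure, |h t| ^ s ≤ |f t| ^ s + |g t| ^ s) :
    lpNorm p h ^ s ≤ lpNorm p f ^ s + lpNorm p g ^ s := by
  have hs0 : 0 < s := by linarith
  obtain ⟨F, hF, hFl⟩ := exists_tendsto_lpNorm hp hf
  obtain ⟨G, hG, hGl⟩ := exists_tendsto_lpNorm hp hg
  obtain ⟨H, hH, -⟩ := exists_tendsto_lpNorm hp hh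
  have key : ∀ a > 0, lpNorm p h ^ s ≤ F a 1 ^ s + G a 1 ^ s := by
    intro a ha
    have hc : 0 < (2 : ℝ) ^ s⁻¹ * a := by positivity
    have hHc := hH _ hc
    have hcmp := le_of_deriv_le_of_lt
      (absolutelyContinuousOnInterval_mul_log hp s hc hHc)
      (absolutelyContinuousOnInterval_log_add_rpow hp hs ha (hF a ha) (hG a ha))
      (by rw [hHc.map_zero, (hF a ha).map_zero, (hG a ha).map_zero, mul_log_initial_eq hs ha])
      (by
        filter_upwards [ae_hasDerivAt_mul_log hp s hc hHc,
          ae_hasDerivAt_log_add_rpow hp s ha (hF a ha) (hG a ha), hps, hfgh, ae_mem_Icc]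
          with t h1 h2 h3 h4 ht hlt
        rw [h1.deriv, h2.deriv]
        have hFp := ha.trans_le ((hF a ha).initial_le hp ht)
        have hGp := ha.trans_le ((hG a ha).initial_le hp ht)
        have hHp := hc.trans_le (hHc.initial_le hp ht)
        by_cases h0 : h t = 0
        · have hpt := hp t ht
          have hz : rhs p h (H (2 ^ s⁻¹ * a)) t = 0 := by
            simp [rhs, h0, Real.zero_rpow (by linarith : p t ≠ 0)]
          rw [hz, zero_div, mul_zero]
          have hr1 := rhs_nonneg (f := f) hp (hF a ha).nonneg ht
          have hr2 := rhs_nonneg (f := g) hp (hG a ha).nonneg ht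
          positivity
        · refine log_rate_le (abs_nonneg _) (abs_nonneg _) (abs_nonneg _) hFp hGp hHp hs0 (h3 h0)
            h4 ?_
          rw [← Real.log_rpow hHp] at hlt
          exact ((Real.log_lt_log_iff (by positivity) (by positivity)).1 hlt).le)
    have h1 : (1 : ℝ) ∈ Icc (0 : ℝ) 1 := ⟨zero_le_one, le_rfl⟩
    have hFp := ha.trans_le ((hF a ha).initial_le hp h1)
    have hGp := ha.trans_le ((hG a ha).initial_le hp h1)
    have hHp := hc.trans_le (hHc.initial_le hp h1)
    have h2 := hcmp 1 h1
    rw [← Real.log_rpow hHp, Real.log_le_log_iff (by positivity) (by positivity)] at h2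
    refine le_trans ?_ h2
    have h3 := hHc.lpNorm_le hp hh hc
    have h4 := lpNorm_nonneg p h
    gcongr
  have hlim := (hFl.rpow_const (p := s) (Or.inr hs0.le)).add
    (hGl.rpow_const (p := s) (Or.inr hs0.le))
  refine ge_of_tendsto hlim ?_
  filter_upwards [self_mem_nhdsWithin] with a ha using key a ha

/-- The norm is `s`-concave with constant one on functions supported in `{p ≤ s}`. -/
theorem add_le_lpNorm_rpow (hp : ∀ t ∈ Icc (0 : ℝ) 1, 1 < p t) {s : ℝ} (hs : 1 ≤ s)
    (hf : f ∈ lpClass p) (hg : g ∈ lpClass p) (hh : h ∈ lpClass p)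
    (hps : ∀ᵐ t ∂unitMeasure, h t ≠ 0 → p t ≤ s)
    (hfgh : ∀ᵐ t ∂unitMeasure, |f t| ^ s + |g t| ^ s ≤ |h t| ^ s) :
    lpNorm p f ^ s + lpNorm p g ^ s ≤ lpNorm p h ^ s := by
  have hs0 : 0 < s := by linarith
  obtain ⟨F, hF, -⟩ := exists_tendsto_lpNorm hp hf
  obtain ⟨G, hG, -⟩ := exists_tendsto_lpNorm hp hg
  obtain ⟨H, hH, hHl⟩ := exists_tendsto_lpNorm hp hh
  have hc2 : (0 : ℝ) < 2 ^ s⁻¹ := by positivity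
  have key : ∀ a > 0, lpNorm p f ^ s + lpNorm p g ^ s ≤ H (2 ^ s⁻¹ * a) 1 ^ s := by
    intro a ha
    have hc : 0 < (2 : ℝ) ^ s⁻¹ * a := by positivity
    have hHc := hH _ hc
    have hcmp := le_of_deriv_le_of_lt
      (absolutelyContinuousOnInterval_log_add_rpow hp hs ha (hF a ha) (hG a ha))
      (absolutelyContinuousOnInterval_mul_log hp s hc hHc)
      (by rw [hHc.map_zero, (hF a ha).map_zero, (hG a ha).map_zero, mul_log_initial_eq hs ha])
      (by
        filter_upwards [ae_hasDerivAt_mul_log hp s hc hHc,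
          ae_hasDerivAt_log_add_rpow hp s ha (hF a ha) (hG a ha), hps, hfgh, ae_mem_Icc]
          with t h1 h2 h3 h4 ht hlt
        rw [h1.deriv, h2.deriv]
        have hpt := hp t ht
        have hFp := ha.trans_le ((hF a ha).initial_le hp ht)
        have hGp := ha.trans_le ((hG a ha).initial_le hp ht)
        have hHp := hc.trans_le (hHc.initial_le hp ht)
        by_cases h0 : h t = 0
        · rw [h0, abs_zero, Real.zero_rpow hs0.ne'] at h4
          have hf0 : 0 ≤ |f t| ^ s := by positivity
          have hg0 : 0 ≤ |g t| ^ s := by positivity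
          have hf1 : |f t| = 0 :=
            (Real.rpow_eq_zero (abs_nonneg _) hs0.ne').1 (by linarith)
          have hg1 : |g t| = 0 :=
            (Real.rpow_eq_zero (abs_nonneg _) hs0.ne').1 (by linarith)
          simp [rhs, h0, hf1, hg1, Real.zero_rpow (by linarith : p t ≠ 0)]
        · refine le_log_rate (abs_nonneg _) (abs_nonneg _) (abs_nonneg _) hFp hGp hHp
            (by linarith) (h3 h0) h4 ?_
          rw [← Real.log_rpow hHp] at hlt
          exact ((Real.log_lt_log_iff (by positivity) (by positivity)).1 hlt).le)
    have h1 : (1 : ℝ) ∈ Icc (0 : ℝ) 1 := ⟨zero_le_one, le_rfl⟩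
    have hFp := ha.trans_le ((hF a ha).initial_le hp h1)
    have hGp := ha.trans_le ((hG a ha).initial_le hp h1)
    have hHp := hc.trans_le (hHc.initial_le hp h1)
    have h2 := hcmp 1 h1
    rw [← Real.log_rpow hHp, Real.log_le_log_iff (by positivity) (by positivity)] at h2
    refine le_trans ?_ h2
    have h3 := (hF a ha).lpNorm_le hp hf ha
    have h4 := (hG a ha).lpNorm_le hp hg ha
    have h5 := lpNorm_nonneg p f
    have h6 := lpNorm_nonneg p g
    gcongr
  refine ge_of_tendsto ((hHl.comp (tendsto_const_mul_nhdsGT_zero hc2)).rpow_const (p := s)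
    (Or.inr hs0.le)) ?_
  filter_upwards [self_mem_nhdsWithin] with a ha using key a ha

theorem lpNorm_add_le (hp : ∀ t ∈ Icc (0 : ℝ) 1, 1 < p t) (hf : f ∈ lpClass p)
    (hg : g ∈ lpClass p) (hfg : f + g ∈ lpClass p) :
    lpNorm p (f + g) ≤ lpNorm p f + lpNorm p g := by
  have h := lpNorm_rpow_le_add hp le_rfl hf hg hfg
    (by filter_upwards [ae_mem_Icc] with t ht _ using (hp t ht).le)
    (by
      filter_upwards [AEEqFun.coeFn_add f g] with t ht
      simpa [ht] using abs_add_le (f t) (g t))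
  simpa using h

end

/-! ### The modular and its finite elements -/

section

variable {p : ℝ → ℝ} {f g h : LZero} {a b : ℝ} {φ ψ : ℝ → ℝ}

/-- The modular `∫ |f|^{p(t)} / p(t) dt`, with values in `[0, ∞]`. -/
def modular (p : ℝ → ℝ) (f : LZero) : ENNReal :=
  ∫⁻ t, ENNReal.ofReal (|f t| ^ p t / p t) ∂unitMeasure

/-- The finite elements: functions all of whose multiples have finite modular. They form a linear
space on which the norm is order continuous, for every exponent `p`. -/
def finiteElements (p : ℝ → ℝ) : Set LZero :=
  {f | ∀ c : ℝ, modular p (c • f) < ⊤}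

theorem aemeasurable_modular (hpm : AEMeasurable p unitMeasure) (f : LZero) :
    AEMeasurable (fun t => ENNReal.ofReal (|f t| ^ p t / p t)) unitMeasure :=
  ((f.aestronglyMeasurable.aemeasurable.abs.pow hpm).div hpm).ennreal_ofReal

theorem modular_mono (hp : ∀ t ∈ Icc (0 : ℝ) 1, 1 < p t)
    (hfg : ∀ᵐ t ∂unitMeasure, |f t| ≤ |g t|) : modular p f ≤ modular p g := by
  refine lintegral_mono_ae ?_
  filter_upwards [hfg, ae_mem_Icc] with t h1 ht
  have hpt := hp t ht
  refine ENNReal.ofReal_le_ofReal ?_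
  gcongr

theorem modular_add_le (hpm : AEMeasurable p unitMeasure) (hp : ∀ t ∈ Icc (0 : ℝ) 1, 1 < p t)
    (f g : LZero) :
    modular p (f + g) ≤ modular p ((2 : ℝ) • f) + modular p ((2 : ℝ) • g) := by
  unfold modular
  rw [← lintegral_add_left' (aemeasurable_modular hpm _)]
  refine lintegral_mono_ae ?_
  filter_upwards [AEEqFun.coeFn_add f g, coeFn_smul_abs 2 f, coeFn_smul_abs 2 g, ae_mem_Icc]
    with t h1 h2 h3 ht
  have hpt := hp t ht
  rw [h1, h2, h3, Pi.add_apply, abs_of_pos (two_pos : (0 : ℝ) < 2),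
    ← ENNReal.ofReal_add (by positivity) (by positivity), ← add_div]
  refine ENNReal.ofReal_le_ofReal ?_
  have hf0 := abs_nonneg (f t)
  have hg0 := abs_nonneg (g t)
  have hfp : 0 ≤ (2 * |f t|) ^ p t := by positivity
  have hgp : 0 ≤ (2 * |g t|) ^ p t := by positivity
  gcongr
  rcases le_total |f t| |g t| with hle | hle
  · calc |f t + g t| ^ p t ≤ (2 * |g t|) ^ p t := by
          gcongr
          linarith [abs_add_le (f t) (g t)]
      _ ≤ _ := by linarith
  · calc |f t + g t| ^ p t ≤ (2 * |f t|) ^ p t := by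
          gcongr
          linarith [abs_add_le (f t) (g t)]
      _ ≤ _ := by linarith

theorem smul_mem_finiteElements (c : ℝ) (hf : f ∈ finiteElements p) :
    c • f ∈ finiteElements p := fun d => by
  rw [smul_smul]
  exact hf _

theorem add_mem_finiteElements (hpm : AEMeasurable p unitMeasure)
    (hp : ∀ t ∈ Icc (0 : ℝ) 1, 1 < p t) (hf : f ∈ finiteElements p)
    (hg : g ∈ finiteElements p) : f + g ∈ finiteElements p := fun d => by
  rw [smul_add]
  refine (modular_add_le hpm hp _ _).trans_lt (ENNReal.add_lt_top.2 ⟨?_, ?_⟩)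
  · exact smul_mem_finiteElements d hf _
  · exact smul_mem_finiteElements d hg _

theorem sub_mem_finiteElements (hpm : AEMeasurable p unitMeasure)
    (hp : ∀ t ∈ Icc (0 : ℝ) 1, 1 < p t) (hf : f ∈ finiteElements p)
    (hg : g ∈ finiteElements p) : f - g ∈ finiteElements p := by
  have := add_mem_finiteElements hpm hp hf (smul_mem_finiteElements (-1) hg)
  rwa [neg_one_smul, ← sub_eq_add_neg] at this

theorem mem_finiteElements_of_abs_le (hp : ∀ t ∈ Icc (0 : ℝ) 1, 1 < p t)
    (hf : f ∈ finiteElements p) (hgf : ∀ᵐ t ∂unitMeasure, |g t| ≤ |f t|) :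
    g ∈ finiteElements p := fun c => by
  refine (modular_mono hp ?_).trans_lt (hf c)
  filter_upwards [hgf, coeFn_smul_abs c f, coeFn_smul_abs c g] with t h1 h2 h3
  rw [h2, h3]
  gcongr

theorem self_le_two_rpow {q : ℝ} (hq : 1 ≤ q) : q ≤ 2 ^ q := by
  have := one_add_mul_self_le_rpow_one_add (s := 1) (by norm_num) hq
  norm_num at this
  linarith

theorem exists_isSolution_of_mem_finiteElements (hpm : AEMeasurable p unitMeasure)
    (hp : ∀ t ∈ Icc (0 : ℝ) 1, 1 < p t) (hf : f ∈ finiteElements p) (ha : 0 < a) :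
    ∃ φ, IsSolution p f a φ := by
  refine exists_isSolution hpm hp ha
    ⟨(aemeasurable_abs_rpow hpm f a⁻¹).aestronglyMeasurable, ?_⟩
  rw [hasFiniteIntegral_iff_ofReal (Eventually.of_forall fun t => by positivity)]
  refine lt_of_le_of_lt (lintegral_mono_ae ?_) (hf (2 * a⁻¹))
  filter_upwards [coeFn_smul_abs (2 * a⁻¹) f, ae_mem_Icc] with t h1 ht
  have hpt := hp t ht
  refine ENNReal.ofReal_le_ofReal ?_
  rw [h1, abs_of_pos (by positivity : 0 < 2 * a⁻¹), le_div_iff₀ (by linarith), mul_assoc,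
    Real.mul_rpow two_pos.le (by positivity), mul_comm]
  have := self_le_two_rpow hpt.le
  gcongr

theorem mem_lpClass_of_mem_finiteElements (hpm : AEMeasurable p unitMeasure)
    (hp : ∀ t ∈ Icc (0 : ℝ) 1, 1 < p t) (hf : f ∈ finiteElements p) : f ∈ lpClass p :=
  mem_lpClass_of_forall_exists hpm hp fun _ ha =>
    exists_isSolution_of_mem_finiteElements hpm hp hf ha

/-- On the unit ball the solutions stay below `1`, so that `φ ^ (1 - p) ≥ 1`. -/
theorem modular_le_one (hp : ∀ t ∈ Icc (0 : ℝ) 1, 1 < p t) (hf : f ∈ lpClass p)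
    (h : lpNorm p f < 1) : modular p f ≤ 1 := by
  obtain ⟨Φ, hΦ, hl⟩ := exists_tendsto_lpNorm hp hf
  obtain ⟨a, ha1, ha⟩ := ((hl.eventually_lt_const h).and self_mem_nhdsWithin).exists
  have ha0 : 0 < a := ha
  have hs := hΦ a ha0
  calc modular p f ≤ ∫⁻ t, ENNReal.ofReal (rhs p f (Φ a) t) ∂unitMeasure := by
        refine lintegral_mono_ae ?_
        filter_upwards [ae_mem_Icc] with t ht
        have hpt := hp t ht
        refine ENNReal.ofReal_le_ofReal ?_
        have h1 : 1 ≤ Φ a t ^ (1 - p t) :=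
          Real.one_le_rpow_of_pos_of_le_one_of_nonpos (ha0.trans_le (hs.initial_le hp ht))
            ((hs.le_one hp ht).trans ha1.le) (by linarith)
        have h2 : 0 ≤ |f t| ^ p t / p t := by positivity
        exact le_mul_of_one_le_right h2 h1
    _ = ENNReal.ofReal (∫ t, rhs p f (Φ a) t ∂unitMeasure) :=
        (ofReal_integral_eq_lintegral_ofReal hs.integrable_rhs (by
          filter_upwards [ae_mem_Icc] with t ht using rhs_nonneg hp hs.nonneg ht)).symm
    _ ≤ 1 := by
        rw [ENNReal.ofReal_le_one]
        linarith [hs.apply_one]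

/-- The solution starting from `1` stays above `1`, so that `φ ^ (1 - p) ≤ 1` and its increment
is at most the modular. -/
theorem lpNorm_le_two (hp : ∀ t ∈ Icc (0 : ℝ) 1, 1 < p t) (hf : f ∈ lpClass p)
    (h : modular p f ≤ 1) : lpNorm p f ≤ 2 := by
  obtain ⟨Φ, hΦ, -⟩ := exists_tendsto_lpNorm hp hf
  have hs := hΦ 1 one_pos
  refine (hs.lpNorm_le hp hf one_pos).trans ?_
  have h1 : ENNReal.ofReal (∫ t, rhs p f (Φ 1) t ∂unitMeasure) ≤ 1 := by
    rw [ofReal_integral_eq_lintegral_ofReal hs.integrable_rhs (by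
          filter_upwards [ae_mem_Icc] with t ht using rhs_nonneg hp hs.nonneg ht)]
    refine le_trans (lintegral_mono_ae ?_) h
    filter_upwards [ae_mem_Icc] with t ht
    have hpt := hp t ht
    refine ENNReal.ofReal_le_ofReal (mul_le_of_le_one_right (by positivity) ?_)
    exact Real.rpow_le_one_of_one_le_of_nonpos (hs.initial_le hp ht) (by linarith)
  rw [ENNReal.ofReal_le_one] at h1
  linarith [hs.apply_one]

theorem lpNorm_le_of_modular_smul_le_one (hp : ∀ t ∈ Icc (0 : ℝ) 1, 1 < p t)
    (hf : f ∈ lpClass p) {c : ℝ} (hc : 0 < c) (h : modular p (c • f) ≤ 1) :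
    lpNorm p f ≤ 2 / c := by
  have h1 := lpNorm_le_two hp (smul_mem_lpClass hp c hf) h
  rw [lpNorm_smul hp c hf, abs_of_pos hc] at h1
  rw [le_div_iff₀ hc]
  linarith

theorem modular_smul_le_one (hp : ∀ t ∈ Icc (0 : ℝ) 1, 1 < p t)
    (hf : f ∈ lpClass p) {c : ℝ} (h : |c| * lpNorm p f < 1) : modular p (c • f) ≤ 1 :=
  modular_le_one hp (smul_mem_lpClass hp c hf) (by rwa [lpNorm_smul hp c hf])

theorem mem_finiteElements_of_modular_lt_top (hp : ∀ t ∈ Icc (0 : ℝ) 1, 1 < p t) {K : ℝ}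
    (hK : ∀ᵐ t ∂unitMeasure, f t ≠ 0 → p t ≤ K) (h : modular p f < ⊤) :
    f ∈ finiteElements p := fun c => by
  set C := max |c| 1 ^ K with hC
  have hC0 : 0 ≤ C := Real.rpow_nonneg (zero_le_one.trans (le_max_right _ _)) _
  calc modular p (c • f) ≤ ∫⁻ t, ENNReal.ofReal C * ENNReal.ofReal (|f t| ^ p t / p t)
        ∂unitMeasure := by
        refine lintegral_mono_ae ?_
        filter_upwards [coeFn_smul_abs c f, hK, ae_mem_Icc] with t h1 h2 ht
        have hpt := hp t ht
        rw [← ENNReal.ofReal_mul hC0]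
        refine ENNReal.ofReal_le_ofReal ?_
        rw [h1]
        by_cases h0 : f t = 0
        · simp [h0, Real.zero_rpow (by linarith : p t ≠ 0)]
        · rw [Real.mul_rpow (abs_nonneg _) (abs_nonneg _), mul_div_assoc]
          have h3 : |c| ^ p t ≤ C :=
            (Real.rpow_le_rpow (abs_nonneg _) (le_max_left _ 1) (by linarith)).trans
              (Real.rpow_le_rpow_of_exponent_le (le_max_right _ _) (h2 h0))
          gcongr
    _ = ENNReal.ofReal C * modular p f := lintegral_const_mul' _ _ ENNReal.ofReal_ne_top
    _ < ⊤ := ENNReal.mul_lt_top ENNReal.ofReal_lt_top h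

/-- Where the exponent is bounded, finiteness of the modular does not depend on a scalar factor. -/
theorem mem_finiteElements_of_mem_lpClass (hp : ∀ t ∈ Icc (0 : ℝ) 1, 1 < p t) {K : ℝ}
    (hK : ∀ᵐ t ∂unitMeasure, f t ≠ 0 → p t ≤ K) (hf : f ∈ lpClass p) :
    f ∈ finiteElements p := by
  set c := (lpNorm p f + 1)⁻¹ with hc
  have hN := lpNorm_nonneg p f
  have hc0 : 0 < c := by positivity
  have h1 : modular p (c • f) ≤ 1 := by
    refine modular_smul_le_one hp hf ?_
    rw [abs_of_pos hc0, hc, inv_mul_lt_iff₀ (by positivity)]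
    linarith
  have h2 : c • f ∈ finiteElements p := by
    refine mem_finiteElements_of_modular_lt_top hp (K := K) ?_
      (h1.trans_lt ENNReal.one_lt_top)
    filter_upwards [hK, coeFn_smul_abs c f] with t h3 h4 h5
    refine h3 fun h0 => h5 ?_
    rw [h0, abs_zero, mul_zero, abs_eq_zero] at h4
    exact h4
  have h3 := smul_mem_finiteElements c⁻¹ h2
  rwa [smul_smul, inv_mul_cancel₀ hc0.ne', one_smul] at h3

theorem mul_modular_le (hp : ∀ t ∈ Icc (0 : ℝ) 1, 1 < p t) {c : ℝ} (hc : 1 ≤ c) (f : LZero) :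
    ENNReal.ofReal c * modular p f ≤ modular p (c • f) := by
  unfold modular
  rw [← lintegral_const_mul' _ _ ENNReal.ofReal_ne_top]
  refine lintegral_mono_ae ?_
  filter_upwards [coeFn_smul_abs c f, ae_mem_Icc] with t h1 ht
  have hpt := hp t ht
  rw [← ENNReal.ofReal_mul (by linarith), h1,
    abs_of_pos (zero_lt_one.trans_le hc),
    Real.mul_rpow (by linarith) (abs_nonneg _), mul_div_assoc]
  refine ENNReal.ofReal_le_ofReal ?_
  have : c ≤ c ^ p t := by
    simpa using Real.rpow_le_rpow_of_exponent_le hc hpt.le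
  gcongr

theorem eq_zero_of_modular_eq_zero (hpm : AEMeasurable p unitMeasure)
    (hp : ∀ t ∈ Icc (0 : ℝ) 1, 1 < p t) (h : modular p f = 0) : f = 0 := by
  have h1 := (lintegral_eq_zero_iff' (aemeasurable_modular hpm f)).1 h
  refine AEEqFun.ext ?_
  filter_upwards [h1, AEEqFun.coeFn_zero (α := ℝ) (β := ℝ) (μ := unitMeasure), ae_mem_Icc]
    with t h2 h3 ht
  have hpt := hp t ht
  rw [h3, Pi.zero_apply]
  rw [Pi.zero_apply, ENNReal.ofReal_eq_zero] at h2
  have h4 : 0 ≤ |f t| ^ p t := by positivity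
  have h5 : |f t| ^ p t ≤ 0 := by
    by_contra! hc
    exact absurd h2 (not_le.2 (by positivity))
  have h6 := (Real.rpow_eq_zero (abs_nonneg _) (by linarith)).1 (le_antisymm h5 h4)
  exact abs_eq_zero.1 h6

/-- A function of norm zero has all its multiples in the unit ball, and hence of modular at most `1`,
while the modular of `c • f` is at least `c` times that of `f`. -/
theorem lpNorm_eq_zero_iff (hpm : AEMeasurable p unitMeasure)
    (hp : ∀ t ∈ Icc (0 : ℝ) 1, 1 < p t) (hf : f ∈ lpClass p) :
    lpNorm p f = 0 ↔ f = 0 := by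
  refine ⟨fun h => eq_zero_of_modular_eq_zero hpm hp ?_, fun h => h ▸ lpNorm_zero hp⟩
  have h1 : ∀ n : ℕ, modular p f ≤ ((n : ENNReal) + 1)⁻¹ := fun n => by
    have hn : (1 : ℝ) ≤ (n : ℝ) + 1 := by
      have : (0 : ℝ) ≤ n := n.cast_nonneg
      linarith
    have h2 := (mul_modular_le hp hn f).trans
      (modular_smul_le_one hp hf (by rw [h, mul_zero]; exact one_pos))
    rw [ENNReal.ofReal_add (by positivity) zero_le_one, ENNReal.ofReal_natCast,
      ENNReal.ofReal_one] at h2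
    rw [ENNReal.le_inv_iff_mul_le, mul_comm]
    exact h2
  refine le_antisymm ?_ zero_le
  have h3 : Tendsto (fun n : ℕ => ((n : ENNReal) + 1)⁻¹) atTop (𝓝 0) := by
    have := (tendsto_add_atTop_iff_nat 1).2 ENNReal.tendsto_inv_nat_nhds_zero
    simpa using this
  exact ge_of_tendsto' h3 h1

/-- Fatou's lemma for the modular. -/
theorem modular_le_of_tendsto (hpm : AEMeasurable p unitMeasure)
    (hp : ∀ t ∈ Icc (0 : ℝ) 1, 1 < p t) {u : ℕ → LZero} {C : ENNReal}
    (hu : ∀ᵐ t ∂unitMeasure, Tendsto (fun n => |u n t|) atTop (𝓝 |f t|))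
    (hC : ∀ᶠ n in atTop, modular p (u n) ≤ C) : modular p f ≤ C := by
  calc modular p f
      = ∫⁻ t, liminf (fun n => ENNReal.ofReal (|u n t| ^ p t / p t)) atTop ∂unitMeasure := by
        refine lintegral_congr_ae ?_
        filter_upwards [hu, ae_mem_Icc] with t h1 ht
        have hpt := hp t ht
        refine (Tendsto.liminf_eq ?_).symm
        exact (ENNReal.continuous_ofReal.tendsto _).comp
          ((h1.rpow_const (Or.inr (by linarith))).div_const _)
    _ ≤ liminf (fun n => modular p (u n)) atTop :=
        lintegral_liminf_le' fun n => aemeasurable_modular hpm _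
    _ ≤ C := by
        refine liminf_le_of_frequently_le' hC.frequently

/-- The norm is order continuous on the finite elements. -/
theorem tendsto_lpNorm_zero (hpm : AEMeasurable p unitMeasure)
    (hp : ∀ t ∈ Icc (0 : ℝ) 1, 1 < p t) (hf : f ∈ finiteElements p) {u : ℕ → LZero}
    (hu : ∀ n, ∀ᵐ t ∂unitMeasure, |u n t| ≤ |f t|)
    (hlim : ∀ᵐ t ∂unitMeasure, Tendsto (fun n => u n t) atTop (𝓝 0)) :
    Tendsto (fun n => lpNorm p (u n)) atTop (𝓝 0) := by
  have huc : ∀ n, u n ∈ lpClass p := fun n =>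
    mem_lpClass_of_mem_finiteElements hpm hp (mem_finiteElements_of_abs_le hp hf (hu n))
  rw [Metric.tendsto_atTop']
  intro ε hε
  set c : ℝ := 4 / ε with hc
  have hc0 : 0 < c := by positivity
  have h1 : Tendsto (fun n => modular p (c • u n)) atTop (𝓝 (∫⁻ _, 0 ∂unitMeasure)) := by
    refine tendsto_lintegral_of_dominated_convergence'
      (fun t => ENNReal.ofReal (|(c • f : LZero) t| ^ p t / p t))
      (fun n => aemeasurable_modular hpm _) (fun n => ?_) (hf c).ne ?_
    · filter_upwards [hu n, coeFn_smul_abs c f, coeFn_smul_abs c (u n), ae_mem_Icc]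
        with t h1 h2 h3 ht
      have hpt := hp t ht
      refine ENNReal.ofReal_le_ofReal ?_
      rw [h2, h3]
      gcongr
    · have hall : ∀ᵐ t ∂unitMeasure, ∀ n, |(c • u n : LZero) t| = |c| * |u n t| :=
        ae_all_iff.2 fun n => coeFn_smul_abs c (u n)
      filter_upwards [hlim, hall, ae_mem_Icc] with t h1 h2 ht
      have hpt := hp t ht
      have h3 : Tendsto (fun n => (|c| * |u n t|) ^ p t / p t) atTop (𝓝 0) := by
        have := ((h1.abs.const_mul |c|).rpow_const (p := p t) (Or.inr (by linarith))).div_const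
          (p t)
        simpa [Real.zero_rpow (by linarith : p t ≠ 0)] using this
      simp only [h2]
      have := (ENNReal.continuous_ofReal.tendsto _).comp h3
      rwa [ENNReal.ofReal_zero] at this
  rw [lintegral_zero] at h1
  obtain ⟨N, hN⟩ := eventually_atTop.1 (h1.eventually_le_const zero_lt_one)
  refine ⟨N, fun n hn => ?_⟩
  have h2 := lpNorm_le_of_modular_smul_le_one hp (huc n) hc0 (hN n hn.le)
  rw [Real.dist_eq, sub_zero, abs_of_nonneg (lpNorm_nonneg _ _)]
  have h3 : 2 / c = ε / 2 := by
    rw [hc]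
    field_simp
    norm_num
  linarith

end

/-! ### Completeness for essentially bounded exponents -/

section

variable {p : ℝ → ℝ} {f g h : LZero} {a b : ℝ} {φ ψ : ℝ → ℝ}

theorem add_mem_lpClass (hpm : AEMeasurable p unitMeasure)
    (hp : ∀ t ∈ Icc (0 : ℝ) 1, 1 < p t) {K : ℝ} (hK : ∀ᵐ t ∂unitMeasure, p t ≤ K)
    (hf : f ∈ lpClass p) (hg : g ∈ lpClass p) : f + g ∈ lpClass p := by
  have hK' : ∀ u : LZero, ∀ᵐ t ∂unitMeasure, u t ≠ 0 → p t ≤ K := fun u =>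
    hK.mono fun t ht _ => ht
  exact mem_lpClass_of_mem_finiteElements hpm hp (add_mem_finiteElements hpm hp
    (mem_finiteElements_of_mem_lpClass hp (hK' f) hf)
    (mem_finiteElements_of_mem_lpClass hp (hK' g) hg))

theorem isNormedFunctionSpace (hpm : AEMeasurable p unitMeasure)
    (hp : ∀ t ∈ Icc (0 : ℝ) 1, 1 < p t) {K : ℝ} (hK : ∀ᵐ t ∂unitMeasure, p t ≤ K) :
    IsNormedFunctionSpace (lpClass p) (lpNorm p) where
  zero_mem := zero_mem_lpClass hp
  add_mem _ hf _ hg := add_mem_lpClass hpm hp hK hf hg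
  smul_mem c _ hf := smul_mem_lpClass hp c hf
  norm_nonneg f _ := lpNorm_nonneg p f
  norm_smul c _ hf := lpNorm_smul hp c hf
  norm_add_le _ hf _ hg := lpNorm_add_le hp hf hg (add_mem_lpClass hpm hp hK hf hg)
  norm_eq_zero_iff _ hf := lpNorm_eq_zero_iff hpm hp hf

/-- The modular controls the `L¹` norm since `|x| ≤ 1 + |x| ^ q`. -/
theorem lintegral_enorm_le_of_modular_le_one (hp : ∀ t ∈ Icc (0 : ℝ) 1, 1 < p t) {K : ℝ}
    (hK : ∀ᵐ t ∂unitMeasure, p t ≤ K) (h : modular p f ≤ 1) :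
    ∫⁻ t, ‖f t‖ₑ ∂unitMeasure ≤ 1 + ENNReal.ofReal K := by
  calc ∫⁻ t, ‖f t‖ₑ ∂unitMeasure
      ≤ ∫⁻ t, (1 + ENNReal.ofReal K * ENNReal.ofReal (|f t| ^ p t / p t)) ∂unitMeasure := by
        refine lintegral_mono_ae ?_
        filter_upwards [hK, ae_mem_Icc] with t h1 ht
        have hpt := hp t ht
        have hK0 : 0 ≤ K := by linarith
        rw [← ENNReal.ofReal_mul hK0, ← ENNReal.ofReal_one,
          ← ENNReal.ofReal_add zero_le_one (by positivity), ← ofReal_norm,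
          Real.norm_eq_abs]
        refine ENNReal.ofReal_le_ofReal ?_
        have h2 : |f t| ≤ 1 + |f t| ^ p t := by
          rcases le_total |f t| 1 with h3 | h3
          · have : 0 ≤ |f t| ^ p t := by positivity
            linarith
          · have := Real.rpow_le_rpow_of_exponent_le h3 hpt.le
            rw [Real.rpow_one] at this
            linarith
        have h4 : |f t| ^ p t ≤ K * (|f t| ^ p t / p t) := by
          rw [← mul_div_assoc, le_div_iff₀ (by linarith), mul_comm K]
          gcongr
        linarith
    _ = 1 + ENNReal.ofReal K * modular p f := by
        rw [lintegral_add_left measurable_const, lintegral_const_mul' _ _ ENNReal.ofReal_ne_top]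
        simp [modular]
    _ ≤ 1 + ENNReal.ofReal K * 1 := by gcongr
    _ = _ := by rw [mul_one]

theorem lintegral_enorm_le (hp : ∀ t ∈ Icc (0 : ℝ) 1, 1 < p t) {K : ℝ}
    (hK : ∀ᵐ t ∂unitMeasure, p t ≤ K) (hf : f ∈ lpClass p) {c : ℝ} (hc : 0 < c)
    (h : lpNorm p f < c) :
    ∫⁻ t, ‖f t‖ₑ ∂unitMeasure ≤ ENNReal.ofReal c * (1 + ENNReal.ofReal K) := by
  have h1 := lintegral_enorm_le_of_modular_le_one hp hK
    (modular_smul_le_one hp hf (c := c⁻¹) (by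
      rw [abs_of_pos (inv_pos.2 hc), inv_mul_lt_iff₀ hc, mul_one]
      exact h))
  have h2 : ∫⁻ t, ‖f t‖ₑ ∂unitMeasure =
      ENNReal.ofReal c * ∫⁻ t, ‖(c⁻¹ • f : LZero) t‖ₑ ∂unitMeasure := by
    rw [← lintegral_const_mul' _ _ ENNReal.ofReal_ne_top]
    refine lintegral_congr_ae ?_
    filter_upwards [coeFn_smul_abs c⁻¹ f] with t ht
    rw [← ofReal_norm, ← ofReal_norm, Real.norm_eq_abs, Real.norm_eq_abs, ht,
      ← ENNReal.ofReal_mul hc.le, abs_of_pos (inv_pos.2 hc), mul_inv_cancel_left₀ hc.ne']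
  rw [h2]
  gcongr

/-- The Riesz–Fischer theorem: a fast Cauchy sequence converges almost everywhere because the norm
controls the `L¹` norm, and Fatou's lemma for the modular shows that it converges in norm. -/
theorem completeSpace (hpm : AEMeasurable p unitMeasure)
    (hp : ∀ t ∈ Icc (0 : ℝ) 1, 1 < p t) {K : ℝ} (hK : ∀ᵐ t ∂unitMeasure, p t ≤ K)
    (H : IsNormedFunctionSpace (lpClass p) (lpNorm p)) : CompleteSpace H.Space := by
  refine Metric.complete_of_convergent_controlled_sequences (fun n => (1 / 2 : ℝ) ^ n)
    (fun n => by positivity) fun u hu => ?_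
  set v : ℕ → LZero := fun n => (u n).1 with hv
  have hvc : ∀ n, v n ∈ lpClass p := fun n => (u n).2
  have hsub : ∀ n m, v n - v m ∈ lpClass p := fun n m => (u n - u m).2
  have hdist : ∀ N n m, N ≤ n → N ≤ m → lpNorm p (v n - v m) < (1 / 2 : ℝ) ^ N := by
    intro N n m hn hm
    have := hu N n m hn hm
    rw [dist_eq_norm] at this
    exact this
  set C : ENNReal := 2 + ENNReal.ofReal K with hC
  have hae : ∀ᵐ t ∂unitMeasure, ∃ l, Tendsto (fun n => v n t) atTop (𝓝 l) := by
    refine Lp.ae_tendsto_of_cauchy_eLpNorm (p := 1) (fun n => (v n).aestronglyMeasurable) le_rfl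
      (B := fun n => C * ENNReal.ofReal ((1 / 2 : ℝ) ^ n)) ?_ fun N n m hn hm => ?_
    · rw [ENNReal.tsum_mul_left, ← ENNReal.ofReal_tsum_of_nonneg (fun n => by positivity)
        (summable_geometric_of_lt_one (by norm_num) (by norm_num))]
      exact ENNReal.mul_ne_top (by simp [hC]) ENNReal.ofReal_ne_top
    · have h1 := lintegral_enorm_le hp hK (hsub n m) (by positivity) (hdist N n m hn hm)
      have h2 : eLpNorm (⇑(v n) - ⇑(v m)) 1 unitMeasure =
          ∫⁻ t, ‖(v n - v m : LZero) t‖ₑ ∂unitMeasure := by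
        rw [eLpNorm_one_eq_lintegral_enorm]
        refine lintegral_congr_ae ?_
        filter_upwards [AEEqFun.coeFn_sub (v n) (v m)] with t ht
        rw [ht]
      rw [h2]
      refine h1.trans_lt ?_
      rw [mul_comm]
      refine ENNReal.mul_lt_mul_left ?_ ENNReal.ofReal_ne_top ?_
      · exact (ENNReal.ofReal_pos.2 (by positivity)).ne'
      · rw [hC]
        exact ENNReal.add_lt_add_right ENNReal.ofReal_ne_top (by norm_num)
  obtain ⟨F, hFm, hF⟩ := exists_stronglyMeasurable_limit_of_tendsto_ae
    (fun n => (v n).aestronglyMeasurable) hae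
  set w : LZero := AEEqFun.mk F hFm.aestronglyMeasurable with hw
  have hmod : ∀ m, modular p ((2 : ℝ) ^ m • (w - v m)) ≤ 1 := by
    intro m
    refine modular_le_of_tendsto hpm hp (u := fun n => (2 : ℝ) ^ m • (v n - v m)) ?_ ?_
    · have h1 : ∀ᵐ t ∂unitMeasure, ∀ n,
          |((2 : ℝ) ^ m • (v n - v m) : LZero) t| = |(2 : ℝ) ^ m| * |v n t - v m t| :=
        ae_all_iff.2 fun n => by
          filter_upwards [coeFn_smul_abs ((2 : ℝ) ^ m) (v n - v m), AEEqFun.coeFn_sub (v n) (v m)]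
            with t h1 h2
          rw [h1, h2, Pi.sub_apply]
      filter_upwards [hF, h1, coeFn_smul_abs ((2 : ℝ) ^ m) (w - v m),
        AEEqFun.coeFn_sub w (v m), AEEqFun.coeFn_mk F hFm.aestronglyMeasurable]
        with t h2 h3 h4 h5 h6
      simp only [h3]
      rw [h4, h5, Pi.sub_apply, h6]
      exact ((h2.sub_const _).abs).const_mul _
    · filter_upwards [eventually_ge_atTop m] with n hn
      refine modular_smul_le_one hp (hsub n m) ?_
      have := hdist m n m hn le_rfl
      rw [one_div, inv_pow] at this
      rw [abs_of_pos (by positivity : (0 : ℝ) < 2 ^ m)]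
      have h2 : (0 : ℝ) < 2 ^ m := by positivity
      calc (2 : ℝ) ^ m * lpNorm p (v n - v m) < 2 ^ m * (2 ^ m)⁻¹ := by gcongr
        _ = 1 := mul_inv_cancel₀ h2.ne'
  have hmem : ∀ m, w - v m ∈ lpClass p := by
    intro m
    have h1 : (2 : ℝ) ^ m • (w - v m) ∈ finiteElements p :=
      mem_finiteElements_of_modular_lt_top hp (hK.mono fun t ht _ => ht)
        ((hmod m).trans_lt ENNReal.one_lt_top)
    have h2 := smul_mem_finiteElements ((2 : ℝ) ^ m)⁻¹ h1
    rw [smul_smul, inv_mul_cancel₀ (by positivity), one_smul] at h2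
    exact mem_lpClass_of_mem_finiteElements hpm hp h2
  have hwc : w ∈ lpClass p := by
    have := H.add_mem _ (hmem 0) _ (hvc 0)
    rwa [sub_add_cancel] at this
  obtain ⟨W, hW⟩ : ∃ W : H.Space, W.1 = w := ⟨⟨w, hwc⟩, rfl⟩
  refine ⟨W, ?_⟩
  rw [tendsto_iff_norm_sub_tendsto_zero]
  refine squeeze_zero (g := fun n => 2 / (2 : ℝ) ^ n) (fun n => norm_nonneg _) (fun n => ?_) ?_
  · rw [norm_sub_rev]
    change lpNorm p (W.1 - v n) ≤ _
    rw [hW]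
    exact lpNorm_le_of_modular_smul_le_one hp (hmem n) (by positivity) (hmod n)
  · have h1 := (tendsto_pow_atTop_nhds_zero_of_lt_one (r := (1 / 2 : ℝ)) (by norm_num)
      (by norm_num)).const_mul 2
    rw [mul_zero] at h1
    refine h1.congr fun n => ?_
    rw [one_div, inv_pow, div_eq_mul_inv]

end

/-! ### Two-point inequalities -/

section

/-- A lower bound for `x ^ s` by its tangent at `1` plus a quadratic term, valid up to `x = 2`. -/
theorem quadratic_le_rpow {s x : ℝ} (hs : 1 < s) (hs2 : s ≤ 2) (hx0 : 0 ≤ x) (hx2 : x ≤ 2) :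
    1 + s * (x - 1) + s * (s - 1) / 4 * (x - 1) ^ 2 ≤ x ^ s := by
  set k : ℝ → ℝ := fun x => x ^ s - (1 + s * (x - 1) + s * (s - 1) / 4 * (x - 1) ^ 2) with hk
  set k' : ℝ → ℝ := fun x => s * x ^ (s - 1) - (s + s * (s - 1) / 2 * (x - 1)) with hk'
  have hd : ∀ x : ℝ, HasDerivAt k (k' x) x := fun x => by
    have h1 := Real.hasDerivAt_rpow_const (x := x) (p := s) (Or.inr hs.le)
    have h2 : HasDerivAt (fun x : ℝ => x - 1) 1 x := (hasDerivAt_id x).sub_const 1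
    have h3 := h1.sub (((h2.const_mul s).const_add 1).add ((h2.pow 2).const_mul (s * (s - 1) / 4)))
    refine h3.congr_deriv ?_
    simp only [hk']
    push_cast
    ring
  have hdk : deriv k = k' := funext fun x => (hd x).deriv
  have hd2 : ∀ x : ℝ, 0 < x → HasDerivAt k' (s * (s - 1) * x ^ (s - 2) - s * (s - 1) / 2) x := by
    intro x hx
    have h1 := (Real.hasDerivAt_rpow_const (x := x) (p := s - 1) (Or.inl hx.ne')).const_mul s
    have h2 : HasDerivAt (fun x : ℝ => x - 1) 1 x := (hasDerivAt_id x).sub_const 1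
    have h3 := h1.sub ((h2.const_mul (s * (s - 1) / 2)).const_add s)
    refine h3.congr_deriv ?_
    rw [show s - 1 - 1 = s - 2 by ring]
    ring
  have hconv : ConvexOn ℝ (Icc 0 2) k := by
    refine convexOn_of_deriv2_nonneg (convex_Icc 0 2)
      (fun x _ => (hd x).continuousAt.continuousWithinAt)
      (fun x _ => (hd x).differentiableAt.differentiableWithinAt) ?_ ?_
    · rw [hdk, interior_Icc]
      exact fun x hx => (hd2 x hx.1).differentiableAt.differentiableWithinAt
    · rw [interior_Icc]
      intro x hx
      simp only [Function.iterate_succ, Function.iterate_zero, Function.comp_apply, id, hdk,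
        (hd2 x hx.1).deriv]
      have h1 : (2 : ℝ)⁻¹ ≤ x ^ (s - 2) :=
        calc (2 : ℝ)⁻¹ = 2 ^ (-1 : ℝ) := by rw [Real.rpow_neg_one]
          _ ≤ 2 ^ (s - 2) := Real.rpow_le_rpow_of_exponent_le (by norm_num) (by linarith)
          _ ≤ x ^ (s - 2) := Real.rpow_le_rpow_of_nonpos hx.1 hx.2.le (by linarith)
      have h2 : 0 < s * (s - 1) := mul_pos (by linarith) (by linarith)
      nlinarith
  have hk1 : k 1 = 0 := by simp [hk]
  have hk'1 : deriv k 1 = 0 := by simp [hdk, hk']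
  have h1m : (1 : ℝ) ∈ Icc (0 : ℝ) 2 := by norm_num
  have hmain : 0 ≤ k x := by
    rcases lt_trichotomy x 1 with hlt | rfl | hlt
    · have h := hconv.slope_le_deriv ⟨hx0, hx2⟩ h1m hlt (hd 1).differentiableAt
      rw [hk'1, slope_def_field, hk1, div_nonpos_iff] at h
      rcases h with h | h <;> linarith [h.1, h.2]
    · exact hk1.ge
    · have h := hconv.deriv_le_slope h1m ⟨hx0, hx2⟩ hlt (hd 1).differentiableAt
      rw [hk'1, slope_def_field, hk1, sub_zero] at h
      by_contra! hc
      exact absurd h (not_le.2 (div_neg_of_neg_of_pos hc (by linarith)))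
  simp only [hk] at hmain
  linarith

/-- The power mean of `1 + v` and `1 - v` exceeds `1` by a quadratic gain; the linear terms of the
two lower bounds cancel. -/
theorem one_add_sq_le_rpow_mean {s v : ℝ} (hs : 1 < s) (hs2 : s ≤ 2) (hv : |v| ≤ 1) :
    1 + s * (s - 1) / 4 * v ^ 2 ≤ (|1 + v| ^ s + |1 - v| ^ s) / 2 := by
  obtain ⟨h1, h2⟩ := abs_le.1 hv
  have h3 := quadratic_le_rpow hs hs2 (x := 1 + v) (by linarith) (by linarith)
  have h4 := quadratic_le_rpow hs hs2 (x := 1 - v) (by linarith) (by linarith)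
  rw [abs_of_nonneg (by linarith : 0 ≤ 1 + v), abs_of_nonneg (by linarith : 0 ≤ 1 - v)]
  nlinarith

/-- The inequality `rpow_half_le_rpow_mean` for `|v| ≤ u`, with coefficients `A` and `B` that allow
exchanging the roles of `u` and `v`. After division by `u ^ s` it follows from Bernoulli's inequality
with exponent `s / 2 ≤ 1`. -/
theorem rpow_half_le_rpow_mean_of_le {s u v : ℝ} (hs : 1 < s) (hs2 : s ≤ 2) (hu : 0 < u)
    (hv : |v| ≤ u) {A B : ℝ} (hA0 : 0 ≤ A) (hB0 : 0 ≤ B)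
    (hAB : ∀ x : ℝ, |x| ≤ 1 → A + B * x ^ 2 - 1 ≤ s * (s - 1) / 4 * x ^ 2) :
    (A * u ^ 2 + B * v ^ 2) ^ (s / 2) ≤ (|u + v| ^ s + |u - v| ^ s) / 2 := by
  set x := v / u with hx
  have hx1 : |x| ≤ 1 := by
    rw [hx, abs_div, abs_of_pos hu, div_le_one hu]
    exact hv
  have hvx : v = u * x := by
    rw [hx]
    field_simp
  have h1 : (A + B * x ^ 2) ^ (s / 2) ≤ 1 + s * (s - 1) / 4 * x ^ 2 := by
    have hb := rpow_one_add_le_one_add_mul_self (s := A + B * x ^ 2 - 1)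
      (p := s / 2) (by nlinarith [sq_nonneg x]) (by linarith) (by linarith)
    rw [show 1 + (A + B * x ^ 2 - 1) = A + B * x ^ 2 by ring] at hb
    have h2 := hAB x hx1
    have h3 : 0 ≤ s * (s - 1) / 4 * x ^ 2 := by
      have : 0 ≤ s * (s - 1) := mul_nonneg (by linarith) (by linarith)
      positivity
    nlinarith
  have hu2 : (u ^ 2) ^ (s / 2) = u ^ s := by
    rw [← Real.rpow_natCast, ← Real.rpow_mul hu.le]
    congr 1
    push_cast
    ring
  have hfac : ∀ y : ℝ, |u * y| ^ s = u ^ s * |y| ^ s := fun y => by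
    rw [abs_mul, abs_of_pos hu, Real.mul_rpow hu.le (abs_nonneg _)]
  rw [hvx, show u + u * x = u * (1 + x) by ring, show u - u * x = u * (1 - x) by ring, hfac, hfac,
    show A * u ^ 2 + B * (u * x) ^ 2 = u ^ 2 * (A + B * x ^ 2) by ring,
    Real.mul_rpow (by positivity) (by positivity), hu2]
  have h4 := one_add_sq_le_rpow_mean hs hs2 hx1
  calc u ^ s * (A + B * x ^ 2) ^ (s / 2) ≤ u ^ s * ((|1 + x| ^ s + |1 - x| ^ s) / 2) := by
        gcongr
        exact h1.trans h4
    _ = _ := by ring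

/-- Two-point strong convexity of `x ↦ |x| ^ s` for `1 < s ≤ 2`: the power mean of `u + v` and
`u - v` is at least a weighted Euclidean norm of `(u, v)`. -/
theorem rpow_half_le_rpow_mean {s : ℝ} (hs : 1 < s) (hs2 : s ≤ 2) (u v : ℝ) :
    (u ^ 2 + s * (s - 1) / 4 * v ^ 2) ^ (s / 2) ≤ (|u + v| ^ s + |u - v| ^ s) / 2 := by
  set c := s * (s - 1) / 4 with hc
  have hc0 : 0 ≤ c := by
    have : 0 ≤ s * (s - 1) := mul_nonneg (by linarith) (by linarith)
    positivity
  have hc1 : c ≤ 1 := by nlinarith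
  -- both sides are even in `u` and in `v`
  wlog hu : 0 ≤ u generalizing u
  · have := this (-u) (by linarith)
    rw [neg_sq, show -u + v = -(u - v) by ring, show -u - v = -(u + v) by ring, abs_neg, abs_neg,
      add_comm (|u - v| ^ s)] at this
    exact this
  wlog hv : 0 ≤ v generalizing v
  · have := this (-v) (by linarith)
    rw [neg_sq, sub_neg_eq_add, ← sub_eq_add_neg, add_comm (|u - v| ^ s)] at this
    exact this
  rcases hu.eq_or_lt with rfl | hu0
  · rcases hv.eq_or_lt with rfl | hv0
    · simp [Real.zero_rpow (by linarith : s ≠ 0), Real.zero_rpow (by linarith : s / 2 ≠ 0)]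
    · have := rpow_half_le_rpow_mean_of_le hs hs2 hv0 (v := 0) (by simpa using hv) hc0 zero_le_one
        (fun x hx => by
          have : x ^ 2 ≤ 1 := (sq_le_one_iff_abs_le_one x).2 hx
          nlinarith)
      simpa [add_comm] using this
  · rcases le_total v u with hvu | huv
    · have := rpow_half_le_rpow_mean_of_le hs hs2 hu0 (v := v) (by rwa [abs_of_nonneg hv])
        zero_le_one hc0 (fun x hx => by simp [hc])
      simpa using this
    · have := rpow_half_le_rpow_mean_of_le hs hs2 (hu0.trans_le huv) (v := u)
        (by rwa [abs_of_nonneg hu]) hc0 zero_le_one (fun x hx => by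
          have : x ^ 2 ≤ 1 := (sq_le_one_iff_abs_le_one x).2 hx
          nlinarith)
      rw [show v - u = -(u - v) by ring, abs_neg, add_comm v u,
        add_comm (c * v ^ 2), one_mul] at this
      exact this

/-- The two-point inequality behind uniform convexity. Both sides are compared with a Euclidean norm
of `((a + b) / 2, (a - b) / 2)`; exponents `r ≥ 2` only decrease the left-hand side. -/
theorem exists_two_point_convex {s r : ℝ} (hs : 1 < s) (hs2 : s ≤ 2) (hr : 2 ≤ r) :
    ∃ c : ℝ, 0 < c ∧ ∀ a b : ℝ, |(a + b) / 2| ^ r + (c * |(a - b) / 2|) ^ r ≤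
      (((|a| ^ s + |b| ^ s) / 2) ^ s⁻¹) ^ r := by
  set c := s * (s - 1) / 4 with hc
  have hc0 : 0 < c := by
    have : 0 < s * (s - 1) := mul_pos (by linarith) (by linarith)
    positivity
  refine ⟨√c, Real.sqrt_pos.2 hc0, fun a b => ?_⟩
  set u := (a + b) / 2 with hu
  set v := (a - b) / 2 with hv
  have h1 := rpow_half_le_rpow_mean hs hs2 u v
  rw [show u + v = a by rw [hu, hv]; ring, show u - v = b by rw [hu, hv]; ring] at h1
  have hsq : ∀ x : ℝ, 0 ≤ x → (x ^ 2) ^ (r / 2) = x ^ r := fun x hx => by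
    rw [← Real.rpow_natCast, ← Real.rpow_mul hx]
    congr 1
    push_cast
    ring
  calc |u| ^ r + (√c * |v|) ^ r = (u ^ 2) ^ (r / 2) + (c * v ^ 2) ^ (r / 2) := by
        rw [← hsq _ (abs_nonneg u), ← hsq _ (by positivity : 0 ≤ √c * |v|), sq_abs, mul_pow,
          Real.sq_sqrt hc0.le, sq_abs]
    _ ≤ (u ^ 2 + c * v ^ 2) ^ (r / 2) :=
        Real.add_rpow_le_rpow_add (by positivity) (by positivity) (by linarith)
    _ = ((u ^ 2 + c * v ^ 2) ^ (s / 2)) ^ (r / s) := by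
        rw [← Real.rpow_mul (by positivity)]
        congr 1
        have : s ≠ 0 := by linarith
        field_simp
    _ ≤ ((|a| ^ s + |b| ^ s) / 2) ^ (r / s) := by
        have : 0 ≤ r / s := div_nonneg (by linarith) (by linarith)
        gcongr
    _ = _ := by
        rw [← Real.rpow_mul (by positivity)]
        congr 1
        ring

theorem exists_pow_le_quadratic (m : ℕ) :
    ∃ D : ℝ, 0 ≤ D ∧ ∀ v : ℝ, |v| ≤ 1 → (1 + v) ^ m ≤ 1 + m * v + D * v ^ 2 := by
  induction m with
  | zero => exact ⟨0, le_rfl, fun v _ => by simp⟩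
  | succ m ih =>
    obtain ⟨D, hD, h⟩ := ih
    refine ⟨m + 2 * D, by positivity, fun v hv => ?_⟩
    obtain ⟨h1, h2⟩ := abs_le.1 hv
    have h3 := mul_le_mul_of_nonneg_right (h v hv) (by linarith : 0 ≤ 1 + v)
    rw [← pow_succ] at h3
    have h4 : D * v ^ 2 * v ≤ D * v ^ 2 := by
      have : 0 ≤ D * v ^ 2 := by positivity
      nlinarith
    push_cast
    nlinarith

/-- The power mean of even order of `u + v` and `u - v` is at most a weighted Euclidean norm of
`(u, v)`. For an even exponent the powers are polynomials, and the odd terms cancel. -/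
theorem exists_pow_mean_le {n : ℕ} (hn : 1 ≤ n) : ∃ C : ℝ, 0 < C ∧ ∀ u v : ℝ,
    ((u + v) ^ (2 * n) + (u - v) ^ (2 * n)) / 2 ≤ (u ^ 2 + C * v ^ 2) ^ n := by
  obtain ⟨D, hD, h⟩ := exists_pow_le_quadratic (2 * n)
  refine ⟨D + 4, by linarith, fun u v => ?_⟩
  rcases le_total |u| |v| with huv | hvu
  · have h4 : ∀ w : ℝ, |w| ≤ 2 * |v| → w ^ (2 * n) ≤ (4 * v ^ 2) ^ n := fun w hw => by
      rw [pow_mul, ← sq_abs w, ← sq_abs v]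
      have : |w| ^ 2 ≤ 4 * |v| ^ 2 := by nlinarith [abs_nonneg w, abs_nonneg v]
      gcongr
    have h5 := h4 (u + v) ((abs_add_le u v).trans (by linarith))
    have h6 := h4 (u - v) ((abs_sub u v).trans (by linarith))
    have h7 : (4 * v ^ 2) ^ n ≤ (u ^ 2 + (D + 4) * v ^ 2) ^ n := by
      have : 4 * v ^ 2 ≤ u ^ 2 + (D + 4) * v ^ 2 := by nlinarith [sq_nonneg u, sq_nonneg v]
      gcongr
    linarith
  · rcases eq_or_ne u 0 with rfl | hu
    · have hv0 : v = 0 := by simpa using hvu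
      subst hv0
      have : 2 * n ≠ 0 := by omega
      simp [zero_pow this, zero_pow (by omega : n ≠ 0)]
    · set x := v / u with hx
      have hx1 : |x| ≤ 1 := by
        rw [hx, abs_div, div_le_one (abs_pos.2 hu)]
        exact hvu
      have hvx : v = u * x := by
        rw [hx]
        field_simp
      have h1 := h x hx1
      have h2 := h (-x) (by rwa [abs_neg])
      have h3 : 1 + (D + 4) * x ^ 2 ≤ (1 + (D + 4) * x ^ 2) ^ n :=
        le_self_pow₀ (by nlinarith [sq_nonneg x]) (by omega)
      have h4 : ((1 + x) ^ (2 * n) + (1 - x) ^ (2 * n)) / 2 ≤ (1 + (D + 4) * x ^ 2) ^ n := by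
        rw [← sub_eq_add_neg] at h2
        nlinarith [sq_nonneg x]
      rw [hvx, show u + u * x = u * (1 + x) by ring, show u - u * x = u * (1 - x) by ring,
        show u ^ 2 + (D + 4) * (u * x) ^ 2 = u ^ 2 * (1 + (D + 4) * x ^ 2) by ring, mul_pow,
        mul_pow u, mul_pow (u ^ 2), ← pow_mul]
      have h5 : 0 ≤ u ^ (2 * n) := by
        rw [pow_mul]
        positivity
      nlinarith

/-- The two-point inequality behind uniform smoothness. Both sides are compared with a Euclidean norm
of `(u, v)`; exponents `s ≤ 2` only increase the right-hand side. -/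
theorem exists_two_point_smooth {s : ℝ} (hs : 0 < s) (hs2 : s ≤ 2) {n : ℕ} (hn : 1 ≤ n) :
    ∃ C : ℝ, 0 < C ∧ ∀ u v : ℝ,
      (((|u + v| ^ ((2 * n : ℕ) : ℝ) + |u - v| ^ ((2 * n : ℕ) : ℝ)) / 2) ^
        (((2 * n : ℕ) : ℝ))⁻¹) ^ s ≤ |u| ^ s + (C * |v|) ^ s := by
  obtain ⟨C, hC, h⟩ := exists_pow_mean_le hn
  refine ⟨√C, Real.sqrt_pos.2 hC, fun u v => ?_⟩
  have hsq : ∀ x : ℝ, 0 ≤ x → (x ^ 2) ^ (s / 2) = x ^ s := fun x hx => by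
    rw [← Real.rpow_natCast, ← Real.rpow_mul hx]
    congr 1
    push_cast
    ring
  have heven : ∀ x : ℝ, |x| ^ ((2 * n : ℕ) : ℝ) = x ^ (2 * n) := fun x => by
    rw [Real.rpow_natCast, pow_mul, sq_abs, ← pow_mul]
  have hn0 : (n : ℝ) ≠ 0 := by positivity
  rw [heven, heven, ← hsq _ (abs_nonneg u), ← hsq _ (by positivity : 0 ≤ √C * |v|), sq_abs,
    mul_pow, Real.sq_sqrt hC.le, sq_abs]
  have h0 : 0 ≤ ((u + v) ^ (2 * n) + (u - v) ^ (2 * n)) / 2 := by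
    rw [pow_mul, pow_mul]
    positivity
  calc ((((u + v) ^ (2 * n) + (u - v) ^ (2 * n)) / 2) ^ (((2 * n : ℕ) : ℝ))⁻¹) ^ s
      ≤ (((u ^ 2 + C * v ^ 2) ^ n) ^ (((2 * n : ℕ) : ℝ))⁻¹) ^ s := by
        gcongr
        exact h u v
    _ = (u ^ 2 + C * v ^ 2) ^ (s / 2) := by
        rw [← Real.rpow_natCast, ← Real.rpow_mul (by positivity), ← Real.rpow_mul (by positivity)]
        congr 1
        push_cast
        field_simp
    _ ≤ _ := Real.rpow_add_le_add_rpow (by positivity) (by positivity) (by positivity)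
        (by linarith)

end

/-! ### Uniform convexity and uniform smoothness -/

section

variable {p : ℝ → ℝ} {f g h : LZero} {a b : ℝ} {φ ψ : ℝ → ℝ}

/-- The pointwise power mean `((|f| ^ s + |g| ^ s) / 2) ^ (1 / s)`. -/
def powMean (s : ℝ) (f g : LZero) : LZero :=
  AEEqFun.mk (fun t => ((|f t| ^ s + |g t| ^ s) / 2) ^ s⁻¹)
    (((((f.aestronglyMeasurable.aemeasurable.abs.pow_const s).add
      (g.aestronglyMeasurable.aemeasurable.abs.pow_const s)).div_const 2).pow_const
      s⁻¹).aestronglyMeasurable)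

theorem coeFn_powMean (s : ℝ) (f g : LZero) : ∀ᵐ t ∂unitMeasure,
    |powMean s f g t| = ((|f t| ^ s + |g t| ^ s) / 2) ^ s⁻¹ := by
  filter_upwards [AEEqFun.coeFn_mk (μ := unitMeasure)
    (fun t => ((|f t| ^ s + |g t| ^ s) / 2) ^ s⁻¹) _] with t ht
  rw [powMean, ht, abs_of_nonneg (by positivity)]

theorem coeFn_powMean_rpow {s : ℝ} (hs : 0 < s) (f g : LZero) : ∀ᵐ t ∂unitMeasure,
    |powMean s f g t| ^ s = (|f t| ^ s + |g t| ^ s) / 2 := by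
  filter_upwards [coeFn_powMean s f g] with t ht
  rw [ht, Real.rpow_inv_rpow (by positivity) hs.ne']

theorem powMean_mem_finiteElements (hpm : AEMeasurable p unitMeasure)
    (hp : ∀ t ∈ Icc (0 : ℝ) 1, 1 < p t) {s : ℝ} (hs : 0 < s) (hf : f ∈ finiteElements p)
    (hg : g ∈ finiteElements p) : powMean s f g ∈ finiteElements p := by
  have habs : ∀ {u : LZero}, u ∈ finiteElements p → |u| ∈ finiteElements p := fun {u} hu => by
    refine mem_finiteElements_of_abs_le hp hu ?_
    filter_upwards [AEEqFun.coeFn_abs u] with t ht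
    rw [ht, abs_abs]
  refine mem_finiteElements_of_abs_le hp (add_mem_finiteElements hpm hp (habs hf) (habs hg)) ?_
  filter_upwards [coeFn_powMean s f g, AEEqFun.coeFn_add |f| |g|, AEEqFun.coeFn_abs f,
    AEEqFun.coeFn_abs g] with t h1 h2 h3 h4
  rw [h1, h2, Pi.add_apply, h3, h4, abs_of_nonneg (by positivity : 0 ≤ |f t| + |g t|)]
  have h5 : |f t| ^ s ≤ (|f t| + |g t|) ^ s := by
    gcongr
    linarith [abs_nonneg (g t)]
  have h6 : |g t| ^ s ≤ (|f t| + |g t|) ^ s := by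
    gcongr
    linarith [abs_nonneg (f t)]
  calc ((|f t| ^ s + |g t| ^ s) / 2) ^ s⁻¹ ≤ ((|f t| + |g t|) ^ s) ^ s⁻¹ := by
        gcongr
        linarith
    _ = _ := Real.rpow_rpow_inv (by positivity) hs.ne'

theorem coeFn_half_smul_rpow {s : ℝ} (hs : 0 < s) (f : LZero) : ∀ᵐ t ∂unitMeasure,
    |(((2 : ℝ)⁻¹ ^ s⁻¹) • f : LZero) t| ^ s = |f t| ^ s / 2 := by
  filter_upwards [coeFn_smul_abs ((2 : ℝ)⁻¹ ^ s⁻¹) f] with t ht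
  rw [ht, abs_of_pos (by positivity), Real.mul_rpow (by positivity) (abs_nonneg _),
    Real.rpow_inv_rpow (by norm_num) hs.ne']
  ring

theorem lpNorm_half_smul_rpow (hp : ∀ t ∈ Icc (0 : ℝ) 1, 1 < p t) {s : ℝ} (hs : 0 < s)
    (hf : f ∈ lpClass p) : lpNorm p (((2 : ℝ)⁻¹ ^ s⁻¹) • f) ^ s = lpNorm p f ^ s / 2 := by
  rw [lpNorm_smul hp _ hf, abs_of_pos (by positivity),
    Real.mul_rpow (by positivity) (lpNorm_nonneg _ _), Real.rpow_inv_rpow (by norm_num) hs.ne']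
  ring

theorem lpNorm_powMean_le (hp : ∀ t ∈ Icc (0 : ℝ) 1, 1 < p t) {s : ℝ} (hs : 1 ≤ s)
    (hps : ∀ᵐ t ∂unitMeasure, s ≤ p t) (hf : f ∈ lpClass p) (hg : g ∈ lpClass p)
    (hk : powMean s f g ∈ lpClass p) :
    lpNorm p (powMean s f g) ^ s ≤ (lpNorm p f ^ s + lpNorm p g ^ s) / 2 := by
  have hs0 : 0 < s := by linarith
  have h := lpNorm_rpow_le_add hp hs (smul_mem_lpClass hp ((2 : ℝ)⁻¹ ^ s⁻¹) hf)
    (smul_mem_lpClass hp ((2 : ℝ)⁻¹ ^ s⁻¹) hg) hk (hps.mono fun t ht _ => ht) (by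
      filter_upwards [coeFn_half_smul_rpow hs0 f, coeFn_half_smul_rpow hs0 g,
        coeFn_powMean_rpow hs0 f g] with t h1 h2 h3
      rw [h1, h2, h3, add_div])
  rwa [lpNorm_half_smul_rpow hp hs0 hf, lpNorm_half_smul_rpow hp hs0 hg, ← add_div] at h

theorem le_lpNorm_powMean (hp : ∀ t ∈ Icc (0 : ℝ) 1, 1 < p t) {r : ℝ} (hr : 1 ≤ r)
    (hpr : ∀ᵐ t ∂unitMeasure, p t ≤ r) (hf : f ∈ lpClass p) (hg : g ∈ lpClass p)
    (hk : powMean r f g ∈ lpClass p) :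
    (lpNorm p f ^ r + lpNorm p g ^ r) / 2 ≤ lpNorm p (powMean r f g) ^ r := by
  have hr0 : 0 < r := by linarith
  have h := add_le_lpNorm_rpow hp hr (smul_mem_lpClass hp ((2 : ℝ)⁻¹ ^ r⁻¹) hf)
    (smul_mem_lpClass hp ((2 : ℝ)⁻¹ ^ r⁻¹) hg) hk (hpr.mono fun t ht _ => ht) (by
      filter_upwards [coeFn_half_smul_rpow hr0 f, coeFn_half_smul_rpow hr0 g,
        coeFn_powMean_rpow hr0 f g] with t h1 h2 h3
      rw [h1, h2, h3, add_div])
  rwa [lpNorm_half_smul_rpow hp hr0 hf, lpNorm_half_smul_rpow hp hr0 hg, ← add_div] at h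

/-- A quantitative form of uniform convexity: the power mean of exponent `s` dominates the midpoint
with a gain of the order of `|f - g|`, and the convexity and concavity of the norm transfer this
pointwise inequality to norms. -/
theorem exists_lpNorm_midpoint_le (hpm : AEMeasurable p unitMeasure)
    (hp : ∀ t ∈ Icc (0 : ℝ) 1, 1 < p t) {s r : ℝ} (hs : 1 < s) (hs2 : s ≤ 2) (hr : 2 ≤ r)
    (hps : ∀ᵐ t ∂unitMeasure, s ≤ p t) (hpr : ∀ᵐ t ∂unitMeasure, p t ≤ r) :
    ∃ c : ℝ, 0 < c ∧ ∀ f ∈ lpClass p, ∀ g ∈ lpClass p, lpNorm p f = 1 → lpNorm p g = 1 →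
      (lpNorm p (f + g) / 2) ^ r + (c * (lpNorm p (f - g) / 2)) ^ r ≤ 1 := by
  obtain ⟨c, hc, hcc⟩ := exists_two_point_convex hs hs2 hr
  refine ⟨c, hc, fun f hf g hg hf1 hg1 => ?_⟩
  have hfin : ∀ {u : LZero}, u ∈ lpClass p → u ∈ finiteElements p := fun {u} hu =>
    mem_finiteElements_of_mem_lpClass hp (hpr.mono fun t ht _ => ht) hu
  have hk : powMean s f g ∈ lpClass p := mem_lpClass_of_mem_finiteElements hpm hp
    (powMean_mem_finiteElements hpm hp (by linarith) (hfin hf) (hfin hg))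
  have hadd : f + g ∈ lpClass p := mem_lpClass_of_mem_finiteElements hpm hp
    (add_mem_finiteElements hpm hp (hfin hf) (hfin hg))
  have hsub : f - g ∈ lpClass p := mem_lpClass_of_mem_finiteElements hpm hp
    (sub_mem_finiteElements hpm hp (hfin hf) (hfin hg))
  have hk1 : lpNorm p (powMean s f g) ≤ 1 := by
    have h := lpNorm_powMean_le hp hs.le hps hf hg hk
    rw [hf1, hg1, Real.one_rpow] at h
    norm_num at h
    by_contra! hc
    exact absurd h (not_le.2 (Real.one_lt_rpow hc (by linarith)))
  have h := add_le_lpNorm_rpow hp (by linarith : 1 ≤ r)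
    (smul_mem_lpClass hp (1 / 2) hadd) (smul_mem_lpClass hp (c / 2) hsub) hk
    (hpr.mono fun t ht _ => ht) (by
      filter_upwards [coeFn_smul_abs (1 / 2) (f + g), coeFn_smul_abs (c / 2) (f - g),
        coeFn_powMean s f g, AEEqFun.coeFn_add f g, AEEqFun.coeFn_sub f g] with t h1 h2 h3 h4 h5
      have h6 := hcc (f t) (g t)
      rw [abs_div, abs_div, abs_two] at h6
      rw [h1, h2, h3, h4, h5, Pi.add_apply, Pi.sub_apply, abs_of_pos (by norm_num : (0:ℝ) < 1 / 2),
        abs_of_pos (by positivity : 0 < c / 2)]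
      convert h6 using 3 <;> ring)
  rw [lpNorm_smul hp _ hadd, lpNorm_smul hp _ hsub, abs_of_pos (by norm_num : (0:ℝ) < 1 / 2),
    abs_of_pos (by positivity : 0 < c / 2)] at h
  calc (lpNorm p (f + g) / 2) ^ r + (c * (lpNorm p (f - g) / 2)) ^ r
      = (1 / 2 * lpNorm p (f + g)) ^ r + (c / 2 * lpNorm p (f - g)) ^ r := by
        congr 2 <;> ring
    _ ≤ lpNorm p (powMean s f g) ^ r := h
    _ ≤ 1 := Real.rpow_le_one (lpNorm_nonneg _ _) hk1 (by linarith)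

theorem uniformConvexSpace (hpm : AEMeasurable p unitMeasure)
    (hp : ∀ t ∈ Icc (0 : ℝ) 1, 1 < p t) {s r : ℝ} (hs : 1 < s) (hs2 : s ≤ 2) (hr : 2 ≤ r)
    (hps : ∀ᵐ t ∂unitMeasure, s ≤ p t) (hpr : ∀ᵐ t ∂unitMeasure, p t ≤ r)
    (H : IsNormedFunctionSpace (lpClass p) (lpNorm p)) : UniformConvexSpace H.Space := by
  obtain ⟨c, hc, hcc⟩ := exists_lpNorm_midpoint_le hpm hp hs hs2 hr hps hpr
  refine ⟨fun ε hε => ⟨2 * ((c * (ε / 2)) ^ r / r), by positivity, fun x hx y hy hxy => ?_⟩⟩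
  have h1 := hcc x.1 x.2 y.1 y.2 hx hy
  change (‖x + y‖ / 2) ^ r + (c * (‖x - y‖ / 2)) ^ r ≤ 1 at h1
  have h2 : (c * (ε / 2)) ^ r ≤ (c * (‖x - y‖ / 2)) ^ r := by gcongr
  have h3 := one_add_mul_self_le_rpow_one_add (s := ‖x + y‖ / 2 - 1)
    (by linarith [norm_nonneg (x + y)]) (by linarith : 1 ≤ r)
  rw [show 1 + (‖x + y‖ / 2 - 1) = ‖x + y‖ / 2 by ring] at h3
  have h4 : r * (‖x + y‖ / 2 - 1) ≤ -(c * (ε / 2)) ^ r := by linarith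
  have h5 : ‖x + y‖ / 2 - 1 ≤ -((c * (ε / 2)) ^ r / r) := by
    rw [← neg_div, le_div_iff₀ (by linarith), mul_comm]
    exact h4
  linarith

/-- A quantitative form of uniform smoothness, obtained from the power mean of exponent `2 * n` of
`f + g` and `f - g`. -/
theorem exists_lpNorm_add_sub_le (hpm : AEMeasurable p unitMeasure)
    (hp : ∀ t ∈ Icc (0 : ℝ) 1, 1 < p t) {s : ℝ} (hs : 1 < s) (hs2 : s ≤ 2) {n : ℕ} (hn : 1 ≤ n)
    (hps : ∀ᵐ t ∂unitMeasure, s ≤ p t) (hpr : ∀ᵐ t ∂unitMeasure, p t ≤ ((2 * n : ℕ) : ℝ)) :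
    ∃ C : ℝ, 0 < C ∧ ∀ f ∈ lpClass p, ∀ g ∈ lpClass p,
      ((lpNorm p (f + g) + lpNorm p (f - g)) / 2) ^ s ≤
        lpNorm p f ^ s + (C * lpNorm p g) ^ s := by
  obtain ⟨C, hC, hCC⟩ := exists_two_point_smooth (by linarith : 0 < s) hs2 hn
  refine ⟨C, hC, fun f hf g hg => ?_⟩
  set r : ℝ := ((2 * n : ℕ) : ℝ) with hr
  have hr1 : 1 ≤ r := by
    rw [hr]
    exact_mod_cast (by omega : 1 ≤ 2 * n)
  have hfin : ∀ {u : LZero}, u ∈ lpClass p → u ∈ finiteElements p := fun {u} hu =>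
    mem_finiteElements_of_mem_lpClass hp (hpr.mono fun t ht _ => ht) hu
  have hadd' := add_mem_finiteElements hpm hp (hfin hf) (hfin hg)
  have hsub' := sub_mem_finiteElements hpm hp (hfin hf) (hfin hg)
  have hadd : f + g ∈ lpClass p := mem_lpClass_of_mem_finiteElements hpm hp hadd'
  have hsub : f - g ∈ lpClass p := mem_lpClass_of_mem_finiteElements hpm hp hsub'
  have hk : powMean r (f + g) (f - g) ∈ lpClass p := mem_lpClass_of_mem_finiteElements hpm hp
    (powMean_mem_finiteElements hpm hp (by linarith) hadd' hsub')
  have h1 := le_lpNorm_powMean hp hr1 hpr hadd hsub hk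
  have h2 := lpNorm_rpow_le_add hp hs.le hf (smul_mem_lpClass hp C hg) hk
    (hps.mono fun t ht _ => ht) (by
      filter_upwards [coeFn_smul_abs C g, coeFn_powMean r (f + g) (f - g),
        AEEqFun.coeFn_add f g, AEEqFun.coeFn_sub f g] with t h1 h2 h3 h4
      rw [h1, h2, h3, h4, Pi.add_apply, Pi.sub_apply, abs_of_pos hC]
      exact hCC (f t) (g t))
  rw [lpNorm_smul hp _ hg, abs_of_pos hC] at h2
  refine le_trans ?_ h2
  have h3 : (lpNorm p (f + g) + lpNorm p (f - g)) / 2 ≤ lpNorm p (powMean r (f + g) (f - g)) := by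
    rw [← Real.rpow_le_rpow_iff (z := r) _ (lpNorm_nonneg _ _) (by linarith)]
    · refine le_trans ?_ h1
      have := (convexOn_rpow hr1).2 (mem_Ici.2 (lpNorm_nonneg p (f + g)))
        (mem_Ici.2 (lpNorm_nonneg p (f - g))) (by norm_num : (0 : ℝ) ≤ 1 / 2)
        (by norm_num : (0 : ℝ) ≤ 1 / 2) (by norm_num)
      simp only [smul_eq_mul] at this
      convert this using 1
      · congr 1
        ring
      · ring
    · have h4 := lpNorm_nonneg p (f + g)
      have h5 := lpNorm_nonneg p (f - g)
      positivity
  have h4 := lpNorm_nonneg p (f + g)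
  have h5 := lpNorm_nonneg p (f - g)
  gcongr

theorem isUniformlySmooth (hpm : AEMeasurable p unitMeasure)
    (hp : ∀ t ∈ Icc (0 : ℝ) 1, 1 < p t) {s : ℝ} (hs : 1 < s) (hs2 : s ≤ 2) {n : ℕ} (hn : 1 ≤ n)
    (hps : ∀ᵐ t ∂unitMeasure, s ≤ p t) (hpr : ∀ᵐ t ∂unitMeasure, p t ≤ ((2 * n : ℕ) : ℝ))
    (H : IsNormedFunctionSpace (lpClass p) (lpNorm p)) : IsUniformlySmooth H.Space := by
  obtain ⟨C, hC, hCC⟩ := exists_lpNorm_add_sub_le hpm hp hs hs2 hn hps hpr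
  intro ε hε
  -- `δ` is chosen such that `C ^ s * δ ^ (s - 1) = ε / 2`
  set δ : ℝ := (ε / (2 * C ^ s)) ^ (s - 1)⁻¹ with hδ
  refine ⟨δ, by positivity, fun x y hx hy => ?_⟩
  have h1 := hCC x.1 x.2 y.1 y.2
  change ((‖x + y‖ + ‖x - y‖) / 2) ^ s ≤ ‖x‖ ^ s + (C * ‖y‖) ^ s at h1
  rw [hx, Real.one_rpow, Real.mul_rpow hC.le (norm_nonneg _)] at h1
  set M := (‖x + y‖ + ‖x - y‖) / 2 with hM
  have hM0 : 0 ≤ M := by positivity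
  have h2 : ‖y‖ ^ s ≤ δ ^ (s - 1) * ‖y‖ := by
    rcases (norm_nonneg y).eq_or_lt with h0 | h0
    · rw [← h0, Real.zero_rpow (by linarith), mul_zero]
    · calc ‖y‖ ^ s = ‖y‖ ^ (s - 1) * ‖y‖ := by
            rw [Real.rpow_sub_one h0.ne', div_mul_cancel₀ _ h0.ne']
        _ ≤ _ := by
            have : 0 ≤ s - 1 := by linarith
            gcongr
  have h3 : δ ^ (s - 1) = ε / (2 * C ^ s) := by
    rw [hδ, Real.rpow_inv_rpow (by positivity) (by linarith)]
  have h4 : C ^ s * ‖y‖ ^ s ≤ ε / 2 * ‖y‖ := by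
    have hCs : 0 < C ^ s := by positivity
    calc C ^ s * ‖y‖ ^ s ≤ C ^ s * (δ ^ (s - 1) * ‖y‖) := by gcongr
      _ = ε / 2 * ‖y‖ := by
        rw [h3]
        field_simp
  have h5 := one_add_mul_self_le_rpow_one_add (s := M - 1) (by linarith) hs.le
  rw [show 1 + (M - 1) = M by ring] at h5
  have h6 : M - 1 ≤ ε / 2 * ‖y‖ := by
    have h7 : 0 ≤ ε / 2 * ‖y‖ := by positivity
    rcases le_total M 1 with hM1 | hM1
    · linarith
    · nlinarith
  rw [hM] at h6
  linarith

end

/-! ### Reflexivity -/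

section Reflexive

variable {E X : Type*} [NormedAddCommGroup E] [NormedSpace ℝ E] [NormedAddCommGroup X]
  [NormedSpace ℝ X]

/-- Goldstine's theorem, in the form of simultaneous approximation on finitely many functionals. -/
theorem exists_norm_le_forall_abs_sub_lt (ξ : StrongDual ℝ (StrongDual ℝ E))
    (S : Finset (StrongDual ℝ E)) {ε : ℝ} (hε : 0 < ε) :
    ∃ x : E, ‖x‖ ≤ ‖ξ‖ ∧ ∀ f ∈ S, |f x - ξ f| < ε := by
  classical
  set A : E →L[ℝ] (S → ℝ) := ContinuousLinearMap.pi fun f => f.1 with hA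
  set b : S → ℝ := fun f => ξ f.1 with hb
  have hmem : b ∈ closure (A '' Metric.closedBall 0 ‖ξ‖) := by
    by_contra hbn
    have hconv : Convex ℝ (closure (A '' Metric.closedBall 0 ‖ξ‖)) :=
      ((convex_closedBall 0 ‖ξ‖).linear_image A.toLinearMap).closure
    obtain ⟨g, u, hgu, hub⟩ := geometric_hahn_banach_closed_point hconv isClosed_closure hbn
    set F : StrongDual ℝ E := g.comp A with hF
    have hFu : ∀ x : E, ‖x‖ ≤ ‖ξ‖ → F x < u := fun x hx =>
      hgu _ (subset_closure ⟨x, by simpa using hx, rfl⟩)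
    have hg : ∀ y : S → ℝ, g y = ∑ i, y i * g (Pi.single i 1) := fun y => by
      conv_lhs => rw [← Finset.univ_sum_single y]
      rw [map_sum]
      refine Finset.sum_congr rfl fun i _ => ?_
      rw [← smul_eq_mul, ← map_smul, ← Pi.single_smul, smul_eq_mul, mul_one]
    have hFsum : F = ∑ i : S, g (Pi.single i 1) • i.1 := by
      ext x
      simp only [hF, ContinuousLinearMap.comp_apply, _root_.sum_apply,
        _root_.smul_apply, smul_eq_mul]
      rw [hg]
      exact Finset.sum_congr rfl fun i _ => mul_comm _ _
    have hξF : ξ F = g b := by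
      rw [hFsum, map_sum, hg]
      refine Finset.sum_congr rfl fun i _ => ?_
      rw [map_smul, smul_eq_mul, mul_comm]
    have hu0 : 0 < u := by simpa using hFu 0 (by rw [norm_zero]; exact norm_nonneg ξ)
    have hle : ξ F ≤ ‖ξ‖ * ‖F‖ := (le_abs_self _).trans (ξ.le_opNorm F)
    rcases (norm_nonneg ξ).eq_or_lt with h0 | h0
    · rw [← h0, zero_mul] at hle
      linarith
    · have hFn : ‖F‖ ≤ u / ‖ξ‖ := by
        refine F.opNorm_le_bound (by positivity) fun x => ?_
        rcases eq_or_ne x 0 with rfl | hx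
        · simp
        have hxn : 0 < ‖x‖ := norm_pos_iff.2 hx
        have hsc : ∀ σ : ℝ, |σ| = 1 → σ * F x ≤ u / ‖ξ‖ * ‖x‖ := fun σ hσ => by
          have h1 := hFu ((σ * (‖ξ‖ / ‖x‖)) • x) (by
            rw [norm_smul, Real.norm_eq_abs, abs_mul, hσ, abs_of_pos (by positivity)]
            field_simp
            exact le_rfl)
          rw [map_smul, smul_eq_mul] at h1
          rw [div_mul_eq_mul_div, le_div_iff₀ h0]
          calc σ * F x * ‖ξ‖ = σ * (‖ξ‖ / ‖x‖) * F x * ‖x‖ := by field_simp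
            _ ≤ u * ‖x‖ := by gcongr
        have h1 := hsc 1 (by simp)
        have h2 := hsc (-1) (by simp)
        rw [Real.norm_eq_abs, abs_le]
        constructor <;> linarith
      have : ‖ξ‖ * ‖F‖ ≤ u :=
        calc ‖ξ‖ * ‖F‖ ≤ ‖ξ‖ * (u / ‖ξ‖) := by gcongr
          _ = u := by field_simp
      linarith
  obtain ⟨_, ⟨x, hx, rfl⟩, hxb⟩ := Metric.mem_closure_iff.1 hmem ε hε
  refine ⟨x, by simpa using hx, fun f hf => ?_⟩
  have := (dist_pi_lt_iff hε).1 hxb ⟨f, hf⟩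
  rw [dist_comm, Real.dist_eq] at this
  exact this

theorem norm_ne_zero_and_norm_normalize (ξ : StrongDual ℝ E) (hξ : ξ ≠ 0) :
    ‖ξ‖ ≠ 0 ∧ ‖‖ξ‖⁻¹ • ξ‖ = 1 :=
  ⟨norm_ne_zero_iff.2 hξ, norm_smul_inv_norm hξ⟩

/-- The Milman–Pettis theorem. Points of the unit ball that approximate a norm one element of the
bidual on larger and larger finite sets of functionals form a Cauchy net by uniform convexity. -/
theorem isReflexiveSpace_of_uniformConvexSpace [CompleteSpace E] [UniformConvexSpace E] :
    IsReflexiveSpace E := by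
  classical
  have key : ∀ ξ : StrongDual ℝ (StrongDual ℝ E), ‖ξ‖ = 1 →
      ∃ x, NormedSpace.inclusionInDoubleDual ℝ E x = ξ := by
    intro ξ hξ
    have hex := fun q : Finset (StrongDual ℝ E) × ℕ =>
      exists_norm_le_forall_abs_sub_lt ξ q.1 (ε := 1 / ((q.2 : ℝ) + 1)) (by positivity)
    choose x hx1 hx2 using hex
    rw [hξ] at hx1
    have happ : ∀ f : StrongDual ℝ E, Tendsto (fun q => f (x q)) atTop (𝓝 (ξ f)) := by
      intro f
      rw [tendsto_iff_dist_tendsto_zero]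
      have h1 : Tendsto (fun q : Finset (StrongDual ℝ E) × ℕ => 1 / ((q.2 : ℝ) + 1)) atTop
          (𝓝 0) := by
        rw [← prod_atTop_atTop_eq]
        exact tendsto_one_div_add_atTop_nhds_zero_nat.comp tendsto_snd
      refine squeeze_zero' (Eventually.of_forall fun _ => dist_nonneg) ?_ h1
      filter_upwards [eventually_ge_atTop (({f} : Finset (StrongDual ℝ E)), 0)] with q hq
      exact (hx2 q f (hq.1 (Finset.mem_singleton_self f))).le
    have hcauchy : Cauchy (map x atTop) := by
      rw [Metric.cauchy_iff]
      refine ⟨inferInstance, fun ε hε => ?_⟩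
      obtain ⟨δ, hδ, hδx⟩ := exists_forall_closed_ball_dist_add_le_two_sub E hε
      obtain ⟨f, hf1, hf⟩ : ∃ f : StrongDual ℝ E, ‖f‖ ≤ 1 ∧ 1 - δ / 2 < ξ f := by
        by_contra! hc
        have h1 : ‖ξ‖ ≤ max (1 - δ / 2) 0 := by
          refine ContinuousLinearMap.opNorm_le_of_unit_norm (le_max_right _ _) fun f hf => ?_
          rw [Real.norm_eq_abs, abs_le]
          have h2 := hc f hf.le
          have h3 := hc (-f) (by rw [norm_neg, hf])
          rw [map_neg] at h3
          have h4 := le_max_left (1 - δ / 2) 0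
          constructor <;> linarith
        rw [hξ] at h1
        rcases le_max_iff.1 h1 with h2 | h2 <;> linarith
      refine ⟨x '' {q | 1 - δ / 2 < f (x q)},
        image_mem_map ((happ f).eventually (lt_mem_nhds hf)), ?_⟩
      rintro _ ⟨q, hq, rfl⟩ _ ⟨q', hq', rfl⟩
      by_contra! hc
      rw [dist_eq_norm] at hc
      have h1 := hδx (hx1 q) (hx1 q') hc
      have h2 : f (x q + x q') ≤ ‖x q + x q'‖ := by
        calc f (x q + x q') ≤ ‖f‖ * ‖x q + x q'‖ := (le_abs_self _).trans (f.le_opNorm _)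
          _ ≤ 1 * ‖x q + x q'‖ := by gcongr
          _ = _ := one_mul _
      rw [map_add] at h2
      have hq1 : 1 - δ / 2 < f (x q) := hq
      have hq2 : 1 - δ / 2 < f (x q') := hq'
      linarith
    obtain ⟨z, hz⟩ := CompleteSpace.complete hcauchy
    refine ⟨z, ?_⟩
    ext f
    rw [NormedSpace.dual_def]
    exact tendsto_nhds_unique ((f.continuous.tendsto z).comp hz) (happ f)
  intro ξ
  by_cases hξ : ξ = 0
  · exact ⟨0, by rw [map_zero, hξ]⟩
  · obtain ⟨hn, hu⟩ := norm_ne_zero_and_norm_normalize (E := StrongDual ℝ E) ξ hξ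
    obtain ⟨x, hx⟩ := key (‖ξ‖⁻¹ • ξ) hu
    refine ⟨‖ξ‖ • x, ?_⟩
    rw [map_smul, hx, smul_smul, mul_inv_cancel₀ hn, one_smul]

/-- In a reflexive space a bounded sequence has a weak cluster point, and by Mazur's theorem this
point lies in the closed convex hull of every tail. -/
theorem IsReflexiveSpace.exists_forall_mem_closure_convexHull (hE : IsReflexiveSpace E)
    {y : ℕ → E} {B : ℝ} (hB : ∀ n, ‖y n‖ ≤ B) :
    ∃ z, ∀ n, z ∈ closure (convexHull ℝ (y '' Ici n)) := by
  have hbd : ∀ (f : StrongDual ℝ E) (n : ℕ), |f (y n)| ≤ B * ‖f‖ := fun f n => by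
    rw [mul_comm]
    exact (f.le_opNorm _).trans (by gcongr; exact hB n)
  have hex : ∀ f : StrongDual ℝ E, ∃ l, Tendsto (fun n => f (y n)) (hyperfilter ℕ) (𝓝 l) := by
    intro f
    obtain ⟨l, -, hl⟩ := isCompact_Icc.ultrafilter_le_nhds
      ((hyperfilter ℕ).map fun n => f (y n)) (s := Icc (-(B * ‖f‖)) (B * ‖f‖))
      (le_principal_iff.2 (Eventually.of_forall (f := ((hyperfilter ℕ : Ultrafilter ℕ) : Filter ℕ))
        fun n => abs_le.1 (hbd f n)))
    exact ⟨l, hl⟩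
  choose L hL using hex
  set Lin : StrongDual ℝ E →ₗ[ℝ] ℝ :=
    { toFun := L
      map_add' := fun f g => tendsto_nhds_unique (hL (f + g)) ((hL f).add (hL g))
      map_smul' := fun c f => tendsto_nhds_unique (hL (c • f)) ((hL f).const_mul c) } with hLin
  set ξ : StrongDual ℝ (StrongDual ℝ E) := Lin.mkContinuous B fun f =>
    le_of_tendsto (hL f).norm (Eventually.of_forall fun n => hbd f n) with hξ
  obtain ⟨z, hz⟩ := hE ξ
  refine ⟨z, fun n => ?_⟩
  by_contra hzn
  obtain ⟨f, u, hfu, hu⟩ := geometric_hahn_banach_closed_point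
    (convex_convexHull ℝ (y '' Ici n)).closure isClosed_closure hzn
  have h1 : f z = L f := by
    rw [← NormedSpace.dual_def ℝ E z f, hz]
    rfl
  have h2 : L f ≤ u := by
    refine le_of_tendsto (hL f) ?_
    have h3 : ∀ᶠ k in (hyperfilter ℕ : Filter ℕ), n ≤ k :=
      Nat.hyperfilter_le_atTop (eventually_ge_atTop n)
    filter_upwards [h3] with k hk
    exact (hfu _ (subset_closure (subset_convexHull ℝ _ ⟨k, hk, rfl⟩))).le
  linarith

/-- A reflexive space contains no isomorphic image of a space with a bounded sequence whose tails
have convex hulls that stay away from each given point. -/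
theorem IsReflexiveSpace.false_of_separated (hE : IsReflexiveSpace E) (T : X →ₗ[ℝ] E)
    (hT : ∀ x, ‖x‖ ≤ ‖T x‖) {e : ℕ → X} {B : ℝ} (hB : ∀ n, ‖T (e n)‖ ≤ B) {c : ℝ} (hc : 0 < c)
    (h : ∀ x, ∃ m, ∀ x' ∈ convexHull ℝ (e '' Ici m), c ≤ ‖x - x'‖) : False := by
  obtain ⟨z, hz⟩ := hE.exists_forall_mem_closure_convexHull hB
  have happrox : ∀ m, ∃ x ∈ convexHull ℝ (e '' Ici m), ‖z - T x‖ < c / 2 := by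
    intro m
    have h1 := hz m
    have h2 : (fun n => T (e n)) '' Ici m = T '' (e '' Ici m) := by rw [image_image]
    rw [h2, ← LinearMap.image_convexHull] at h1
    obtain ⟨_, ⟨x, hx, rfl⟩, hd⟩ := Metric.mem_closure_iff.1 h1 (c / 2) (by positivity)
    exact ⟨x, hx, by rwa [dist_eq_norm] at hd⟩
  obtain ⟨x, -, hx⟩ := happrox 0
  obtain ⟨m, hm⟩ := h x
  obtain ⟨x', hx'm, hx'⟩ := happrox m
  have h1 := hm x' hx'm
  have h2 := hT (x - x')
  have h3 : ‖T (x - x')‖ ≤ ‖z - T x'‖ + ‖z - T x‖ := by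
    rw [map_sub]
    calc ‖T x - T x'‖ = ‖(z - T x') - (z - T x)‖ := by congr 1; abel
      _ ≤ _ := norm_sub_le _ _
  linarith

theorem summable_lp_one (x : lp (fun _ : ℕ => ℝ) 1) : Summable fun k => |x k| := by
  have := (lp.memℓp x).summable (by simp)
  simpa using this

theorem lp_one_norm_eq (x : lp (fun _ : ℕ => ℝ) 1) : ‖x‖ = ∑' k, |x k| := by
  have := lp.norm_eq_tsum_rpow (p := 1) (by simp) x
  simpa using this

/-- The sum of the coordinates with index at least `m`, as a linear functional on `ℓ¹`. -/
def lpTailSum (m : ℕ) : lp (fun _ : ℕ => ℝ) 1 →ₗ[ℝ] ℝ where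
  toFun x := ∑' k, x (k + m)
  map_add' x y := by
    have hx := ((summable_nat_add_iff m).2 (summable_lp_one x)).of_abs
    have hy := ((summable_nat_add_iff m).2 (summable_lp_one y)).of_abs
    simpa using hx.tsum_add hy
  map_smul' c x := by
    simp [tsum_mul_left]

theorem lpTailSum_le (m : ℕ) (x : lp (fun _ : ℕ => ℝ) 1) : lpTailSum m x ≤ ‖x‖ := by
  have hx := (summable_nat_add_iff m).2 (summable_lp_one x)
  calc lpTailSum m x ≤ ∑' k, |x (k + m)| := hx.of_abs.tsum_le_tsum (fun k => le_abs_self _) hx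
    _ ≤ ∑' k, |x k| := by
        rw [← (summable_lp_one x).sum_add_tsum_nat_add m]
        exact le_add_of_nonneg_left (Finset.sum_nonneg fun _ _ => abs_nonneg _)
    _ = ‖x‖ := (lp_one_norm_eq x).symm

theorem lpTailSum_single {m n : ℕ} (hmn : m ≤ n) :
    lpTailSum m (lp.single 1 n (1 : ℝ)) = 1 := by
  change ∑' k, (lp.single 1 n (1 : ℝ) : lp (fun _ : ℕ => ℝ) 1) (k + m) = 1
  rw [tsum_eq_single (n - m) fun k hk => ?_]
  · rw [Nat.sub_add_cancel hmn, lp.single_apply_self]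
  · rw [lp.single_apply_ne]
    omega

/-- The separation holds for the unit vectors of `ℓ¹`: the tail sum from `m` on equals `1` on the
convex hull of the unit vectors with index at least `m`, and is small at a given point for large `m`. -/
theorem IsReflexiveSpace.false_of_lp_one_embedding (hE : IsReflexiveSpace E)
    (T : lp (fun _ : ℕ => ℝ) 1 →ₗ[ℝ] E) (hT : ∀ x, ‖x‖ ≤ ‖T x‖) {C : ℝ}
    (hC : ∀ x, ‖T x‖ ≤ C * ‖x‖) : False := by
  refine hE.false_of_separated T hT (e := fun n => lp.single 1 n (1 : ℝ)) (B := C)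
    (fun n => ?_) (c := 1 / 2) (by norm_num) fun x => ?_
  · refine (hC _).trans_eq ?_
    rw [lp.norm_single (by simp), norm_one, mul_one]
  · have h1 : Tendsto (fun m => lpTailSum m x) atTop (𝓝 0) := tendsto_sum_nat_add fun k => x k
    obtain ⟨m, hm⟩ := (h1.eventually_le_const (by norm_num : (0 : ℝ) < 1 / 2)).exists
    refine ⟨m, fun x' hx' => ?_⟩
    have h2 : convexHull ℝ ((fun n => (lp.single 1 n (1 : ℝ) : lp (fun _ : ℕ => ℝ) 1)) '' Ici m) ⊆
        {x | lpTailSum m x = 1} := by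
      refine convexHull_min ?_ (convex_hyperplane (lpTailSum m).isLinear 1)
      rintro _ ⟨n, hn, rfl⟩
      exact lpTailSum_single hn
    have h3 : lpTailSum m x' = 1 := h2 hx'
    have h4 := lpTailSum_le m (x' - x)
    rw [map_sub, h3, norm_sub_rev] at h4
    linarith

theorem abs_apply_le_norm (x : C₀(ℕ, ℝ)) (k : ℕ) : |x k| ≤ ‖x‖ := by
  rw [← ZeroAtInftyContinuousMap.norm_toBCF_eq_norm]
  exact x.toBCF.norm_coe_le_norm k

theorem norm_le_of_forall_abs_le {x : C₀(ℕ, ℝ)} {C : ℝ} (hC : 0 ≤ C) (h : ∀ k, |x k| ≤ C) :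
    ‖x‖ ≤ C := by
  rw [← ZeroAtInftyContinuousMap.norm_toBCF_eq_norm]
  exact (BoundedContinuousFunction.norm_le hC).2 h

theorem tendsto_zero_atTop (x : C₀(ℕ, ℝ)) : Tendsto x atTop (𝓝 0) := by
  have := x.zero_at_infty'
  rwa [cocompact_eq_cofinite, Nat.cofinite_eq_atTop] at this

/-- The element of `c₀` whose coordinates are those of `x` below `n` and `0` from `n` on. -/
def c₀Truncate (n : ℕ) (x : ℕ → ℝ) : C₀(ℕ, ℝ) where
  toFun k := if k < n then x k else 0
  continuous_toFun := continuous_of_discreteTopology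
  zero_at_infty' := by
    rw [cocompact_eq_cofinite, Nat.cofinite_eq_atTop]
    refine tendsto_const_nhds.congr' ?_
    filter_upwards [eventually_ge_atTop n] with k hk
    rw [if_neg (not_lt.2 hk)]

theorem c₀Truncate_apply (n : ℕ) (x : ℕ → ℝ) (k : ℕ) :
    c₀Truncate n x k = if k < n then x k else 0 := rfl

/-- The separation holds for the summing basis of `c₀`, whose `n`-th vector has the coordinates `1`
up to `n` and `0` beyond: the coordinate with index `m` equals `1` on the convex hull of the vectors
with index at least `m`, and is small at a given point for large `m`. -/
theorem IsReflexiveSpace.false_of_c₀_embedding (hE : IsReflexiveSpace E)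
    (T : C₀(ℕ, ℝ) →ₗ[ℝ] E) (hT : ∀ x, ‖x‖ ≤ ‖T x‖) {C : ℝ} (hC0 : 0 ≤ C)
    (hC : ∀ x, ‖T x‖ ≤ C * ‖x‖) : False := by
  refine hE.false_of_separated T hT (e := fun n => c₀Truncate (n + 1) fun _ => 1) (B := C)
    (fun n => ?_) (c := 1 / 2) (by norm_num) fun x => ?_
  · refine (hC _).trans (mul_le_of_le_one_right hC0 (norm_le_of_forall_abs_le zero_le_one ?_))
    intro k
    rw [c₀Truncate_apply]
    split_ifs <;> simp
  · obtain ⟨m, hm⟩ := ((tendsto_zero_atTop x).eventually_le_const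
      (by norm_num : (0 : ℝ) < 1 / 2)).exists
    refine ⟨m, fun x' hx' => ?_⟩
    have h2 : convexHull ℝ ((fun n => c₀Truncate (n + 1) fun _ => 1) '' Ici m) ⊆
        {x : C₀(ℕ, ℝ) | x m = 1} := by
      refine convexHull_min ?_ (convex_hyperplane (f := fun x : C₀(ℕ, ℝ) => x m)
        ⟨fun _ _ => rfl, fun _ _ => rfl⟩ 1)
      rintro _ ⟨n, hn, rfl⟩
      exact if_pos (Nat.lt_succ_of_le hn)
    have h3 : x' m = 1 := h2 hx'
    have h4 := (neg_abs_le _).trans' (neg_le_neg (abs_apply_le_norm (x - x') m))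
    rw [ZeroAtInftyContinuousMap.sub_apply, h3] at h4
    linarith

end Reflexive

/-! ### Sequences of disjoint blocks -/

section

variable {p : ℝ → ℝ} {f g h : LZero} {a b : ℝ} {φ ψ : ℝ → ℝ}

/-- A sequence of disjoint measurable sets `{t ∈ support | index t = n}` of positive measure, such
that `p` is essentially bounded on each of them. -/
structure Blocks (p : ℝ → ℝ) where
  /-- the number of the block that contains a given point of the support -/
  index : ℝ → ℕ
  /-- the union of the blocks -/
  support : Set ℝ
  measurable_index : Measurable index
  measurableSet_support : MeasurableSet support
  measure_ne_zero : ∀ n, unitMeasure {t | t ∈ support ∧ index t = n} ≠ 0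
  bounded : ∀ n, ∃ K : ℝ, ∀ᵐ t ∂unitMeasure, t ∈ support → index t = n → p t ≤ K

namespace Blocks

variable (β : Blocks p)

/-- The function with the constant value `y n` on the `n`-th block, and `0` off the blocks. -/
def step (y : ℕ → ℝ) : LZero :=
  AEEqFun.mk (β.support.indicator fun t => y (β.index t))
    (((measurable_from_nat (f := y)).comp β.measurable_index).indicator
      β.measurableSet_support).aestronglyMeasurable

theorem coeFn_step (y : ℕ → ℝ) : ∀ᵐ t ∂unitMeasure,
    β.step y t = β.support.indicator (fun t => y (β.index t)) t :=
  AEEqFun.coeFn_mk _ _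

theorem step_add (y z : ℕ → ℝ) : β.step (y + z) = β.step y + β.step z := by
  refine AEEqFun.ext ?_
  filter_upwards [β.coeFn_step y, β.coeFn_step z, β.coeFn_step (y + z),
    AEEqFun.coeFn_add (β.step y) (β.step z)] with t h1 h2 h3 h4
  rw [h4, Pi.add_apply, h1, h2, h3]
  by_cases ht : t ∈ β.support <;> simp [ht]

theorem step_smul (c : ℝ) (y : ℕ → ℝ) : β.step (c • y) = c • β.step y := by
  refine AEEqFun.ext ?_
  filter_upwards [β.coeFn_step y, β.coeFn_step (c • y),
    AEEqFun.coeFn_smul c (β.step y)] with t h1 h2 h3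
  rw [h3, Pi.smul_apply, h1, h2]
  by_cases ht : t ∈ β.support <;> simp [ht]

theorem exists_bound_lt (N : ℕ) :
    ∃ K : ℝ, ∀ᵐ t ∂unitMeasure, t ∈ β.support → β.index t < N → p t ≤ K := by
  choose K hK using β.bounded
  refine ⟨∑ n ∈ Finset.range N, |K n|, ?_⟩
  filter_upwards [ae_all_iff.2 hK] with t ht hts htN
  calc p t ≤ K (β.index t) := ht _ hts rfl
    _ ≤ |K (β.index t)| := le_abs_self _
    _ ≤ _ := Finset.single_le_sum (f := fun n => |K n|) (fun _ _ => abs_nonneg _)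
        (Finset.mem_range.2 htN)

theorem step_bounded {N : ℕ} {y : ℕ → ℝ} (hy : ∀ k, N ≤ k → y k = 0) :
    ∃ K : ℝ, ∀ᵐ t ∂unitMeasure, β.step y t ≠ 0 → p t ≤ K := by
  obtain ⟨K, hK⟩ := β.exists_bound_lt N
  refine ⟨K, ?_⟩
  filter_upwards [hK, β.coeFn_step y] with t h1 h2 h3
  rw [h2] at h3
  have hts : t ∈ β.support := mem_of_indicator_ne_zero h3
  refine h1 hts ?_
  by_contra! hN
  exact h3 (by rw [indicator_of_mem hts, hy _ hN])

theorem step_mem_finiteElements (hp : ∀ t ∈ Icc (0 : ℝ) 1, 1 < p t) {N : ℕ} {y : ℕ → ℝ}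
    (hy : ∀ k, N ≤ k → y k = 0) : β.step y ∈ finiteElements p := by
  obtain ⟨K, hK⟩ := β.step_bounded hy
  refine mem_finiteElements_of_modular_lt_top hp hK ?_
  set M : ℝ := 1 + ∑ n ∈ Finset.range N, |y n| with hM
  have hM1 : 1 ≤ M := le_add_of_nonneg_right (Finset.sum_nonneg fun _ _ => abs_nonneg _)
  have hyM : ∀ k, |y k| ≤ M := fun k => by
    rcases le_or_gt N k with hk | hk
    · rw [hy k hk, abs_zero]
      linarith
    · have := Finset.single_le_sum (f := fun n => |y n|) (fun _ _ => abs_nonneg _)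
        (Finset.mem_range.2 hk)
      linarith
  calc modular p (β.step y) ≤ ∫⁻ _, ENNReal.ofReal (M ^ K) ∂unitMeasure := by
        refine lintegral_mono_ae ?_
        filter_upwards [hK, β.coeFn_step y, ae_mem_Icc] with t h1 h2 ht
        have hpt := hp t ht
        refine ENNReal.ofReal_le_ofReal ?_
        by_cases h0 : β.step y t = 0
        · rw [h0, abs_zero, Real.zero_rpow (by linarith), zero_div]
          positivity
        · have h3 : |β.step y t| ≤ M := by
            rw [h2] at h0 ⊢
            rw [indicator_of_mem (mem_of_indicator_ne_zero h0)]
            exact hyM _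
          calc |β.step y t| ^ p t / p t ≤ |β.step y t| ^ p t :=
                div_le_self (by positivity) hpt.le
            _ ≤ M ^ p t := by gcongr
            _ ≤ M ^ K := Real.rpow_le_rpow_of_exponent_le hM1 (h1 h0)
    _ < ⊤ := by
        rw [lintegral_const]
        exact ENNReal.mul_lt_top ENNReal.ofReal_lt_top (measure_lt_top _ _)

theorem step_single_ne_zero (n : ℕ) : β.step (Pi.single n 1) ≠ 0 := by
  intro h0
  refine β.measure_ne_zero n ?_
  have h1 : ∀ᵐ t ∂unitMeasure, ¬(t ∈ β.support ∧ β.index t = n) := by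
    filter_upwards [β.coeFn_step (Pi.single n 1),
      AEEqFun.coeFn_zero (α := ℝ) (β := ℝ) (μ := unitMeasure)] with t h1 h2 h3
    rw [h0, h2, indicator_of_mem h3.1, h3.2, Pi.single_eq_same, Pi.zero_apply] at h1
    exact zero_ne_one h1
  rw [ae_iff] at h1
  simpa using h1

/-- The factor that gives the indicator function of the `n`-th block norm one. -/
def weight (n : ℕ) : ℝ := (lpNorm p (β.step (Pi.single n 1)))⁻¹

/-- The linear map that sends the `n`-th unit vector to the normalized indicator function of the
`n`-th block. -/
def embed : (ℕ → ℝ) →ₗ[ℝ] LZero where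
  toFun x := β.step fun n => β.weight n * x n
  map_add' x y := by
    rw [← step_add]
    congr 1
    ext n
    simp [mul_add]
  map_smul' c x := by
    rw [RingHom.id_apply, ← step_smul]
    congr 1
    ext n
    simp only [Pi.smul_apply, smul_eq_mul]
    ring

theorem embed_apply (x : ℕ → ℝ) : β.embed x = β.step fun n => β.weight n * x n := rfl

theorem coeFn_embed (x : ℕ → ℝ) : ∀ᵐ t ∂unitMeasure,
    β.embed x t = β.support.indicator (fun t => β.weight (β.index t) * x (β.index t)) t :=
  β.coeFn_step fun n => β.weight n * x n

theorem embed_mem_finiteElements_of_eq_zero (hp : ∀ t ∈ Icc (0 : ℝ) 1, 1 < p t) {N : ℕ}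
    {x : ℕ → ℝ} (hx : ∀ k, N ≤ k → x k = 0) : β.embed x ∈ finiteElements p := by
  rw [embed_apply]
  exact β.step_mem_finiteElements hp (N := N) fun k hk => by rw [hx k hk, mul_zero]

theorem lpNorm_embed_single (hpm : AEMeasurable p unitMeasure)
    (hp : ∀ t ∈ Icc (0 : ℝ) 1, 1 < p t) (n : ℕ) (a : ℝ) :
    lpNorm p (β.embed (Pi.single n a)) = |a| := by
  have hu : β.step (Pi.single n 1) ∈ lpClass p := by
    refine mem_lpClass_of_mem_finiteElements hpm hp (β.step_mem_finiteElements hp (N := n + 1) ?_)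
    intro k hk
    rw [Pi.single_eq_of_ne (by omega)]
  have hne : lpNorm p (β.step (Pi.single n 1)) ≠ 0 := fun h =>
    β.step_single_ne_zero n ((lpNorm_eq_zero_iff hpm hp hu).1 h)
  have h1 : β.embed (Pi.single n a) = (β.weight n * a) • β.step (Pi.single n 1) := by
    rw [← step_smul, embed_apply]
    congr 1
    ext k
    rcases eq_or_ne k n with rfl | hk
    · simp
    · simp [Pi.single_eq_of_ne hk]
  rw [h1, lpNorm_smul hp _ hu, abs_mul, weight, abs_inv, abs_of_nonneg (lpNorm_nonneg _ _)]
  field_simp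

/-- The part of a sequence with indices at least `n`. -/
def tail (n : ℕ) (x : ℕ → ℝ) : ℕ → ℝ := fun k => if n ≤ k then x k else 0

/-- The part of a sequence with indices less than `n`. -/
def head (n : ℕ) (x : ℕ → ℝ) : ℕ → ℝ := fun k => if k < n then x k else 0

theorem head_add_tail (n : ℕ) (x : ℕ → ℝ) : head n x + tail n x = x := by
  ext k
  by_cases hk : k < n
  · simp [head, tail, hk, not_le.2 hk]
  · simp [head, tail, hk, not_lt.1 hk]

theorem tail_zero (x : ℕ → ℝ) : tail 0 x = x := by
  ext k
  simp [tail]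

theorem head_eq_zero {n k : ℕ} (hk : n ≤ k) (x : ℕ → ℝ) : head n x k = 0 :=
  if_neg (not_lt.2 hk)

theorem abs_embed_le {x y : ℕ → ℝ} (h : ∀ k, |x k| ≤ |y k|) :
    ∀ᵐ t ∂unitMeasure, |β.embed x t| ≤ |β.embed y t| := by
  filter_upwards [β.coeFn_embed x, β.coeFn_embed y] with t h1 h2
  rw [h1, h2]
  by_cases ht : t ∈ β.support
  · rw [indicator_of_mem ht, indicator_of_mem ht, abs_mul, abs_mul]
    exact mul_le_mul_of_nonneg_left (h _) (abs_nonneg _)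
  · simp [ht]

theorem abs_head_le (n : ℕ) (x : ℕ → ℝ) (k : ℕ) : |head n x k| ≤ |x k| := by
  unfold head
  split_ifs
  · exact le_rfl
  · simp

theorem abs_tail_le (n : ℕ) (x : ℕ → ℝ) (k : ℕ) : |tail n x k| ≤ |x k| := by
  unfold tail
  split_ifs
  · exact le_rfl
  · simp

/-- The first block of a tail and the remaining tail have disjoint supports, so that their `s`-th
powers add up. -/
theorem abs_embed_tail_rpow (n : ℕ) (x : ℕ → ℝ) {s : ℝ} (hs : s ≠ 0) :
    ∀ᵐ t ∂unitMeasure, |β.embed (tail n x) t| ^ s =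
      |β.embed (Pi.single n (x n)) t| ^ s + |β.embed (tail (n + 1) x) t| ^ s := by
  filter_upwards [β.coeFn_embed (tail n x), β.coeFn_embed (Pi.single n (x n)),
    β.coeFn_embed (tail (n + 1) x)] with t h1 h2 h3
  rw [h1, h2, h3]
  by_cases ht : t ∈ β.support
  · simp only [indicator_of_mem ht]
    rcases eq_or_ne (β.index t) n with hn | hn
    · simp [tail, hn, Real.zero_rpow hs]
    · have : n ≤ β.index t ↔ n + 1 ≤ β.index t := by omega
      simp [tail, hn, this, Real.zero_rpow hs]
  · simp [ht, Real.zero_rpow hs]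

theorem tail_eq_zero {N : ℕ} {x : ℕ → ℝ} (hx : ∀ k, N ≤ k → x k = 0) (n : ℕ) :
    ∀ k, N ≤ k → tail n x k = 0 := by
  intro k hk
  simp [tail, hx k hk]

theorem embed_tail_mem_finiteElements (hp : ∀ t ∈ Icc (0 : ℝ) 1, 1 < p t) {N : ℕ} {x : ℕ → ℝ}
    (hx : ∀ k, N ≤ k → x k = 0) (n : ℕ) : β.embed (tail n x) ∈ finiteElements p :=
  β.embed_mem_finiteElements_of_eq_zero hp (tail_eq_zero hx n)

theorem embed_tail_mem_lpClass (hpm : AEMeasurable p unitMeasure)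
    (hp : ∀ t ∈ Icc (0 : ℝ) 1, 1 < p t) {N : ℕ} {x : ℕ → ℝ}
    (hx : ∀ k, N ≤ k → x k = 0) (n : ℕ) : β.embed (tail n x) ∈ lpClass p :=
  mem_lpClass_of_mem_finiteElements hpm hp (β.embed_tail_mem_finiteElements hp hx n)

theorem embed_single_mem_lpClass (hpm : AEMeasurable p unitMeasure)
    (hp : ∀ t ∈ Icc (0 : ℝ) 1, 1 < p t) (n : ℕ) (a : ℝ) :
    β.embed (Pi.single n a) ∈ lpClass p :=
  mem_lpClass_of_mem_finiteElements hpm hp (β.embed_mem_finiteElements_of_eq_zero hp (N := n + 1)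
    fun k hk => by rw [Pi.single_eq_of_ne (by omega)])

/-- A property that holds on the blocks with index at least `n` holds where the image of a tail does
not vanish. -/
theorem of_embed_tail_ne_zero {P : ℝ → Prop} {n : ℕ}
    (h : ∀ᵐ t ∂unitMeasure, t ∈ β.support → n ≤ β.index t → P t) (x : ℕ → ℝ) :
    ∀ᵐ t ∂unitMeasure, β.embed (tail n x) t ≠ 0 → P t := by
  filter_upwards [h, β.coeFn_embed (tail n x)] with t h1 h2 h3
  rw [h2] at h3
  have hts : t ∈ β.support := mem_of_indicator_ne_zero h3
  refine h1 hts ?_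
  by_contra hn
  rw [indicator_of_mem hts] at h3
  simp [tail, hn] at h3

theorem lpNorm_embed_tail_rpow_le (hpm : AEMeasurable p unitMeasure)
    (hp : ∀ t ∈ Icc (0 : ℝ) 1, 1 < p t) {N : ℕ} {x : ℕ → ℝ} (hx : ∀ k, N ≤ k → x k = 0) {n : ℕ}
    {s : ℝ} (hs : 1 ≤ s)
    (hps : ∀ᵐ t ∂unitMeasure, t ∈ β.support → n ≤ β.index t → s ≤ p t) :
    lpNorm p (β.embed (tail n x)) ^ s ≤
      |x n| ^ s + lpNorm p (β.embed (tail (n + 1) x)) ^ s := by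
  rw [← β.lpNorm_embed_single hpm hp n (x n)]
  exact lpNorm_rpow_le_add hp hs (β.embed_single_mem_lpClass hpm hp n _)
    (β.embed_tail_mem_lpClass hpm hp hx _) (β.embed_tail_mem_lpClass hpm hp hx _)
    (β.of_embed_tail_ne_zero hps x)
    ((β.abs_embed_tail_rpow n x (by linarith)).mono fun t ht => ht.le)

theorem le_lpNorm_embed_tail_rpow (hpm : AEMeasurable p unitMeasure)
    (hp : ∀ t ∈ Icc (0 : ℝ) 1, 1 < p t) {N : ℕ} {x : ℕ → ℝ} (hx : ∀ k, N ≤ k → x k = 0) {n : ℕ}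
    {s : ℝ} (hs : 1 ≤ s)
    (hps : ∀ᵐ t ∂unitMeasure, t ∈ β.support → n ≤ β.index t → p t ≤ s) :
    |x n| ^ s + lpNorm p (β.embed (tail (n + 1) x)) ^ s ≤
      lpNorm p (β.embed (tail n x)) ^ s := by
  rw [← β.lpNorm_embed_single hpm hp n (x n)]
  exact add_le_lpNorm_rpow hp hs (β.embed_single_mem_lpClass hpm hp n _)
    (β.embed_tail_mem_lpClass hpm hp hx _) (β.embed_tail_mem_lpClass hpm hp hx _)
    (β.of_embed_tail_ne_zero hps x)
    ((β.abs_embed_tail_rpow n x (by linarith)).mono fun t ht => ht.ge)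

theorem lpNorm_embed_tail_of_le (hp : ∀ t ∈ Icc (0 : ℝ) 1, 1 < p t) {N n : ℕ} {x : ℕ → ℝ}
    (hx : ∀ k, N ≤ k → x k = 0) (hn : N ≤ n) : lpNorm p (β.embed (tail n x)) = 0 := by
  have : tail n x = 0 := by
    ext k
    by_cases hk : n ≤ k
    · simp [tail, hx k (hn.trans hk)]
    · simp [tail, hk]
  rw [this, map_zero, lpNorm_zero hp]

theorem lpNorm_embed_tail_le_sum (hpm : AEMeasurable p unitMeasure)
    (hp : ∀ t ∈ Icc (0 : ℝ) 1, 1 < p t) {N : ℕ} {x : ℕ → ℝ} (hx : ∀ k, N ≤ k → x k = 0) (n : ℕ) :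
    lpNorm p (β.embed (tail n x)) ≤ ∑ k ∈ Finset.Ico n N, |x k| := by
  rcases le_or_gt N n with hn | hn
  · rw [β.lpNorm_embed_tail_of_le hp hx hn, Finset.Ico_eq_empty (not_lt.2 hn), Finset.sum_empty]
  · have h1 := β.lpNorm_embed_tail_rpow_le hpm hp hx (n := n) le_rfl
      (by filter_upwards [ae_mem_Icc] with t ht _ _ using (hp t ht).le)
    simp only [Real.rpow_one] at h1
    rw [Finset.sum_eq_sum_Ico_succ_bot hn]
    linarith [lpNorm_embed_tail_le_sum hpm hp hx (n + 1)]
termination_by N - n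

theorem two_rpow_mul_add_le {r A B : ℝ} (hr : 1 ≤ r) (hA : 0 ≤ A) (hB : 0 ≤ B) :
    2 ^ (r⁻¹ - 1) * (A + B) ≤ (A ^ r + B ^ r) ^ r⁻¹ := by
  have hr0 : 0 < r := by linarith
  have h1 := (convexOn_rpow hr).2 (mem_Ici.2 hA) (mem_Ici.2 hB) (by norm_num : (0 : ℝ) ≤ 1 / 2)
    (by norm_num : (0 : ℝ) ≤ 1 / 2) (by norm_num)
  simp only [smul_eq_mul] at h1
  have h2 : (A + B) ^ r ≤ 2 ^ (r - 1) * (A ^ r + B ^ r) := by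
    have h3 : (A + B) ^ r = 2 ^ r * (1 / 2 * A + 1 / 2 * B) ^ r := by
      rw [← Real.mul_rpow (by norm_num) (by positivity)]
      congr 1
      ring
    rw [h3, Real.rpow_sub_one (by norm_num)]
    have h4 : (0 : ℝ) < 2 ^ r := by positivity
    calc (2 : ℝ) ^ r * (1 / 2 * A + 1 / 2 * B) ^ r
        ≤ 2 ^ r * (1 / 2 * A ^ r + 1 / 2 * B ^ r) := by gcongr
      _ = _ := by ring
  rw [Real.le_rpow_inv_iff_of_pos (by positivity) (by positivity) hr0,
    Real.mul_rpow (by positivity) (by positivity), ← Real.rpow_mul (by norm_num)]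
  calc (2 : ℝ) ^ ((r⁻¹ - 1) * r) * (A + B) ^ r
      ≤ 2 ^ ((r⁻¹ - 1) * r) * (2 ^ (r - 1) * (A ^ r + B ^ r)) := by gcongr
    _ = (2 ^ ((r⁻¹ - 1) * r) * 2 ^ (r - 1)) * (A ^ r + B ^ r) := by ring
    _ = A ^ r + B ^ r := by
        rw [← Real.rpow_add (by norm_num)]
        have : (r⁻¹ - 1) * r + (r - 1) = 0 := by
          field_simp
          ring
        rw [this, Real.rpow_zero, one_mul]

/-- If the exponents on the blocks tend to `1` fast enough, the `ℓ¹` norm is a lower bound up to a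
constant close to one. The error factors `2 ^ (r⁻¹ - 1)` of the steps from one tail to the preceding
one multiply to at least `2 ^ (-η)`. -/
theorem sum_le_lpNorm_embed_tail (hpm : AEMeasurable p unitMeasure)
    (hp : ∀ t ∈ Icc (0 : ℝ) 1, 1 < p t) {η : ℝ} {r : ℕ → ℝ} (hr : ∀ n, 1 ≤ r n)
    (hrη : ∀ n, 1 - (r n)⁻¹ ≤ η / 2 ^ (n + 1))
    (hpr : ∀ n, ∀ᵐ t ∂unitMeasure, t ∈ β.support → n ≤ β.index t → p t ≤ r n)
    {N : ℕ} {x : ℕ → ℝ} (hx : ∀ k, N ≤ k → x k = 0) (n : ℕ) :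
    2 ^ (-(η / 2 ^ n)) * ∑ k ∈ Finset.Ico n N, |x k| ≤ lpNorm p (β.embed (tail n x)) := by
  rcases le_or_gt N n with hn | hn
  · rw [Finset.Ico_eq_empty (not_lt.2 hn), Finset.sum_empty, mul_zero]
    exact lpNorm_nonneg _ _
  · have h1 := β.le_lpNorm_embed_tail_rpow hpm hp hx (hr n) (hpr n)
    have hr0 : 0 < r n := by linarith [hr n]
    have hη : 0 ≤ η / 2 ^ (n + 1) :=
      le_trans (sub_nonneg.2 (inv_le_one_of_one_le₀ (hr n))) (hrη n)
    have ih := sum_le_lpNorm_embed_tail hpm hp hr hrη hpr hx (n + 1)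
    set b := lpNorm p (β.embed (tail n x)) with hb
    set b' := lpNorm p (β.embed (tail (n + 1) x)) with hb'
    set q : ℝ := 2 ^ (-(η / 2 ^ (n + 1))) with hq
    have hq1 : q ≤ 1 := Real.rpow_le_one_of_one_le_of_nonpos (by norm_num) (by linarith)
    have hq0 : 0 < q := by positivity
    have hb0 : 0 ≤ b := lpNorm_nonneg _ _
    have hb0' : 0 ≤ b' := lpNorm_nonneg _ _
    have h2 : (2 : ℝ) ^ (-(η / 2 ^ n)) = q * q := by
      rw [hq, ← Real.rpow_add (by norm_num)]
      congr 1
      rw [pow_succ]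
      field_simp
      ring
    have h3 : q ≤ 2 ^ ((r n)⁻¹ - 1) :=
      Real.rpow_le_rpow_of_exponent_le (by norm_num) (by linarith [hrη n])
    rw [h2, Finset.sum_eq_sum_Ico_succ_bot hn]
    calc q * q * (|x n| + ∑ k ∈ Finset.Ico (n + 1) N, |x k|)
        = q * (q * |x n| + q * ∑ k ∈ Finset.Ico (n + 1) N, |x k|) := by ring
      _ ≤ q * (|x n| + b') := by
          have : q * |x n| ≤ |x n| := mul_le_of_le_one_left (abs_nonneg _) hq1
          gcongr
      _ ≤ 2 ^ ((r n)⁻¹ - 1) * (|x n| + b') := by gcongr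
      _ ≤ (|x n| ^ r n + b' ^ r n) ^ (r n)⁻¹ := two_rpow_mul_add_le (hr n) (abs_nonneg _) hb0'
      _ ≤ (b ^ r n) ^ (r n)⁻¹ := by gcongr
      _ = b := Real.rpow_rpow_inv hb0 hr0.ne'
termination_by N - n

/-- If the exponents on the blocks tend to infinity fast enough, the supremum norm is an upper bound
up to a constant close to one. The factors `2 ^ s⁻¹` of the steps from one tail to the preceding one
multiply to at most `2 ^ η`. -/
theorem lpNorm_embed_tail_le_sup (hpm : AEMeasurable p unitMeasure)
    (hp : ∀ t ∈ Icc (0 : ℝ) 1, 1 < p t) {η : ℝ} {s : ℕ → ℝ} (hs : ∀ n, 1 ≤ s n)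
    (hsη : ∀ n, (s n)⁻¹ ≤ η / 2 ^ (n + 1))
    (hps : ∀ n, ∀ᵐ t ∂unitMeasure, t ∈ β.support → n ≤ β.index t → s n ≤ p t)
    {N : ℕ} {x : ℕ → ℝ} (hx : ∀ k, N ≤ k → x k = 0) {M : ℝ} (hM : 0 ≤ M) (n : ℕ)
    (hxM : ∀ k, n ≤ k → |x k| ≤ M) :
    lpNorm p (β.embed (tail n x)) ≤ 2 ^ (η / 2 ^ n) * M := by
  rcases le_or_gt N n with hn | hn
  · rw [β.lpNorm_embed_tail_of_le hp hx hn]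
    positivity
  · have h1 := β.lpNorm_embed_tail_rpow_le hpm hp hx (hs n) (hps n)
    have hs0 : 0 < s n := by linarith [hs n]
    have hη : 0 ≤ η / 2 ^ (n + 1) := (inv_nonneg.2 hs0.le).trans (hsη n)
    have ih := lpNorm_embed_tail_le_sup hpm hp hs hsη hps hx hM (n + 1)
      fun k hk => hxM k (by omega)
    set b := lpNorm p (β.embed (tail n x)) with hb
    set b' := lpNorm p (β.embed (tail (n + 1) x)) with hb'
    set q : ℝ := 2 ^ (η / 2 ^ (n + 1)) with hq
    have hq1 : 1 ≤ q := Real.one_le_rpow (by norm_num) hη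
    have hb0 : 0 ≤ b := lpNorm_nonneg _ _
    have hb0' : 0 ≤ b' := lpNorm_nonneg _ _
    have h2 : (2 : ℝ) ^ (η / 2 ^ n) = q * q := by
      rw [hq, ← Real.rpow_add (by norm_num)]
      congr 1
      rw [pow_succ]
      field_simp
      ring
    have h3 : (2 : ℝ) ^ (s n)⁻¹ ≤ q := Real.rpow_le_rpow_of_exponent_le (by norm_num) (hsη n)
    have h4 : |x n| ≤ q * M := (hxM n le_rfl).trans (le_mul_of_one_le_left hM hq1)
    rw [h2]
    calc b = (b ^ s n) ^ (s n)⁻¹ := (Real.rpow_rpow_inv hb0 hs0.ne').symm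
      _ ≤ (|x n| ^ s n + b' ^ s n) ^ (s n)⁻¹ := by gcongr
      _ ≤ ((q * M) ^ s n + (q * M) ^ s n) ^ (s n)⁻¹ := by gcongr
      _ = 2 ^ (s n)⁻¹ * (q * M) := by
          rw [← two_mul, Real.mul_rpow (by norm_num) (by positivity),
            Real.rpow_rpow_inv (by positivity) hs0.ne']
      _ ≤ q * (q * M) := by gcongr
      _ = q * q * M := by ring
termination_by N - n

theorem tendsto_embed_head (x : ℕ → ℝ) : ∀ᵐ t ∂unitMeasure,
    Tendsto (fun n => β.embed (head n x) t) atTop (𝓝 (β.embed x t)) := by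
  filter_upwards [ae_all_iff.2 fun n => β.coeFn_embed (head n x), β.coeFn_embed x] with t h1 h2
  refine tendsto_const_nhds.congr' ?_
  filter_upwards [eventually_gt_atTop (β.index t)] with n hn
  rw [h1, h2]
  by_cases ht : t ∈ β.support <;> simp [ht, head, hn]

theorem tendsto_lpNorm_embed_tail (hpm : AEMeasurable p unitMeasure)
    (hp : ∀ t ∈ Icc (0 : ℝ) 1, 1 < p t) {x : ℕ → ℝ} (hx : β.embed x ∈ finiteElements p) :
    Tendsto (fun n => lpNorm p (β.embed (tail n x))) atTop (𝓝 0) := by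
  refine tendsto_lpNorm_zero hpm hp hx (fun n => β.abs_embed_le (abs_tail_le n x)) ?_
  filter_upwards [ae_all_iff.2 fun n => β.coeFn_embed (tail n x)] with t h1
  refine tendsto_const_nhds.congr' ?_
  filter_upwards [eventually_gt_atTop (β.index t)] with n hn
  rw [h1]
  by_cases ht : t ∈ β.support <;> simp [ht, tail, not_le.2 hn]

/-- Bounds for the heads of a sequence carry over to the whole sequence. -/
theorem lpNorm_embed_le (hpm : AEMeasurable p unitMeasure)
    (hp : ∀ t ∈ Icc (0 : ℝ) 1, 1 < p t) {x : ℕ → ℝ} (hx : β.embed x ∈ finiteElements p) {C : ℝ}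
    (hC : ∀ n, lpNorm p (β.embed (head n x)) ≤ C) : lpNorm p (β.embed x) ≤ C := by
  have hlim := (β.tendsto_lpNorm_embed_tail hpm hp hx).const_add C
  rw [add_zero] at hlim
  refine ge_of_tendsto' hlim fun n => ?_
  have h1 : β.embed x = β.embed (head n x) + β.embed (tail n x) := by
    rw [← map_add, head_add_tail]
  have hh : β.embed (head n x) ∈ lpClass p := mem_lpClass_of_mem_finiteElements hpm hp
    (mem_finiteElements_of_abs_le hp hx (β.abs_embed_le (abs_head_le n x)))
  have ht : β.embed (tail n x) ∈ lpClass p := mem_lpClass_of_mem_finiteElements hpm hp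
    (mem_finiteElements_of_abs_le hp hx (β.abs_embed_le (abs_tail_le n x)))
  have h2 := lpNorm_add_le hp hh ht
    (h1 ▸ mem_lpClass_of_mem_finiteElements hpm hp hx)
  rw [← h1] at h2
  linarith [hC n]

/-- The exponent is bounded on the union of finitely many blocks, and by order continuity the heads
approximate the whole function. -/
theorem embed_mem_lpZeroClass (hpm : AEMeasurable p unitMeasure)
    (hp : ∀ t ∈ Icc (0 : ℝ) 1, 1 < p t) {x : ℕ → ℝ} (hx : β.embed x ∈ finiteElements p) :
    β.embed x ∈ lpZeroClass p := by
  refine ⟨mem_lpClass_of_mem_finiteElements hpm hp hx, fun ε hε => ?_⟩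
  obtain ⟨n, hn⟩ := ((β.tendsto_lpNorm_embed_tail hpm hp hx).eventually_lt_const hε).exists
  have hh : β.embed (head n x) ∈ lpClass p := mem_lpClass_of_mem_finiteElements hpm hp
    (mem_finiteElements_of_abs_le hp hx (β.abs_embed_le (abs_head_le n x)))
  have ht : β.embed (tail n x) ∈ lpClass p := mem_lpClass_of_mem_finiteElements hpm hp
    (mem_finiteElements_of_abs_le hp hx (β.abs_embed_le (abs_tail_le n x)))
  have h1 : β.embed x - β.embed (head n x) = β.embed (tail n x) := by
    rw [sub_eq_iff_eq_add', ← map_add, head_add_tail]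
  refine ⟨β.embed (head n x), ?_, h1 ▸ ht, h1 ▸ hn⟩
  obtain ⟨K, hK⟩ := β.step_bounded (N := n) (y := fun k => β.weight k * head n x k)
    fun k hk => by rw [head_eq_zero hk, mul_zero]
  rw [← embed_apply] at hK
  obtain ⟨m, hm⟩ := exists_nat_ge K
  refine mem_iUnion.2 ⟨m, _, hh, ?_⟩
  filter_upwards [hK] with t ht
  by_cases h0 : β.embed (head n x) t = 0
  · rw [h0, indicator_apply_eq_zero.2 fun _ => h0]
  · rw [indicator_of_mem (show t ∈ {t | p t ≤ m} from (ht h0).trans hm)]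

end Blocks

end

/-! ### Almost isometric copies of `ℓ¹` and `c₀` -/

section

variable {p : ℝ → ℝ}

/-- An essentially unbounded function has integer parts `m n` beyond any prescribed bounds `L n` that
are taken on sets of positive measure. -/
theorem exists_strictMono_measure_floor_ne_zero {ρ : ℝ → ℝ}
    (h : ∀ M : ℝ, ¬∀ᵐ t ∂unitMeasure, ρ t ≤ M) (L : ℕ → ℕ) :
    ∃ m : ℕ → ℕ, StrictMono m ∧ ∀ n, L n ≤ m n ∧ unitMeasure {t | ⌊ρ t⌋₊ = m n} ≠ 0 := by
  refine extraction_forall_of_frequently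
    (P := fun n k => L n ≤ k ∧ unitMeasure {t | ⌊ρ t⌋₊ = k} ≠ 0) fun n => ?_
  rw [frequently_atTop]
  intro a
  by_contra! hc
  refine h ((max a (L n) : ℕ) : ℝ) ?_
  have h1 : ∀ᵐ t ∂unitMeasure, ∀ k, max a (L n) ≤ k → ⌊ρ t⌋₊ ≠ k := by
    refine ae_all_iff.2 fun k => ?_
    by_cases hk : max a (L n) ≤ k
    · have h2 := hc k ((le_max_left _ _).trans hk) ((le_max_right _ _).trans hk)
      have h3 : ∀ᵐ t ∂unitMeasure, ⌊ρ t⌋₊ ≠ k := by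
        rw [ae_iff]
        simpa using h2
      exact h3.mono fun t ht _ => ht
    · exact Eventually.of_forall fun t hk' => absurd hk' hk
  filter_upwards [h1] with t ht
  refine (Nat.lt_of_floor_lt ?_).le
  by_contra! hle
  exact ht _ hle rfl

/-- The level sets of the integer part of `ρ` at the values `m n` form a sequence of blocks. -/
theorem exists_blocks {ρ : ℝ → ℝ} (hρ : Measurable ρ) {m : ℕ → ℕ} (hm : StrictMono m)
    (hm0 : ∀ n, unitMeasure {t | ⌊ρ t⌋₊ = m n} ≠ 0)
    (hb : ∀ n, ∃ K : ℝ, ∀ᵐ t ∂unitMeasure, ⌊ρ t⌋₊ = m n → p t ≤ K) :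
    ∃ β : Blocks p, ∀ t ∈ β.support, ⌊ρ t⌋₊ = m (β.index t) := by
  have hfl : Measurable fun t => ⌊ρ t⌋₊ := Nat.measurable_floor.comp hρ
  have hinv : ∀ n, Function.invFun m (m n) = n := Function.leftInverse_invFun hm.injective
  have hlev : ∀ t n, (⌊ρ t⌋₊ ∈ range m ∧ Function.invFun m ⌊ρ t⌋₊ = n) ↔ ⌊ρ t⌋₊ = m n := by
    intro t n
    constructor
    · rintro ⟨⟨k, hk⟩, hn⟩
      rw [← hk, hinv] at hn
      rw [← hk, hn]
    · intro h
      exact ⟨⟨n, h.symm⟩, by rw [h, hinv]⟩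
  refine ⟨{ index := fun t => Function.invFun m ⌊ρ t⌋₊
            support := {t | ⌊ρ t⌋₊ ∈ range m}
            measurable_index := (measurable_from_nat (f := Function.invFun m)).comp hfl
            measurableSet_support := hfl (MeasurableSet.of_discrete (s := range m))
            measure_ne_zero := fun n => ?_
            bounded := fun n => ?_ }, ?_⟩
  · simp only [mem_ofPred_eq, hlev]
    exact hm0 n
  · obtain ⟨K, hK⟩ := hb n
    refine ⟨K, hK.mono fun t ht h1 h2 => ht ((hlev t n).1 ⟨h1, h2⟩)⟩
  · intro t ht
    exact (hlev t _).1 ⟨ht, rfl⟩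

namespace Blocks

variable (β : Blocks p)

theorem modular_smul_embed_le_one (hpm : AEMeasurable p unitMeasure)
    (hp : ∀ t ∈ Icc (0 : ℝ) 1, 1 < p t) {x : ℕ → ℝ} {c C : ℝ} (hcC : |c| * C < 1)
    (hC : ∀ n, lpNorm p (β.embed (head n x)) ≤ C) : modular p (c • β.embed x) ≤ 1 := by
  refine modular_le_of_tendsto hpm hp (u := fun n => c • β.embed (head n x)) ?_
    (Eventually.of_forall fun n => ?_)
  · filter_upwards [β.tendsto_embed_head x, coeFn_smul_abs c (β.embed x),
      ae_all_iff.2 fun n => coeFn_smul_abs c (β.embed (head n x))] with t h1 h2 h3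
    simp only [h2, h3]
    exact h1.abs.const_mul _
  · have h1 : β.embed (head n x) ∈ lpClass p := mem_lpClass_of_mem_finiteElements hpm hp
      (β.embed_mem_finiteElements_of_eq_zero hp fun k hk => head_eq_zero hk x)
    refine modular_smul_le_one hp h1 (lt_of_le_of_lt ?_ hcC)
    have := hC n
    gcongr

theorem lpNorm_embed_head_le (hpm : AEMeasurable p unitMeasure)
    (hp : ∀ t ∈ Icc (0 : ℝ) 1, 1 < p t) {x : ℕ → ℝ} (hx : β.embed x ∈ finiteElements p) (n : ℕ) :
    lpNorm p (β.embed (head n x)) ≤ lpNorm p (β.embed x) := by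
  have h1 := β.abs_embed_le (abs_head_le n x)
  exact lpNorm_mono hp (mem_lpClass_of_mem_finiteElements hpm hp
    (mem_finiteElements_of_abs_le hp hx h1)) (mem_lpClass_of_mem_finiteElements hpm hp hx) h1

theorem sum_abs_head (n : ℕ) (x : ℕ → ℝ) :
    ∑ k ∈ Finset.Ico 0 n, |head n x k| = ∑ k ∈ Finset.range n, |x k| := by
  rw [← Finset.range_eq_Ico]
  exact Finset.sum_congr rfl fun k hk => by rw [head, if_pos (Finset.mem_range.1 hk)]

theorem embed_lp_one_mem_finiteElements (hpm : AEMeasurable p unitMeasure)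
    (hp : ∀ t ∈ Icc (0 : ℝ) 1, 1 < p t) {K : ℝ}
    (hK : ∀ᵐ t ∂unitMeasure, t ∈ β.support → p t ≤ K) (x : lp (fun _ : ℕ => ℝ) 1) :
    β.embed x ∈ finiteElements p ∧ lpNorm p (β.embed x) ≤ ‖x‖ := by
  have hC : ∀ n, lpNorm p (β.embed (head n x)) ≤ ‖x‖ := fun n => by
    have h1 := β.lpNorm_embed_tail_le_sum hpm hp (N := n) (x := head n x)
      (fun k hk => head_eq_zero hk x) 0
    rw [tail_zero, sum_abs_head] at h1
    refine h1.trans ?_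
    rw [lp_one_norm_eq]
    exact (summable_lp_one x).sum_le_tsum _ fun _ _ => abs_nonneg _
  have hc0 : 0 < (‖x‖ + 1)⁻¹ := by positivity
  have h1 : modular p ((‖x‖ + 1)⁻¹ • β.embed x) ≤ 1 :=
    β.modular_smul_embed_le_one hpm hp (by
      rw [abs_of_pos hc0, inv_mul_lt_iff₀ (by positivity)]
      linarith) hC
  have h2 : (‖x‖ + 1)⁻¹ • β.embed x ∈ finiteElements p := by
    refine mem_finiteElements_of_modular_lt_top hp (K := K) ?_ (h1.trans_lt ENNReal.one_lt_top)
    filter_upwards [hK, β.coeFn_embed x, coeFn_smul_abs (‖x‖ + 1)⁻¹ (β.embed x)] with t h3 h4 h5 h6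
    refine h3 ?_
    by_contra hts
    rw [h4, indicator_of_notMem hts, abs_zero, mul_zero, abs_eq_zero] at h5
    exact h6 h5
  have h3 := smul_mem_finiteElements (‖x‖ + 1) h2
  rw [smul_smul, mul_inv_cancel₀ (by positivity), one_smul] at h3
  exact ⟨h3, β.lpNorm_embed_le hpm hp h3 hC⟩

theorem norm_le_lpNorm_embed_lp_one (hpm : AEMeasurable p unitMeasure)
    (hp : ∀ t ∈ Icc (0 : ℝ) 1, 1 < p t) {η : ℝ} {r : ℕ → ℝ} (hr : ∀ n, 1 ≤ r n)
    (hrη : ∀ n, 1 - (r n)⁻¹ ≤ η / 2 ^ (n + 1))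
    (hpr : ∀ n, ∀ᵐ t ∂unitMeasure, t ∈ β.support → n ≤ β.index t → p t ≤ r n)
    (x : lp (fun _ : ℕ => ℝ) 1) (hx : β.embed x ∈ finiteElements p) :
    2 ^ (-η) * ‖x‖ ≤ lpNorm p (β.embed x) := by
  rw [lp_one_norm_eq]
  refine le_of_tendsto' ((summable_lp_one x).hasSum.tendsto_sum_nat.const_mul _) fun n => ?_
  have h1 := β.sum_le_lpNorm_embed_tail hpm hp hr hrη hpr (N := n) (x := head n x)
    (fun k hk => head_eq_zero hk x) 0
  rw [tail_zero, sum_abs_head, pow_zero, div_one] at h1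
  exact h1.trans (β.lpNorm_embed_head_le hpm hp hx n)

theorem lpNorm_embed_head_le_sup (hpm : AEMeasurable p unitMeasure)
    (hp : ∀ t ∈ Icc (0 : ℝ) 1, 1 < p t) {η : ℝ} {s : ℕ → ℝ} (hs : ∀ n, 1 ≤ s n)
    (hsη : ∀ n, (s n)⁻¹ ≤ η / 2 ^ (n + 1))
    (hps : ∀ n, ∀ᵐ t ∂unitMeasure, t ∈ β.support → n ≤ β.index t → s n ≤ p t)
    {x : ℕ → ℝ} {M : ℝ} (hM : 0 ≤ M) (hxM : ∀ k, |x k| ≤ M) (n : ℕ) :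
    lpNorm p (β.embed (head n x)) ≤ 2 ^ η * M := by
  have h1 := β.lpNorm_embed_tail_le_sup hpm hp hs hsη hps (N := n) (x := head n x)
    (fun k hk => head_eq_zero hk x) hM 0 fun k _ => (abs_head_le n x k).trans (hxM k)
  rwa [tail_zero, pow_zero, div_one] at h1

theorem embed_c₀_mem_finiteElements (hpm : AEMeasurable p unitMeasure)
    (hp : ∀ t ∈ Icc (0 : ℝ) 1, 1 < p t) {η : ℝ} {s : ℕ → ℝ} (hs : ∀ n, 1 ≤ s n)
    (hsη : ∀ n, (s n)⁻¹ ≤ η / 2 ^ (n + 1))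
    (hps : ∀ n, ∀ᵐ t ∂unitMeasure, t ∈ β.support → n ≤ β.index t → s n ≤ p t)
    (x : C₀(ℕ, ℝ)) : β.embed x ∈ finiteElements p := by
  intro c
  -- beyond a large index the coordinates are so small that the norm bound for the tail applies
  set M : ℝ := (2 * (2 * |c| + 1) * 2 ^ η)⁻¹ with hM
  have hM0 : 0 < M := by positivity
  obtain ⟨n, hn⟩ := eventually_atTop.1
    ((tendsto_zero_atTop x).abs.eventually_le_const (by rwa [abs_zero]))
  have hxM : ∀ k, |tail n x k| ≤ M := fun k => by
    by_cases hk : n ≤ k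
    · rw [tail, if_pos hk]
      exact hn k hk
    · rw [tail, if_neg hk, abs_zero]
      exact hM0.le
  have h1 : modular p ((c * 2) • β.embed (tail n x)) ≤ 1 := by
    refine β.modular_smul_embed_le_one hpm hp ?_
      (β.lpNorm_embed_head_le_sup hpm hp hs hsη hps hM0.le hxM)
    have h2 : (2 : ℝ) ^ η * M = (2 * (2 * |c| + 1))⁻¹ := by
      rw [hM, mul_inv_rev, ← mul_assoc, mul_inv_cancel₀ (by positivity), one_mul]
    rw [h2, abs_mul, abs_two, ← div_eq_mul_inv, div_lt_one (by positivity)]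
    linarith [abs_nonneg c]
  have h2 : β.embed (head n x) ∈ finiteElements p :=
    β.embed_mem_finiteElements_of_eq_zero hp fun k hk => head_eq_zero hk x
  have h3 : c • β.embed x = c • β.embed (head n x) + c • β.embed (tail n x) := by
    rw [← smul_add, ← map_add, head_add_tail]
  rw [h3]
  refine (modular_add_le hpm hp _ _).trans_lt (ENNReal.add_lt_top.2 ⟨?_, ?_⟩)
  · rw [smul_smul]
    exact h2 _
  · rw [smul_smul, mul_comm]
    exact h1.trans_lt ENNReal.one_lt_top

end Blocks

/-- The coordinates of an element of `ℓ¹`, as a linear map. -/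
def lpCoe : lp (fun _ : ℕ => ℝ) 1 →ₗ[ℝ] (ℕ → ℝ) where
  toFun x := x
  map_add' _ _ := rfl
  map_smul' _ _ := rfl

/-- The coordinates of an element of `c₀`, as a linear map. -/
def c₀Coe : C₀(ℕ, ℝ) →ₗ[ℝ] (ℕ → ℝ) where
  toFun x := x
  map_add' _ _ := rfl
  map_smul' _ _ := rfl

/-- The exponent `η` to be distributed over the blocks in the portions `η / 2 ^ (n + 1)`. -/
theorem exists_two_rpow_eq {ε : ℝ} (hε : 0 < ε) : ∃ η : ℝ, 0 < η ∧ (2 : ℝ) ^ η = 1 + ε :=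
  ⟨Real.logb 2 (1 + ε), Real.logb_pos (by norm_num) (by linarith),
    Real.rpow_logb (by norm_num) (by norm_num) (by linarith)⟩

theorem inv_natCast_le {η : ℝ} (hη : 0 < η) {n m : ℕ} (h : ⌈2 ^ (n + 1) / η⌉₊ + 1 ≤ m) :
    ((m : ℝ))⁻¹ ≤ η / 2 ^ (n + 1) := by
  have h1 : 2 ^ (n + 1) / η ≤ m := by
    have h2 : ((⌈2 ^ (n + 1) / η⌉₊ + 1 : ℕ) : ℝ) ≤ m := by exact_mod_cast h
    push_cast at h2
    linarith [Nat.le_ceil (2 ^ (n + 1) / η)]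
  rw [inv_le_comm₀ (by
    have : 1 ≤ m := by omega
    exact_mod_cast this) (by positivity), inv_div]
  exact h1

/-- Blocks on which `(p - 1)⁻¹` has rapidly increasing integer parts carry an almost isometric copy
of `ℓ¹`. The factor `1 + ε` turns the lower bound `(1 + ε)⁻¹ * ‖x‖` into `‖x‖`. -/
theorem containsAlmostIsometrically_lp_one (hpm : AEMeasurable p unitMeasure)
    (hp : ∀ t ∈ Icc (0 : ℝ) 1, 1 < p t)
    (h : ∀ s : ℝ, 1 < s → ¬∀ᵐ t ∂unitMeasure, s ≤ p t) :
    ContainsAlmostIsometrically (lpZeroClass p) (lpNorm p) (lp (fun _ : ℕ => ℝ) 1) := by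
  intro ε hε
  obtain ⟨η, hη, hηε⟩ := exists_two_rpow_eq hε
  -- a measurable representative, whose level sets serve as blocks
  set p' := hpm.mk p with hp'
  have hpp' : ∀ᵐ t ∂unitMeasure, p t = p' t := hpm.ae_eq_mk
  set ρ : ℝ → ℝ := fun t => (p' t - 1)⁻¹ with hρ
  have hρm : Measurable ρ := (hpm.measurable_mk.sub_const 1).inv
  have hρu : ∀ M : ℝ, ¬∀ᵐ t ∂unitMeasure, ρ t ≤ M := by
    intro M hM
    refine h (1 + (max M 1)⁻¹) (by
      have : 0 < max M 1 := zero_lt_one.trans_le (le_max_right _ _)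
      linarith [inv_pos.2 this]) ?_
    filter_upwards [hM, hpp', ae_mem_Icc] with t h1 h2 ht
    have hpt := hp t ht
    simp only [hρ, ← h2] at h1
    have h3 : (p t - 1)⁻¹ ≤ max M 1 := h1.trans (le_max_left _ _)
    have h4 := inv_anti₀ (inv_pos.2 (by linarith)) h3
    rw [inv_inv] at h4
    linarith
  obtain ⟨m, hm, hmL⟩ := exists_strictMono_measure_floor_ne_zero hρu
    fun n => ⌈2 ^ (n + 1) / η⌉₊ + 1
  have hm1 : ∀ n, (1 : ℝ) ≤ m n := fun n => by
    have : 1 ≤ m n := by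
      have := (hmL n).1
      omega
    exact_mod_cast this
  have hlev : ∀ᵐ t ∂unitMeasure, ∀ n, ⌊ρ t⌋₊ = m n → p t ≤ 1 + ((m n : ℝ))⁻¹ := by
    filter_upwards [hpp', ae_mem_Icc] with t h1 ht n h2
    have hpt := hp t ht
    have hρt : 0 < ρ t := by
      simp only [hρ, ← h1]
      exact inv_pos.2 (by linarith)
    have h3 := Nat.floor_le hρt.le
    rw [h2] at h3
    have h4 := inv_anti₀ (zero_lt_one.trans_le (hm1 n)) h3
    simp only [hρ, inv_inv, ← h1] at h4
    linarith
  obtain ⟨β, hβ⟩ := exists_blocks (p := p) hρm hm (fun n => (hmL n).2)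
    fun n => ⟨_, hlev.mono fun t ht => ht n⟩
  set r : ℕ → ℝ := fun n => 1 + ((m n : ℝ))⁻¹ with hr
  have hr1 : ∀ n, 1 ≤ r n := fun n => by
    have : 0 ≤ ((m n : ℝ))⁻¹ := by positivity
    linarith
  have hrη : ∀ n, 1 - (r n)⁻¹ ≤ η / 2 ^ (n + 1) := fun n => by
    refine le_trans ?_ (inv_natCast_le hη (hmL n).1)
    have h0 : 0 < r n := by linarith [hr1 n]
    have h1 : 1 - (r n)⁻¹ = (r n - 1) * (r n)⁻¹ := by
      rw [sub_mul, mul_inv_cancel₀ h0.ne', one_mul]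
    have h2 : (r n)⁻¹ ≤ 1 := inv_le_one_of_one_le₀ (hr1 n)
    have h3 : r n - 1 = ((m n : ℝ))⁻¹ := by simp [hr]
    rw [h1, h3]
    exact mul_le_of_le_one_right (by positivity) h2
  have hpr : ∀ n, ∀ᵐ t ∂unitMeasure, t ∈ β.support → n ≤ β.index t → p t ≤ r n := fun n => by
    filter_upwards [hlev] with t ht hts hn
    refine (ht _ (hβ t hts)).trans ?_
    have h1 : (m n : ℝ) ≤ m (β.index t) := by exact_mod_cast hm.monotone hn
    have h2 := inv_anti₀ (zero_lt_one.trans_le (hm1 n)) h1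
    simp only [hr]
    linarith
  refine ⟨(1 + ε) • (β.embed ∘ₗ lpCoe), fun x => ?_⟩
  obtain ⟨hx, hxu⟩ := β.embed_lp_one_mem_finiteElements hpm hp
    ((hpr 0).mono fun t ht hts => ht hts (Nat.zero_le _)) x
  have hxl := β.norm_le_lpNorm_embed_lp_one hpm hp hr1 hrη hpr x hx
  have hT : ((1 + ε) • (β.embed ∘ₗ lpCoe)) x = β.embed ((1 + ε) • ⇑x) := by
    rw [map_smul]
    rfl
  have hN : lpNorm p (β.embed ((1 + ε) • ⇑x)) = (1 + ε) * lpNorm p (β.embed x) := by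
    rw [map_smul, lpNorm_smul hp _ (mem_lpClass_of_mem_finiteElements hpm hp hx),
      abs_of_pos (by linarith)]
  rw [hT]
  refine ⟨β.embed_mem_lpZeroClass hpm hp ?_, ?_, ?_⟩
  · rw [map_smul]
    exact smul_mem_finiteElements _ hx
  · rw [hN]
    rw [Real.rpow_neg (by norm_num), hηε, inv_mul_le_iff₀ (by linarith)] at hxl
    exact hxl
  · rw [hN]
    gcongr

/-- Blocks on which `p` has rapidly increasing integer parts carry an almost isometric copy of `c₀`. -/
theorem containsAlmostIsometrically_c₀ (hpm : AEMeasurable p unitMeasure)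
    (hp : ∀ t ∈ Icc (0 : ℝ) 1, 1 < p t)
    (h : ∀ K : ℝ, ¬∀ᵐ t ∂unitMeasure, p t ≤ K) :
    ContainsAlmostIsometrically (lpZeroClass p) (lpNorm p) C₀(ℕ, ℝ) := by
  intro ε hε
  obtain ⟨η, hη, hηε⟩ := exists_two_rpow_eq hε
  -- a measurable representative, whose level sets serve as blocks
  set p' := hpm.mk p with hp'
  have hpp' : ∀ᵐ t ∂unitMeasure, p t = p' t := hpm.ae_eq_mk
  have hρu : ∀ M : ℝ, ¬∀ᵐ t ∂unitMeasure, p' t ≤ M := by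
    intro M hM
    refine h M ?_
    filter_upwards [hM, hpp'] with t h1 h2
    rwa [h2]
  obtain ⟨m, hm, hmL⟩ := exists_strictMono_measure_floor_ne_zero hρu
    fun n => ⌈2 ^ (n + 1) / η⌉₊ + 1
  have hlev : ∀ᵐ t ∂unitMeasure, ∀ n, ⌊p' t⌋₊ = m n → (m n : ℝ) ≤ p t ∧ p t ≤ m n + 1 := by
    filter_upwards [hpp', ae_mem_Icc] with t h1 ht n h2
    have hpt := hp t ht
    rw [← h1] at h2
    rw [← h2]
    exact ⟨Nat.floor_le (by linarith), (Nat.lt_floor_add_one _).le⟩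
  obtain ⟨β, hβ⟩ := exists_blocks (p := p) hpm.measurable_mk hm (fun n => (hmL n).2)
    fun n => ⟨_, hlev.mono fun t ht hn => (ht n hn).2⟩
  set s : ℕ → ℝ := fun n => m n with hs
  have hs1 : ∀ n, 1 ≤ s n := fun n => by
    have : 1 ≤ m n := by
      have := (hmL n).1
      omega
    simp only [hs]
    exact_mod_cast this
  have hsη : ∀ n, (s n)⁻¹ ≤ η / 2 ^ (n + 1) := fun n => inv_natCast_le hη (hmL n).1
  have hps : ∀ n, ∀ᵐ t ∂unitMeasure, t ∈ β.support → n ≤ β.index t → s n ≤ p t := fun n => by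
    filter_upwards [hlev] with t ht hts hn
    refine le_trans ?_ (ht _ (hβ t hts)).1
    simp only [hs]
    exact_mod_cast hm.monotone hn
  refine ⟨β.embed ∘ₗ c₀Coe, fun x => ?_⟩
  have hx := β.embed_c₀_mem_finiteElements hpm hp hs1 hsη hps x
  have hT : (β.embed ∘ₗ c₀Coe) x = β.embed x := rfl
  rw [hT]
  refine ⟨β.embed_mem_lpZeroClass hpm hp hx, ?_, ?_⟩
  · refine norm_le_of_forall_abs_le (lpNorm_nonneg _ _) fun n => ?_
    rw [← β.lpNorm_embed_single hpm hp n (x n)]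
    refine lpNorm_mono hp (β.embed_single_mem_lpClass hpm hp n _)
      (mem_lpClass_of_mem_finiteElements hpm hp hx) (β.abs_embed_le fun k => ?_)
    rcases eq_or_ne k n with rfl | hk
    · rw [Pi.single_eq_same]
    · rw [Pi.single_eq_of_ne hk, abs_zero]
      exact abs_nonneg _
  · rw [← hηε]
    exact β.lpNorm_embed_le hpm hp hx
      (β.lpNorm_embed_head_le_sup hpm hp hs1 hsη hps (norm_nonneg x) (abs_apply_le_norm x))

/-! ### The equivalence -/

theorem ae_bounds_of_one_lt_essInf (h1 : 1 < essInf (fun t => (p t : EReal)) unitMeasure)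
    (h2 : essSup (fun t => (p t : EReal)) unitMeasure < ⊤) :
    ∃ s : ℝ, 1 < s ∧ s ≤ 2 ∧ ∃ n : ℕ, 1 ≤ n ∧ (∀ᵐ t ∂unitMeasure, s ≤ p t) ∧
      ∀ᵐ t ∂unitMeasure, p t ≤ ((2 * n : ℕ) : ℝ) := by
  obtain ⟨s, hs1, hs⟩ := EReal.lt_iff_exists_real_btwn.1 h1
  obtain ⟨K, hK, -⟩ := EReal.lt_iff_exists_real_btwn.1 h2
  have hs1' : 1 < s := by exact_mod_cast hs1
  obtain ⟨n, hn⟩ := exists_nat_ge K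
  -- the exponents for the two-point inequalities: at most `2` from below, even from above
  refine ⟨min s 2, lt_min hs1' (by norm_num), min_le_right _ _, n + 1, by omega, ?_, ?_⟩
  · filter_upwards [ae_lt_of_lt_essInf hs] with t ht
    have : s < p t := by exact_mod_cast ht
    exact (min_le_left _ _).trans this.le
  · filter_upwards [ae_lt_of_essSup_lt hK] with t ht
    have : p t < K := by exact_mod_cast ht
    push_cast
    have : (0 : ℝ) ≤ n := n.cast_nonneg
    linarith

theorem one_lt_essInf_of_ae_le {s : ℝ} (hs : 1 < s) (h : ∀ᵐ t ∂unitMeasure, s ≤ p t) :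
    1 < essInf (fun t => (p t : EReal)) unitMeasure := by
  have h1 : ((s : ℝ) : EReal) ≤ essInf (fun t => (p t : EReal)) unitMeasure :=
    le_essInf_of_ae_le _ (h.mono fun t ht => EReal.coe_le_coe_iff.2 ht)
  exact lt_of_lt_of_le (by exact_mod_cast hs) h1

theorem essSup_lt_top_of_ae_le {K : ℝ} (h : ∀ᵐ t ∂unitMeasure, p t ≤ K) :
    essSup (fun t => (p t : EReal)) unitMeasure < ⊤ := by
  have h1 : essSup (fun t => (p t : EReal)) unitMeasure ≤ ((K : ℝ) : EReal) :=
    essSup_le_of_ae_le _ (h.mono fun t ht => EReal.coe_le_coe_iff.2 ht)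
  exact lt_of_le_of_lt h1 (EReal.coe_lt_top K)

/-- An almost isometric copy of `X` in a normed function space is the range of an embedding into the
corresponding normed space. -/
theorem ContainsAlmostIsometrically.exists_embedding
    (H : IsNormedFunctionSpace (lpClass p) (lpNorm p)) {X : Type*} [NormedAddCommGroup X]
    [NormedSpace ℝ X] (h : ContainsAlmostIsometrically (lpZeroClass p) (lpNorm p) X) :
    ∃ T : X →ₗ[ℝ] H.Space, (∀ x, ‖x‖ ≤ ‖T x‖) ∧ ∀ x, ‖T x‖ ≤ 2 * ‖x‖ := by
  obtain ⟨T, hT⟩ := h 1 one_pos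
  refine ⟨T.codRestrict H.toSubmodule fun x => (hT x).1.1, fun x => (hT x).2.1, fun x => ?_⟩
  have := (hT x).2.2
  rw [one_add_one_eq_two] at this
  exact this

end

end VarExp

end

theorem mainTheorem1 (p : ℝ → ℝ) (hp_meas : AEMeasurable p VarExp.unitMeasure)
    (hp : ∀ t ∈ Set.Icc (0 : ℝ) 1, 1 < p t) :
    List.TFAE
      [ -- the class is a Banach space that is uniformly convex and uniformly smooth
        ∃ h : VarExp.IsNormedFunctionSpace (VarExp.lpClass p) (VarExp.lpNorm p),
          CompleteSpace h.Space ∧ UniformConvexSpace h.Space ∧ VarExp.IsUniformlySmooth h.Space,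
        -- the class is a reflexive Banach space
        ∃ h : VarExp.IsNormedFunctionSpace (VarExp.lpClass p) (VarExp.lpNorm p),
          CompleteSpace h.Space ∧ VarExp.IsReflexiveSpace h.Space,
        -- neither `ℓ¹` nor `c₀` is contained almost isometrically
        ¬ VarExp.ContainsAlmostIsometrically (VarExp.lpZeroClass p) (VarExp.lpNorm p)
            (lp (fun _ : ℕ => ℝ) 1) ∧
          ¬ VarExp.ContainsAlmostIsometrically (VarExp.lpZeroClass p) (VarExp.lpNorm p)
            C₀(ℕ, ℝ),
        -- `ess inf p > 1` and `ess sup p < ∞`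
        1 < essInf (fun t => (p t : EReal)) VarExp.unitMeasure ∧
          essSup (fun t => (p t : EReal)) VarExp.unitMeasure < ⊤ ] := by
  tfae_have 1 → 2 := by
    rintro ⟨H, hc, huc, -⟩
    exact ⟨H, hc, VarExp.isReflexiveSpace_of_uniformConvexSpace⟩
  tfae_have 2 → 3 := by
    rintro ⟨H, -, hr⟩
    constructor
    · intro h
      obtain ⟨T, h1, h2⟩ := h.exists_embedding H
      exact hr.false_of_lp_one_embedding T h1 h2
    · intro h
      obtain ⟨T, h1, h2⟩ := h.exists_embedding H
      exact hr.false_of_c₀_embedding T h1 zero_le_two h2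
  tfae_have 3 → 4 := by
    rintro ⟨h1, h2⟩
    constructor
    · by_contra hinf
      exact h1 (VarExp.containsAlmostIsometrically_lp_one hp_meas hp fun s hs hsp =>
        hinf (VarExp.one_lt_essInf_of_ae_le hs hsp))
    · by_contra hsup
      exact h2 (VarExp.containsAlmostIsometrically_c₀ hp_meas hp fun K hK =>
        hsup (VarExp.essSup_lt_top_of_ae_le hK))
  tfae_have 4 → 1 := by
    rintro ⟨h1, h2⟩
    obtain ⟨s, hs, hs2, n, hn, hps, hpn⟩ := VarExp.ae_bounds_of_one_lt_essInf h1 h2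
    have h2n : (2 : ℝ) ≤ ((2 * n : ℕ) : ℝ) := by exact_mod_cast (by omega : 2 ≤ 2 * n)
    have H := VarExp.isNormedFunctionSpace hp_meas hp hpn
    exact ⟨H, VarExp.completeSpace hp_meas hp hpn H,
      VarExp.uniformConvexSpace hp_meas hp hs hs2 h2n hps hpn H,
      VarExp.isUniformlySmooth hp_meas hp hs hs2 hn hps hpn H⟩
  tfae_finish
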